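/- **Conventions.** All structures are $\in$-structures on sets. A model of MK is a pair $(M,\mathcal C)$ with $M$ a transitive set (the sets of the model) and $\mathcal C$ a set of subsets of $M$ (its classes) satisfying the two-sorted Morse–Kelley axioms: Extensionality, Pairing, Infinity, Union, Power Set for sets; Foundation and Extensionality for classes, Replacement, full Class-Comprehension (formulas with set and class parameters and quantifiers), and Global Choice (a class well-ordering of all sets). It is a *$\beta$-model* if a class of $\mathcal C$, seen as a binary relation, is well-founded in $(M,\mathcal C)$ iff it is really well-founded. Write $(B)_y=\{z\mid (y,z)\in B\}$. *MK\*\** is MK together with the following schemes, for all formulas $\varphi$ with parameters: - Class-Bounding: $\forall x\,\exists A\,\varphi(x,A)\to\exists B\,\forall x\,\exists y\,\varphi(x,(B)_y)$; - $DC_\infty$: $\forall\vec X\,\exists Y\,\varphi(\vec X,Y)\to\forall X\,\exists\vec Z\,\bigl(Z_0=X\wedge\forall i\in \mathrm{ORD}\,(i>0\to\varphi(\vec Z\restriction i,Z_i))\bigr)$, where $\vec X$ ranges over sequences of classes of ordinal length and $\vec Z$ is an $\mathrm{ORD}$-length sequence of classes (a sequence being given by its length and the class of pairs $(i,z)$ with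 $z$ in its $i$-th term). *SetMK\*\** is the theory consisting of ZFC$^-$ (ZFC without Power Set, with Collection, and with Choice in the form that every set can be well-ordered) and the statement that there is a strongly inaccessible cardinal $\kappa$ (uncountable, regular, and every $\alpha<\kappa$ has a power set, of cardinality less than $\kappa$) such that every set can be mapped injectively into $\kappa$ and $\kappa$-Dependent Choice holds: for all formulas $\varphi$ with parameters, $\forall\vec x\,\exists y\,\varphi(\vec x,y)\to\forall x\,\exists\vec z\,\bigl(z_0=x\wedge\forall i<\kappa\,(i>0\to\varphi(\vec z\restriction i,z_i))\bigr)$, where $\vec x$ ranges over sequences of sets of length less than $\kappa$ and $\vec z$ is a sequence of length $\kappa$. A *coding pair* in $(M,\mathcal C)$ is a pair $(M_0,R)$ with $M_0,R\in\mathcal C$, $M_0$ having a distinguished element $a$, and $R$ a well-founded binary relation on $M_0$ such that: (a) for every $z\in M_0$ there is a unique $n$ such that there is an $R$-chain $z\,R\,z_{n-1}\,R\cdots R\,z_1\,R\,a$ ("$z$ is on level $n$"); (b) if $y\ne z$, $y\,R\,x$ and $z\,R\,x$, then $(M_0,R)\restriction y\not\cong(M_0,R)\restriction z$, where $(M_0,R)\restriction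 y$ consists of $y$ and all elements connected to $y$ by an $R$-chain; (c) if $y\neq z$ are on the same level, then no $v$ satisfies both $v\,R\,y$ and $v\,R\,z$. Let $(\tilde M_0,\tilde R)$ be the quotient of $(M_0,R)$ by the equivalence $y\approx z\iff (M_0,R)\restriction y\cong(M_0,R)\restriction z$, with two classes $\tilde R$-related iff they have $R$-related members. The pair $(M_0,R)$ *codes* $x$ if $(\tilde M_0,\tilde R)\cong(TC(\{x\}),\in)$. Finally, for a transitive model $N$ and a cardinal $\kappa$ of $N$, $V_\kappa^N$ is the collection of elements of $N$ of rank less than $\kappa$. **Proposition 20.** 1. Let $(M,\mathcal C)$ be a $\beta$-model of MK\*\* and let $M^+=\{x\mid \text{there is a coding pair in }(M,\mathcal C)\text{ that codes }x\}$. Then $M^+$ is a set, and it is the unique transitive set such that (a) $M^+\models$ SetMK\*\*; (b) $\mathcal C=P(M)\cap M^+$; (c) $M=V_\kappa^{M^+}$ for some $\kappa$ that is the largest cardinal in $M^+$ and strongly inaccessible in $M^+$. 2. Conversely, let $N$ be a transitive model of SetMK\*\*, let $\kappa$ be a strongly inaccessible cardinal in $N$, and put $M=V_\kappa^{N}$ and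 $\mathcal C=P(M)\cap N$. Then $(M,\mathcal C)$ is a $\beta$-model of MK\*\*. -/

import Mathlib

universe u

namespace ClassTheory

/-! ### First-order set theory over a set `N`, two-sorted class theory over a pair `(M, 𝒞)`

Formulas and satisfaction are those of `FirstOrder.Language`; a relation "given by a formula with
parameters" is a relation definable with arbitrary parameters (`Set.univ.Definable`). -/

/-- The only symbol of set theory: binary membership. -/
inductive SetRel : ℕ → Type
  | mem : SetRel 2

/-- The language of set theory. -/
def setLang : FirstOrder.Language.{0, 0} := ⟨fun _ => Empty, SetRel⟩

/-- The structure `(N, ∈)`. -/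
instance setStructure (N : ZFSet.{u}) : setLang.Structure {x : ZFSet.{u} // x ∈ N} where
  funMap := fun f _ => f.elim
  RelMap := fun {_} r v => match r, v with
    | .mem, v => (v 0).1 ∈ (v 1).1

/-- The symbols of class theory: the predicate "is of the sort of sets" and membership. -/
inductive ClassRel : ℕ → Type
  | isSet : ClassRel 1
  | mem : ClassRel 2

/-- The two-sorted language of class theory, presented with a predicate for the sort of sets. -/
def classLang : FirstOrder.Language.{0, 0} := ⟨fun _ => Empty, ClassRel⟩

/-- The two-sorted universe of `(M, 𝒞)`: `Sum.inl` is the sort of sets, `Sum.inr` the sort of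
classes. -/
abbrev TwoSorted (M C : ZFSet.{u}) : Type (u + 1) :=
  {x : ZFSet.{u} // x ∈ M} ⊕ {X : ZFSet.{u} // X ∈ C}

/-- Membership in the two-sorted structure: only "set ∈ set" and "set ∈ class" can hold. -/
def TwoSorted.Mem {M C : ZFSet.{u}} : TwoSorted M C → TwoSorted M C → Prop
  | .inl x, .inl y => x.1 ∈ y.1
  | .inl x, .inr Y => x.1 ∈ Y.1
  | .inr _, _ => False

/-- The two-sorted structure `(M, ∈, 𝒞)`. -/
instance classStructure (M C : ZFSet.{u}) : classLang.Structure (TwoSorted M C) where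
  funMap := fun f _ => f.elim
  RelMap := fun {_} r v => match r, v with
    | .isSet, v => (v 0).isLeft = true
    | .mem, v => (v 0).Mem (v 1)

/-- A unary predicate defined by a formula with parameters. -/
def Def₁ (L : FirstOrder.Language.{0, 0}) {U : Type*} [L.Structure U] (φ : U → Prop) : Prop :=
  (Set.univ : Set U).Definable L {v : Fin 1 → U | φ (v 0)}

/-- A binary relation defined by a formula with parameters. -/
def Def₂ (L : FirstOrder.Language.{0, 0}) {U : Type*} [L.Structure U] (φ : U → U → Prop) : Prop :=
  (Set.univ : Set U).Definable L {v : Fin 2 → U | φ (v 0) (v 1)}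

/-- A ternary relation defined by a formula with parameters. -/
def Def₃ (L : FirstOrder.Language.{0, 0}) {U : Type*} [L.Structure U] (φ : U → U → U → Prop) : Prop :=
  (Set.univ : Set U).Definable L {v : Fin 3 → U | φ (v 0) (v 1) (v 2)}

/-! ### Sets and classes as relations, functions and sequences -/

/-- `u R v`, for a set or class `R` of ordered pairs. -/
def PairRel (R u v : ZFSet.{u}) : Prop := ZFSet.pair u v ∈ R

/-- `(B)_y = {z | (y, z) ∈ B}`. -/
noncomputable def slice (B y : ZFSet.{u}) : ZFSet.{u} :=
  (ZFSet.sUnion (ZFSet.sUnion B)).sep fun z => ZFSet.pair y z ∈ B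

theorem mem_slice {B y z : ZFSet.{u}} : z ∈ slice B y ↔ ZFSet.pair y z ∈ B := by
  unfold slice
  rw [ZFSet.mem_sep]
  refine ⟨And.right, fun h => ⟨?_, h⟩⟩
  refine ZFSet.mem_sUnion.2 ⟨{y, z}, ZFSet.mem_sUnion.2 ⟨_, h, ?_⟩, ?_⟩
  · simp [ZFSet.pair]
  · simp

/-- `F ↾ i`: the pairs of `F` with first component in `i`. -/
noncomputable def restrict (F i : ZFSet.{u}) : ZFSet.{u} :=
  F.sep fun p => ∃ j ∈ i, ∃ z, p = ZFSet.pair j z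

/-- All elements of `F` are pairs with first component in `α`. -/
def IndexedBy (F α : ZFSet.{u}) : Prop := ∀ p ∈ F, ∃ i ∈ α, ∃ z, p = ZFSet.pair i z

/-- `f` is a function with domain `α`, that is, a sequence of length `α`. -/
def IsSeq (f α : ZFSet.{u}) : Prop :=
  IndexedBy f α ∧ ∀ i ∈ α, ∃! y, ZFSet.pair i y ∈ f

/-- `f` is an injective function from `x` to `y`. -/
def IsInjection (f x y : ZFSet.{u}) : Prop :=
  ZFSet.IsFunc x y f ∧ ∀ a b c, ZFSet.pair a c ∈ f → ZFSet.pair b c ∈ f → a = b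

/-- `W` is a (strict) well-ordering of `D` from the point of view of `K`: it is a strict linear
order of `D`, and every nonempty subset of `D` that belongs to `K` has a `W`-least element. -/
def WellOrders (K W D : ZFSet.{u}) : Prop :=
  (∀ x ∈ D, ¬ PairRel W x x) ∧
  (∀ x ∈ D, ∀ y ∈ D, ∀ z ∈ D, PairRel W x y → PairRel W y z → PairRel W x z) ∧
  (∀ x ∈ D, ∀ y ∈ D, x = y ∨ PairRel W x y ∨ PairRel W y x) ∧
  (∀ S ∈ K, S ⊆ D → S.Nonempty → ∃ m ∈ S, ∀ y ∈ S, y ≠ m → PairRel W m y)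

/-! ### Morse-Kelley class theory -/

/-- `(M, ∈, 𝒞)` is a model of MK: `M` is transitive, the classes are subsets of `M`, and the axioms
hold, with set quantifiers ranging over `M` and class quantifiers over `𝒞`. -/
structure IsModelMK (M C : ZFSet.{u}) : Prop where
  transitive : M.IsTransitive
  classes_subset : ∀ X ∈ C, X ⊆ M
  set_ext : ∀ x ∈ M, ∀ y ∈ M, (∀ z ∈ M, z ∈ x ↔ z ∈ y) → x = y
  pairing : ∀ x ∈ M, ∀ y ∈ M, ∃ p ∈ M, ∀ z ∈ M, z ∈ p ↔ z = x ∨ z = y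
  infinity : ∃ w ∈ M, (∃ e ∈ M, e ∈ w ∧ ∀ z ∈ M, z ∉ e) ∧
    ∀ x ∈ M, x ∈ w → ∃ s ∈ M, s ∈ w ∧ ∀ z ∈ M, z ∈ s ↔ z ∈ x ∨ z = x
  union : ∀ x ∈ M, ∃ s ∈ M, ∀ z ∈ M, z ∈ s ↔ ∃ y ∈ M, y ∈ x ∧ z ∈ y
  powerset : ∀ x ∈ M, ∃ p ∈ M, ∀ z ∈ M, z ∈ p ↔ ∀ w ∈ M, w ∈ z → w ∈ x
  foundation : ∀ X ∈ C, (∃ x ∈ M, x ∈ X) → ∃ x ∈ M, x ∈ X ∧ ∀ y ∈ M, y ∈ X → y ∉ x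
  class_ext : ∀ X ∈ C, ∀ Y ∈ C, (∀ z ∈ M, z ∈ X ↔ z ∈ Y) → X = Y
  replacement : ∀ F ∈ C, (∀ p ∈ F, ∃ x y, p = ZFSet.pair x y) →
    (∀ x y z, ZFSet.pair x y ∈ F → ZFSet.pair x z ∈ F → y = z) →
    ∀ x ∈ M, ∃ y ∈ M, ∀ w ∈ M, w ∈ y ↔ ∃ z ∈ M, z ∈ x ∧ ZFSet.pair z w ∈ F
  comprehension : ∀ φ : TwoSorted M C → Prop, Def₁ classLang φ →
    ∃ Y ∈ C, ∀ x : {x // x ∈ M}, x.1 ∈ Y ↔ φ (.inl x)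
  global_choice : ∃ W ∈ C, WellOrders C W M

/-- Class-Bounding: `∀ x ∃ A φ(x, A) → ∃ B ∀ x ∃ y φ(x, (B)_y)`. -/
def ClassBounding (M C : ZFSet.{u}) : Prop :=
  ∀ φ : TwoSorted M C → TwoSorted M C → Prop, Def₂ classLang φ →
    (∀ x : {x // x ∈ M}, ∃ A : {X // X ∈ C}, φ (.inl x) (.inr A)) →
    ∃ B ∈ C, ∀ x : {x // x ∈ M}, ∃ y ∈ M, ∃ A : {X // X ∈ C},
      A.1 = slice B y ∧ φ (.inl x) (.inr A)

/-- Dependent Choice for classes, `DC_∞`. An `α`-length sequence of classes is the pair of the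
ordinal `α` and a class `X` of pairs with first components in `α`; its `i`-th term is `(X)_i`.
An `ORD`-length sequence is likewise a class `Z`, with `i`-th term `(Z)_i`. -/
def ClassDC (M C : ZFSet.{u}) : Prop :=
  ∀ φ : TwoSorted M C → TwoSorted M C → TwoSorted M C → Prop, Def₃ classLang φ →
    (∀ α : {x // x ∈ M}, α.1.IsOrdinal → ∀ X : {X // X ∈ C}, IndexedBy X.1 α.1 →
      ∃ Y : {X // X ∈ C}, φ (.inl α) (.inr X) (.inr Y)) →
    ∀ X ∈ C, ∃ Z ∈ C, slice Z ∅ = X ∧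
      ∀ i : {x // x ∈ M}, i.1.IsOrdinal → i.1 ≠ ∅ →
        ∃ P Y : {X // X ∈ C}, P.1 = restrict Z i.1 ∧ Y.1 = slice Z i.1 ∧
          φ (.inl i) (.inr P) (.inr Y)

/-- `(M, 𝒞)` is a model of MK** = MK + Class-Bounding + `DC_∞`. -/
structure IsModelMKss (M C : ZFSet.{u}) : Prop extends IsModelMK M C where
  class_bounding : ClassBounding M C
  class_dc : ClassDC M C

/-- The β-model property: a class (relation) is well-founded in `(M, 𝒞)` if and only if it is
well-founded. -/
def IsBeta (C : ZFSet.{u}) : Prop :=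
  ∀ R ∈ C, (∀ X ∈ C, X.Nonempty → ∃ m ∈ X, ∀ y ∈ X, ¬ PairRel R y m) ↔ WellFounded (PairRel R)

/-! ### The set theory SetMK**

All notions below are for transitive sets `N`; ordered pairs, functions, ordinals, `ω`, and rank are
absolute for the transitive models in question, so they are taken in the ambient universe, while
quantifiers over arbitrary sets (functions, subsets, ...) range over `N`. -/

/-- The transitive set `N` is a model of ZFC⁻ (no power set axiom), with Separation, Collection, and
Choice in the form that every set can be well-ordered. -/
structure IsModelZFCminus (N : ZFSet.{u}) : Prop where
  ext : ∀ x ∈ N, ∀ y ∈ N, (∀ z ∈ N, z ∈ x ↔ z ∈ y) → x = y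
  foundation : ∀ x ∈ N, (∃ y ∈ N, y ∈ x) → ∃ y ∈ N, y ∈ x ∧ ∀ z ∈ N, z ∈ x → z ∉ y
  pairing : ∀ x ∈ N, ∀ y ∈ N, ∃ p ∈ N, ∀ z ∈ N, z ∈ p ↔ z = x ∨ z = y
  union : ∀ x ∈ N, ∃ s ∈ N, ∀ z ∈ N, z ∈ s ↔ ∃ y ∈ N, y ∈ x ∧ z ∈ y
  infinity : ∃ w ∈ N, (∃ e ∈ N, e ∈ w ∧ ∀ z ∈ N, z ∉ e) ∧
    ∀ x ∈ N, x ∈ w → ∃ s ∈ N, s ∈ w ∧ ∀ z ∈ N, z ∈ s ↔ z ∈ x ∨ z = x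
  separation : ∀ φ : {x // x ∈ N} → Prop, Def₁ setLang φ →
    ∀ a ∈ N, ∃ b ∈ N, ∀ x : {x // x ∈ N}, x.1 ∈ b ↔ x.1 ∈ a ∧ φ x
  collection : ∀ φ : {x // x ∈ N} → {x // x ∈ N} → Prop, Def₂ setLang φ →
    ∀ a ∈ N, (∀ x : {x // x ∈ N}, x.1 ∈ a → ∃ y, φ x y) →
      ∃ b ∈ N, ∀ x : {x // x ∈ N}, x.1 ∈ a → ∃ y : {x // x ∈ N}, y.1 ∈ b ∧ φ x y
  choice : ∀ x ∈ N, ∃ W ∈ N, WellOrders N W x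

/-- `κ` is a cardinal in `N`. -/
def IsCardinalIn (N κ : ZFSet.{u}) : Prop :=
  κ ∈ N ∧ κ.IsOrdinal ∧ ∀ α ∈ κ, ¬ ∃ f ∈ N, IsInjection f κ α

/-- `κ` is the largest cardinal in `N`. -/
def IsLargestCardinalIn (N κ : ZFSet.{u}) : Prop :=
  IsCardinalIn N κ ∧ ∀ μ, IsCardinalIn N μ → μ ⊆ κ

/-- `κ` is a strongly inaccessible cardinal in `N`: an uncountable regular cardinal such that every
`α < κ` has a power set in `N`, which has cardinality less than `κ` in `N`. -/
structure IsStronglyInaccessibleIn (N κ : ZFSet.{u}) : Prop where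
  cardinal : IsCardinalIn N κ
  uncountable : ZFSet.omega ∈ κ
  regular : ∀ α ∈ κ, ∀ f ∈ N, ZFSet.IsFunc α κ f →
    ∃ β ∈ κ, ∀ i γ, ZFSet.pair i γ ∈ f → γ ∈ β
  strong_limit : ∀ α ∈ κ, ∃ p ∈ N, (∀ z ∈ N, z ∈ p ↔ z ⊆ α) ∧
    ∃ β ∈ κ, ∃ f ∈ N, IsInjection f p β

/-- `κ`-Dependent Choice in `N`, for sequences of sets: if every `<κ`-length sequence `f` has some
`y` with `φ(f, y)`, then for every `x` there is a `κ`-length sequence `z` with `z_0 = x` and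
`φ(z ↾ i, z_i)` for all `0 < i < κ`. -/
def DCIn (N κ : ZFSet.{u}) : Prop :=
  ∀ φ : {x // x ∈ N} → {x // x ∈ N} → Prop, Def₂ setLang φ →
    (∀ α ∈ κ, ∀ f : {x // x ∈ N}, IsSeq f.1 α → ∃ y, φ f y) →
    ∀ x ∈ N, ∃ z ∈ N, IsSeq z κ ∧ ZFSet.pair ∅ x ∈ z ∧
      ∀ i ∈ κ, i ≠ ∅ → ∃ f y : {x // x ∈ N},
        f.1 = restrict z i ∧ ZFSet.pair i y.1 ∈ z ∧ φ f y

/-- The transitive set `N` is a model of SetMK**: ZFC⁻, and there is a strongly inaccessible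
cardinal `κ` such that every set can be mapped injectively into `κ` and `κ`-Dependent Choice
holds. -/
structure IsModelSetMKss (N : ZFSet.{u}) : Prop extends IsModelZFCminus N where
  inaccessible : ∃ κ, IsStronglyInaccessibleIn N κ ∧
    (∀ x ∈ N, ∃ f ∈ N, IsInjection f x κ) ∧ DCIn N κ

/-- `V_κ^N`: the elements of `N` of rank less than `κ` (for an ordinal `κ`). -/
noncomputable def VIn (N κ : ZFSet.{u}) : ZFSet.{u} := N.sep fun x => x.rank < κ.rank

/-! ### Coding pairs -/

/-- `RChain R n z a`: there is an `R`-chain `z R z_{n-1} R ... R z_1 R a` of length `n`. -/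
def RChain (R : ZFSet.{u}) : ℕ → ZFSet.{u} → ZFSet.{u} → Prop
  | 0, z, a => z = a
  | n + 1, z, a => ∃ w, PairRel R z w ∧ RChain R n w a

/-- `w` is a node of `(M₀, R) ↾ y`: it is `y` or is connected to `y` by an `R`-chain. -/
def InSubtree (M₀ R y w : ZFSet.{u}) : Prop :=
  w ∈ M₀ ∧ Relation.ReflTransGen (PairRel R) w y

/-- `(M₀, R) ↾ y` and `(M₀, R) ↾ z` are isomorphic. -/
def SubtreeIso (M₀ R y z : ZFSet.{u}) : Prop :=
  Nonempty (Subrel (PairRel R) (InSubtree M₀ R y) ≃r Subrel (PairRel R) (InSubtree M₀ R z))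

/-- `(M₀, R)` is a coding pair, with distinguished element `a`, in the β-model with classes `𝒞`. -/
structure IsCodingPair (C M₀ R a : ZFSet.{u}) : Prop where
  mem_left : M₀ ∈ C
  mem_right : R ∈ C
  top_mem : a ∈ M₀
  relation : ∀ p ∈ R, ∃ x ∈ M₀, ∃ y ∈ M₀, p = ZFSet.pair x y
  level : ∀ z ∈ M₀, ∃! n, RChain R n z a
  rigid : ∀ x ∈ M₀, ∀ y ∈ M₀, ∀ z ∈ M₀, y ≠ z → PairRel R y x → PairRel R z x → ¬ SubtreeIso M₀ R y z
  disjoint : ∀ n, ∀ y ∈ M₀, ∀ z ∈ M₀, RChain R n y a → RChain R n z a → y ≠ z →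
    ∀ v, PairRel R v y → ¬ PairRel R v z
  wf : WellFounded (PairRel R)

/-- The equivalence of nodes that have isomorphic subtrees. -/
def nodeSetoid (M₀ R : ZFSet.{u}) : Setoid {y : ZFSet.{u} // y ∈ M₀} where
  r y z := SubtreeIso M₀ R y.1 z.1
  iseqv := ⟨fun _ => ⟨RelIso.refl _⟩, fun ⟨e⟩ => ⟨e.symm⟩, fun ⟨e⟩ ⟨f⟩ => ⟨e.trans f⟩⟩

/-- The relation `R̃` on the quotient `M̃₀`: some member of the first equivalence class is `R`-related
to some member of the second. -/
def quotRel (M₀ R : ZFSet.{u}) (p q : Quotient (nodeSetoid M₀ R)) : Prop :=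
  ∃ y z : {y : ZFSet.{u} // y ∈ M₀},
    Quotient.mk (nodeSetoid M₀ R) y = p ∧ Quotient.mk (nodeSetoid M₀ R) z = q ∧ PairRel R y.1 z.1

/-- `TC({x})`, the transitive closure of `{x}`. -/
def TCSingleton (x : ZFSet.{u}) : Type (u + 1) :=
  {y : ZFSet.{u} // Relation.ReflTransGen (fun s t : ZFSet.{u} => s ∈ t) y x}

/-- `(M₀, R)` codes `x`: the quotient `(M̃₀, R̃)` is isomorphic to `(TC({x}), ∈)`. (There is at most
one such `x`, as transitive sets that are isomorphic with respect to `∈` are equal.) -/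
def Codes (M₀ R x : ZFSet.{u}) : Prop :=
  Nonempty (quotRel M₀ R ≃r fun s t : TCSingleton x => s.1 ∈ t.1)

/-- `M⁺`, as a class of the ambient universe: all `x` for which there is a coding pair. -/
def codedSets (C : ZFSet.{u}) : Set ZFSet.{u} :=
  {x | ∃ M₀ R a, IsCodingPair C M₀ R a ∧ Codes M₀ R x}

/-- The properties that characterize `M⁺` among the transitive sets `N`: `N ⊨ SetMK**`,
`𝒞 = P(M) ∩ N`, and `M = V_κ^N` where `κ` is the largest cardinal in `N` and strongly inaccessible
in `N`. -/
structure IsAssociated (M C N : ZFSet.{u}) : Prop where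
  transitive : N.IsTransitive
  model : IsModelSetMKss N
  classes_eq : C = M.powerset ∩ N
  sets_eq : ∃ κ, M = VIn N κ ∧ IsLargestCardinalIn N κ ∧ IsStronglyInaccessibleIn N κ

end ClassTheory

/-! Codes and sets are linked by the Mostowski collapse. A well-founded class relation `X` stands
for the set `collapse X ∅`, with `∅` as top node, and `hull C` is the set of all these values. Such
relations need be neither trees nor extensional, which makes codes easy to build; coding pairs
return only at the end, as trees of descending paths.

From classes to sets: two codes have the same value iff a class bisimulation relates their tops
(`IsModelMK.eqCode_iff`), and by the β-property real well-foundedness is expressed by class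
quantifiers (`IsBeta.dp_wellFounded`). Hence the first-order theory of the hull is interpreted in
`(M, 𝒞)` (`IsBeta.dp_of_hull`, an instance of `definable_interpret`). Comprehension then gives
Separation, Class-Bounding gives Collection (`IsBeta.isZF_hull`), and `DC_∞` gives `κ`-Dependent
Choice (`IsBeta.dcIn_hull`), where `κ` is the set of ordinals of `M`. The elements of a coded set
are collapses of nodes in `M`, and Global Choice, refined by rank, injects `M` into `κ`
(`IsModelMK.injIn_ordinals`). So every set of the hull injects into `κ`: this yields Choice and
makes `κ` the largest cardinal. The membership class of `M` collapses to itself, whence `𝒞 = P(M) ∩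
hull C`; Replacement gives `M = V_κ` and the inaccessibility of `κ`.

Uniqueness: if `N` is associated with `(M, 𝒞)`, each of its sets lies in a transitive `t ∈ N` that
injects into `κ`. Copying membership of `t` to `κ` gives a class that codes the set
(`IsZF.exists_copy`). Conversely `N` is closed under collapses (`IsZF.exists_sim`).

From sets to classes: the levels `V_γ^N` with `γ < κ` are elements of `N` of size below `κ`, so
`V_κ^N ∈ N`, and the class structure is interpreted in `N` by tagging its two sorts
(`IsZF.dp_of_definable`). The β-property holds because `N` can carry out the recursion that
witnesses well-foundedness (`IsZF.wellFounded_of_internal`).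

The hull is `M⁺`: a coding pair codes the collapse of its distinguished element
(`IsCodingPair.collapse_eq`). In the other direction an extensional code is unravelled into its tree
of descending paths, a coding pair in which nodes with equal collapse have isomorphic subtrees
(`IsTreeOf.isCodingPair_and_codes`). -/

set_option linter.unusedVariables false
set_option linter.unusedSectionVars false

/-! ### Definability over a transitive set, decided by instance search -/

namespace ClassTheory
open Set FirstOrder FirstOrder.Language

/-- A predicate of `n` sets that is definable, with parameters, in the structure `(T, ∈)`. -/
class Dp (T : ZFSet.{u}) {n : ℕ} (P : (Fin n → ZFSet.{u}) → Prop) : Prop where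
  out : (Set.univ : Set {x // x ∈ T}).Definable setLang
    {v : Fin n → {x // x ∈ T} | P fun i => (v i).1}

/-- A variable, or a constant from `T`. -/
class Tm (T : ZFSet.{u}) {n : ℕ} (t : (Fin n → ZFSet.{u}) → ZFSet.{u}) : Prop where
  out : (∃ i, t = fun v => v i) ∨ ∃ c ∈ T, t = fun _ => c

instance Tm.var {T : ZFSet.{u}} {n : ℕ} (i : Fin n) : Tm T (fun v : Fin n → ZFSet.{u} => v i) :=
  ⟨.inl ⟨i, rfl⟩⟩

instance Tm.const {T : ZFSet.{u}} {n : ℕ} (c : ZFSet.{u}) [h : Fact (c ∈ T)] :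
    Tm T (fun _ : Fin n → ZFSet.{u} => c) :=
  ⟨.inr ⟨c, h.out, rfl⟩⟩

/-- Passing under a quantifier reindexes the variables by `Fin.succ`. This instance recognises an
outer term in the inner context, so that instance search can go through binders. -/
instance Tm.comp {T : ZFSet.{u}} {n m : ℕ} (f : Fin n → Fin m)
    {t : (Fin n → ZFSet.{u}) → ZFSet.{u}} [h : Tm T t] :
    Tm T fun w : Fin m → ZFSet.{u} => t fun i => w (f i) := by
  rcases h.out with ⟨i, rfl⟩ | ⟨c, hc, rfl⟩
  exacts [⟨.inl ⟨_, rfl⟩⟩, ⟨.inr ⟨c, hc, rfl⟩⟩]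

theorem Tm.mem {T : ZFSet.{u}} {n : ℕ} {t : (Fin n → ZFSet.{u}) → ZFSet.{u}} [h : Tm T t]
    {v : Fin n → ZFSet.{u}} (hv : ∀ i, v i ∈ T) : t v ∈ T := by
  rcases h.out with ⟨i, rfl⟩ | ⟨c, hc, rfl⟩
  exacts [hv i, hc]

/-- Only arguments from `T` matter for the equivalence; this is where absoluteness facts about `T`
enter definability proofs. -/
theorem Dp.congr {T : ZFSet.{u}} {n : ℕ} {P Q : (Fin n → ZFSet.{u}) → Prop} (h : Dp T P)
    (e : ∀ v, (∀ i, v i ∈ T) → (Q v ↔ P v)) : Dp T Q := by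
  refine ⟨?_⟩
  convert h.out using 1
  ext v
  exact e _ fun i => (v i).2

theorem Dp.subst {T : ZFSet.{u}} {n k : ℕ} {P : (Fin k → ZFSet.{u}) → Prop} (h : Dp T P)
    (t : Fin k → (Fin n → ZFSet.{u}) → ZFSet.{u}) (ht : ∀ i, Tm T (t i)) :
    Dp T fun v => P fun i => t i v := by
  refine ⟨?_⟩
  let F : (Fin n → {x // x ∈ T}) → (Fin k → {x // x ∈ T}) :=
    fun v i => ⟨t i fun j => (v j).1, Tm.mem (h := ht i) fun j => (v j).2⟩
  have hF : (Set.univ : Set {x // x ∈ T}).DefinableMap setLang F := by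
    intro i
    rcases (ht i).out with ⟨j, hj⟩ | ⟨c, hc, hj⟩
    · have : (fun v => F v i) = fun v => v j := by
        funext v; apply Subtype.ext; simp [F, hj]
      rw [this]
      exact DefinableFun.proj _
    · have : (fun v => F v i) = fun v => ⟨c, hc⟩ := by
        funext v; apply Subtype.ext; simp [F, hj]
      rw [this]
      exact definableFun_const _ _ (Set.mem_univ _)
  exact Definable.preimage_map hF h.out

section calculus

variable {T : ZFSet.{u}} {n : ℕ}

instance Dp.and {P Q : (Fin n → ZFSet.{u}) → Prop} [hP : Dp T P] [hQ : Dp T Q] :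
    Dp T fun v => P v ∧ Q v := ⟨hP.out.inter hQ.out⟩

instance Dp.or {P Q : (Fin n → ZFSet.{u}) → Prop} [hP : Dp T P] [hQ : Dp T Q] :
    Dp T fun v => P v ∨ Q v := ⟨hP.out.union hQ.out⟩

instance Dp.not {P : (Fin n → ZFSet.{u}) → Prop} [hP : Dp T P] :
    Dp T fun v => ¬ P v := ⟨hP.out.compl⟩

instance Dp.imp {P Q : (Fin n → ZFSet.{u}) → Prop} [hP : Dp T P] [hQ : Dp T Q] :
    Dp T fun v => P v → Q v :=
  (inferInstance : Dp T fun v => ¬ P v ∨ Q v).congr fun v _ => by tauto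

instance Dp.iff {P Q : (Fin n → ZFSet.{u}) → Prop} [hP : Dp T P] [hQ : Dp T Q] :
    Dp T fun v => P v ↔ Q v :=
  (inferInstance : Dp T fun v => (P v → Q v) ∧ (Q v → P v)).congr fun v _ => by tauto

theorem Dp.true : Dp T fun _ : Fin n → ZFSet.{u} => True := ⟨by simp⟩

instance Dp.prop (p : Prop) : Dp T fun _ : Fin n → ZFSet.{u} => p := by
  by_cases hp : p
  · exact Dp.true.congr (by simp [hp])
  · exact (Dp.not (hP := Dp.true)).congr (by simp [hp])

instance Dp.mem {t s : (Fin n → ZFSet.{u}) → ZFSet.{u}} [ht : Tm T t] [hs : Tm T s] :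
    Dp T fun v => t v ∈ s v := by
  have h2 : Dp T fun v : Fin 2 → ZFSet.{u} => v 0 ∈ v 1 := by
    refine ⟨Definable.mono (empty_definable_iff.2
      ⟨BoundedFormula.rel (n := 0) (L := setLang) (l := 2) SetRel.mem
        fun i => Term.var (Sum.inl i), ?_⟩) (Set.empty_subset _)⟩
    ext v
    rfl
  exact h2.subst ![t, s] fun i => by fin_cases i <;> assumption

instance Dp.eq {t s : (Fin n → ZFSet.{u}) → ZFSet.{u}} [ht : Tm T t] [hs : Tm T s] :
    Dp T fun v => t v = s v := by
  have h2 : Dp T fun v : Fin 2 → ZFSet.{u} => v 0 = v 1 := by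
    refine ⟨Definable.mono (empty_definable_iff.2
      ⟨(Term.var 0).equal (Term.var 1), ?_⟩) (Set.empty_subset _)⟩
    ext v
    exact Subtype.ext_iff.symm
  exact h2.subst ![t, s] fun i => by fin_cases i <;> assumption

theorem Dp.exAux {P : (Fin n → ZFSet.{u}) → ZFSet.{u} → Prop}
    (hP : Dp T fun w : Fin (n + 1) → ZFSet.{u} => P (fun i => w i.succ) (w 0)) :
    Dp T fun v => ∃ x, x ∈ T ∧ P v x := by
  refine ⟨?_⟩
  convert hP.out.image_comp Fin.succ using 1
  ext v
  constructor
  · rintro ⟨x, hx, h⟩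
    refine ⟨Fin.cons ⟨x, hx⟩ v, ?_, ?_⟩
    · simpa using h
    · ext i; simp
  · rintro ⟨w, hw, rfl⟩
    exact ⟨_, (w 0).2, hw⟩

instance Dp.exT {P : (Fin n → ZFSet.{u}) → ZFSet.{u} → Prop}
    [hP : Dp T fun w : Fin (n + 1) → ZFSet.{u} => P (fun i => w i.succ) (w 0)] :
    Dp T fun v => ∃ x, x ∈ T ∧ P v x := Dp.exAux hP

instance Dp.allT {P : (Fin n → ZFSet.{u}) → ZFSet.{u} → Prop}
    [hP : Dp T fun w : Fin (n + 1) → ZFSet.{u} => P (fun i => w i.succ) (w 0)] :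
    Dp T fun v => ∀ x, x ∈ T → P v x :=
  (inferInstance : Dp T fun v => ¬ ∃ x, x ∈ T ∧ ¬ P v x).congr fun v _ => by push Not; rfl

/-- Quantification over a relation that implies membership in the structure. -/
theorem Dp.exOf {R P : (Fin n → ZFSet.{u}) → ZFSet.{u} → Prop}
    (hR : ∀ v, (∀ i, v i ∈ T) → ∀ x, R v x → x ∈ T)
    (hR' : Dp T fun w : Fin (n + 1) → ZFSet.{u} => R (fun i => w i.succ) (w 0))
    (hP : Dp T fun w : Fin (n + 1) → ZFSet.{u} => P (fun i => w i.succ) (w 0)) :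
    Dp T fun v => ∃ x, R v x ∧ P v x :=
  (inferInstance : Dp T fun v => ∃ x, x ∈ T ∧ (R v x ∧ P v x)).congr fun v hv =>
    ⟨fun ⟨x, h⟩ => ⟨x, hR v hv x h.1, h⟩, fun ⟨x, _, h⟩ => ⟨x, h⟩⟩

theorem Dp.allOf {R P : (Fin n → ZFSet.{u}) → ZFSet.{u} → Prop}
    (hR : ∀ v, (∀ i, v i ∈ T) → ∀ x, R v x → x ∈ T)
    (hR' : Dp T fun w : Fin (n + 1) → ZFSet.{u} => R (fun i => w i.succ) (w 0))
    (hP : Dp T fun w : Fin (n + 1) → ZFSet.{u} => P (fun i => w i.succ) (w 0)) :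
    Dp T fun v => ∀ x, R v x → P v x :=
  (inferInstance : Dp T fun v => ∀ x, x ∈ T → (R v x → P v x)).congr fun v hv =>
    ⟨fun h x _ => h x, fun h x h' => h x (hR v hv x h') h'⟩

variable [hT : Fact T.IsTransitive]

instance Dp.exMem {t : (Fin n → ZFSet.{u}) → ZFSet.{u}} [ht : Tm T t]
    {P : (Fin n → ZFSet.{u}) → ZFSet.{u} → Prop}
    [hP : Dp T fun w : Fin (n + 1) → ZFSet.{u} => P (fun i => w i.succ) (w 0)] :
    Dp T fun v => ∃ x, x ∈ t v ∧ P v x :=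
  Dp.exOf (fun v hv x hx => hT.out.mem_trans hx (ht.mem hv)) inferInstance hP

instance Dp.allMem {t : (Fin n → ZFSet.{u}) → ZFSet.{u}} [ht : Tm T t]
    {P : (Fin n → ZFSet.{u}) → ZFSet.{u} → Prop}
    [hP : Dp T fun w : Fin (n + 1) → ZFSet.{u} => P (fun i => w i.succ) (w 0)] :
    Dp T fun v => ∀ x, x ∈ t v → P v x :=
  Dp.allOf (fun v hv x hx => hT.out.mem_trans hx (ht.mem hv)) inferInstance hP

instance Dp.subset {t s : (Fin n → ZFSet.{u}) → ZFSet.{u}} [ht : Tm T t] [hs : Tm T s] :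
    Dp T fun v => t v ⊆ s v :=
  (inferInstance : Dp T fun v => ∀ x, x ∈ t v → x ∈ s v).congr fun v _ => by
    rw [ZFSet.subset_def]

instance Dp.eqEmpty {t : (Fin n → ZFSet.{u}) → ZFSet.{u}} [ht : Tm T t] :
    Dp T fun v => t v = ∅ :=
  (inferInstance : Dp T fun v => ∀ x, x ∈ t v → False).congr fun v _ => by
    rw [ZFSet.eq_empty]

instance Dp.eqInsert {t s r : (Fin n → ZFSet.{u}) → ZFSet.{u}} [Tm T t] [Tm T s] [Tm T r] :
    Dp T fun v => t v = insert (s v) (r v) :=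
  (inferInstance : Dp T fun v => s v ∈ t v ∧ r v ⊆ t v ∧
      ∀ x, x ∈ t v → x = s v ∨ x ∈ r v).congr fun v _ => by
    constructor
    · rintro h
      rw [h]
      exact ⟨ZFSet.mem_insert _ _, fun x hx => ZFSet.mem_insert_of_mem _ hx,
        fun x hx => ZFSet.mem_insert_iff.1 hx⟩
    · rintro ⟨h1, h2, h3⟩
      ext x
      rw [ZFSet.mem_insert_iff]
      exact ⟨h3 x, fun h => h.elim (fun h => h ▸ h1) fun h => h2 h⟩

instance Dp.eqUPair {t s r : (Fin n → ZFSet.{u}) → ZFSet.{u}} [Tm T t] [Tm T s] [Tm T r] :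
    Dp T fun v => t v = {s v, r v} :=
  (inferInstance : Dp T fun v => s v ∈ t v ∧ r v ∈ t v ∧
      ∀ x, x ∈ t v → x = s v ∨ x = r v).congr fun v _ => by
    constructor
    · rintro h
      rw [h]
      simp
    · rintro ⟨h1, h2, h3⟩
      ext x
      rw [ZFSet.mem_pair]
      exact ⟨h3 x, by rintro (rfl | rfl) <;> assumption⟩

instance Dp.eqSingleton {t s : (Fin n → ZFSet.{u}) → ZFSet.{u}} [Tm T t] [Tm T s] :
    Dp T fun v => t v = {s v} :=
  (inferInstance : Dp T fun v => t v = {s v, s v}).congr fun v _ => by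
    rw [ZFSet.pair_eq_singleton]

end calculus

theorem fst_mem_of_transitive {T a b : ZFSet.{u}} (hT : T.IsTransitive) (h : ZFSet.pair a b ∈ T) :
    a ∈ T :=
  hT.mem_trans (ZFSet.mem_singleton.2 rfl : a ∈ ({a} : ZFSet))
    (hT.mem_trans (by simp [ZFSet.pair] : ({a} : ZFSet) ∈ ZFSet.pair a b) h)

theorem snd_mem_of_transitive {T a b : ZFSet.{u}} (hT : T.IsTransitive) (h : ZFSet.pair a b ∈ T) :
    b ∈ T :=
  hT.mem_trans (by simp : b ∈ ({a, b} : ZFSet))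
    (hT.mem_trans (by simp [ZFSet.pair] : ({a, b} : ZFSet) ∈ ZFSet.pair a b) h)

theorem pairRel_fst_mem {T E a b : ZFSet.{u}} (hT : T.IsTransitive) (hE : E ∈ T) (h : PairRel E a b) :
    a ∈ T := fst_mem_of_transitive hT (hT.mem_trans h hE)

theorem pairRel_snd_mem {T E a b : ZFSet.{u}} (hT : T.IsTransitive) (hE : E ∈ T) (h : PairRel E a b) :
    b ∈ T := snd_mem_of_transitive hT (hT.mem_trans h hE)

section calculus

variable {T : ZFSet.{u}} {n : ℕ} [hT : Fact T.IsTransitive]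

instance Dp.eqPair {t s r : (Fin n → ZFSet.{u}) → ZFSet.{u}} [ht : Tm T t] [Tm T s] [Tm T r] :
    Dp T fun v => t v = ZFSet.pair (s v) (r v) :=
  (inferInstance : Dp T fun v => ∃ x, x ∈ t v ∧ ∃ y, y ∈ t v ∧ x = {s v} ∧ y = {s v, r v} ∧
      t v = {x, y}).congr fun v hv => by
    constructor
    · rintro h
      rw [h]
      exact ⟨_, by simp [ZFSet.pair], _, by simp [ZFSet.pair], rfl, rfl, rfl⟩
    · rintro ⟨x, _, y, _, rfl, rfl, h⟩
      exact h

instance Dp.pairMem {t s r : (Fin n → ZFSet.{u}) → ZFSet.{u}} [ht : Tm T t] [Tm T s] [Tm T r] :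
    Dp T fun v => ZFSet.pair (s v) (r v) ∈ t v :=
  (inferInstance : Dp T fun v => ∃ x, x ∈ t v ∧ x = ZFSet.pair (s v) (r v)).congr fun v hv => by
    simp

instance Dp.pairRel {t s r : (Fin n → ZFSet.{u}) → ZFSet.{u}} [ht : Tm T t] [Tm T s] [Tm T r] :
    Dp T fun v => PairRel (t v) (s v) (r v) := Dp.pairMem

/-- The entries of a pair that belongs to an element of `T` are in `T` by transitivity, so a
quantifier over the ambient universe that is guarded by `PairRel` is a quantifier over `T`. -/
instance Dp.exPairLeft {t s : (Fin n → ZFSet.{u}) → ZFSet.{u}} [ht : Tm T t] [Tm T s]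
    {P : (Fin n → ZFSet.{u}) → ZFSet.{u} → Prop}
    [hP : Dp T fun w : Fin (n + 1) → ZFSet.{u} => P (fun i => w i.succ) (w 0)] :
    Dp T fun v => ∃ x, PairRel (t v) x (s v) ∧ P v x :=
  Dp.exOf (fun v hv x hx => pairRel_fst_mem hT.out (ht.mem hv) hx) inferInstance hP

instance Dp.allPairLeft {t s : (Fin n → ZFSet.{u}) → ZFSet.{u}} [ht : Tm T t] [Tm T s]
    {P : (Fin n → ZFSet.{u}) → ZFSet.{u} → Prop}
    [hP : Dp T fun w : Fin (n + 1) → ZFSet.{u} => P (fun i => w i.succ) (w 0)] :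
    Dp T fun v => ∀ x, PairRel (t v) x (s v) → P v x :=
  Dp.allOf (fun v hv x hx => pairRel_fst_mem hT.out (ht.mem hv) hx) inferInstance hP

instance Dp.exPairRight {t s : (Fin n → ZFSet.{u}) → ZFSet.{u}} [ht : Tm T t] [Tm T s]
    {P : (Fin n → ZFSet.{u}) → ZFSet.{u} → Prop}
    [hP : Dp T fun w : Fin (n + 1) → ZFSet.{u} => P (fun i => w i.succ) (w 0)] :
    Dp T fun v => ∃ x, PairRel (t v) (s v) x ∧ P v x :=
  Dp.exOf (fun v hv x hx => pairRel_snd_mem hT.out (ht.mem hv) hx) inferInstance hP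

instance Dp.allPairRight {t s : (Fin n → ZFSet.{u}) → ZFSet.{u}} [ht : Tm T t] [Tm T s]
    {P : (Fin n → ZFSet.{u}) → ZFSet.{u} → Prop}
    [hP : Dp T fun w : Fin (n + 1) → ZFSet.{u} => P (fun i => w i.succ) (w 0)] :
    Dp T fun v => ∀ x, PairRel (t v) (s v) x → P v x :=
  Dp.allOf (fun v hv x hx => pairRel_snd_mem hT.out (ht.mem hv) hx) inferInstance hP

instance Dp.exPair {t : (Fin n → ZFSet.{u}) → ZFSet.{u}} [ht : Tm T t]
    {P : (Fin n → ZFSet.{u}) → ZFSet.{u} → ZFSet.{u} → Prop}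
    [hP : Dp T fun w : Fin (n + 1 + 1) → ZFSet.{u} => P (fun i => w i.succ.succ) (w (Fin.succ 0)) (w 0)] :
    Dp T fun v => ∃ x y, PairRel (t v) x y ∧ P v x y :=
  (inferInstance : Dp T fun v => ∃ x, x ∈ T ∧ ∃ y, y ∈ T ∧ (PairRel (t v) x y ∧ P v x y)).congr
    fun v hv => ⟨fun ⟨x, y, h⟩ => ⟨x, pairRel_fst_mem hT.out (ht.mem hv) h.1, y,
      pairRel_snd_mem hT.out (ht.mem hv) h.1, h⟩, fun ⟨x, _, y, _, h⟩ => ⟨x, y, h⟩⟩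

instance Dp.allPair {t : (Fin n → ZFSet.{u}) → ZFSet.{u}} [ht : Tm T t]
    {P : (Fin n → ZFSet.{u}) → ZFSet.{u} → ZFSet.{u} → Prop}
    [hP : Dp T fun w : Fin (n + 1 + 1) → ZFSet.{u} => P (fun i => w i.succ.succ) (w (Fin.succ 0)) (w 0)] :
    Dp T fun v => ∀ x y, PairRel (t v) x y → P v x y :=
  (inferInstance : Dp T fun v => ¬ ∃ x y, PairRel (t v) x y ∧ ¬ P v x y).congr
    fun v hv => by push Not; rfl

instance Dp.isTransitive {t : (Fin n → ZFSet.{u}) → ZFSet.{u}} [ht : Tm T t] :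
    Dp T fun v => (t v).IsTransitive :=
  inferInstanceAs (Dp T fun v => ∀ x, x ∈ t v → x ⊆ t v)

instance Dp.isOrdinal {t : (Fin n → ZFSet.{u}) → ZFSet.{u}} [ht : Tm T t] :
    Dp T fun v => (t v).IsOrdinal :=
  (inferInstance : Dp T fun v => (t v).IsTransitive ∧ ∀ x, x ∈ t v → x.IsTransitive).congr
    fun v _ => ZFSet.isOrdinal_iff_forall_mem_isTransitive

end calculus

/-- Definability of a predicate in one, two or three free variables. -/
theorem Dp.lam₁ {T : ZFSet.{u}} {n : ℕ} {P : ZFSet.{u} → Prop}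
    (h : Dp T fun v : Fin 1 → ZFSet.{u} => P (v 0)) {t : (Fin n → ZFSet.{u}) → ZFSet.{u}} [ht : Tm T t] :
    Dp T fun v => P (t v) :=
  h.subst ![t] fun i => by fin_cases i; assumption

theorem Dp.lam₂ {T : ZFSet.{u}} {n : ℕ} {P : ZFSet.{u} → ZFSet.{u} → Prop}
    (h : Dp T fun v : Fin 2 → ZFSet.{u} => P (v 0) (v 1)) {t s : (Fin n → ZFSet.{u}) → ZFSet.{u}}
    [Tm T t] [Tm T s] : Dp T fun v => P (t v) (s v) :=
  h.subst ![t, s] fun i => by fin_cases i <;> assumption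

theorem Dp.lam₃ {T : ZFSet.{u}} {n : ℕ} {P : ZFSet.{u} → ZFSet.{u} → ZFSet.{u} → Prop}
    (h : Dp T fun v : Fin 3 → ZFSet.{u} => P (v 0) (v 1) (v 2))
    {t s r : (Fin n → ZFSet.{u}) → ZFSet.{u}}
    [Tm T t] [Tm T s] [Tm T r] : Dp T fun v => P (t v) (s v) (r v) :=
  h.subst ![t, s, r] fun i => by fin_cases i <;> assumption


/-! ### Transfer of definability along interpretations -/

/-- Transfer of definability along an interpretation `I` of a relational structure `U₁` in `U₂`, where
`I d u` says that `d` represents `u`. -/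
theorem definable_interpret {L₁ L₂ : FirstOrder.Language.{0, 0}} {U₁ U₂ : Type*}
    [L₁.Structure U₁] [L₂.Structure U₂] (hL : ∀ n, IsEmpty (L₁.Functions n))
    (I : U₂ → U₁ → Prop) (hsurj : ∀ u, ∃ d, I d u) (hfun : ∀ d u u', I d u → I d u' → u = u')
    (heq : (Set.univ : Set U₂).Definable L₂ {w : Fin 2 → U₂ | ∃ u, I (w 0) u ∧ I (w 1) u})
    (hrel : ∀ n (r : L₁.Relations n), (Set.univ : Set U₂).Definable L₂
      {w : Fin n → U₂ | ∃ v : Fin n → U₁, (∀ i, I (w i) (v i)) ∧ Structure.RelMap r v})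
    {n : ℕ} {S : Set (Fin n → U₁)} (hS : (Set.univ : Set U₁).Definable L₁ S) :
    (Set.univ : Set U₂).Definable L₂ {w : Fin n → U₂ | ∃ v, (∀ i, I (w i) (v i)) ∧ v ∈ S} := by
  -- An element represents something iff it is related to itself by the interpreted equality. Tuples
  -- that represent nothing must be excluded whenever a complement is taken below.
  have hdom : ∀ {α : Type} [Finite α],
      (Set.univ : Set U₂).Definable L₂ {w : α → U₂ | ∃ v : α → U₁, ∀ i, I (w i) (v i)} := by
    intro α _
    have h1 : ∀ i : α, (Set.univ : Set U₂).Definable L₂ {w : α → U₂ | ∃ u, I (w i) u} := by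
      intro i
      convert heq.preimage_comp (fun _ : Fin 2 => i) using 1
      ext w
      simp
    convert definable_iInter_of_finite h1 using 1
    ext w
    simp only [Set.mem_ofPred_eq, Set.mem_iInter]
    exact ⟨fun ⟨v, hv⟩ i => ⟨v i, hv i⟩, fun h => ⟨fun i => (h i).choose, fun i => (h i).choose_spec⟩⟩
  have huniq : ∀ {α : Type} {w : α → U₂} {v v' : α → U₁}, (∀ i, I (w i) (v i)) →
      (∀ i, I (w i) (v' i)) → v = v' := fun h h' => funext fun i => hfun _ _ _ (h i) (h' i)
  -- Without function symbols a term is a variable or a parameter; a parameter is replaced by a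
  -- chosen representative.
  have hterm : ∀ {k : ℕ} (t : L₁.Term (((Set.univ : Set U₁) ⊕ Fin n) ⊕ Fin k)),
      ∃ g : (Fin n ⊕ Fin k → U₂) → U₂, (Set.univ : Set U₂).DefinableFun L₂ g ∧
        ∀ (w : Fin n ⊕ Fin k → U₂) (v : Fin n ⊕ Fin k → U₁), (∀ i, I (w i) (v i)) →
          I (g w) (t.realize (Sum.elim (Sum.elim (fun u => u.1) (v ∘ Sum.inl)) (v ∘ Sum.inr))) := by
    intro k t
    cases t with
    | var x =>
      rcases x with (c | i) | j
      · obtain ⟨d, hd⟩ := hsurj c.1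
        exact ⟨fun _ => d, definableFun_const _ _ (Set.mem_univ _), fun w v _ => hd⟩
      · exact ⟨fun w => w (Sum.inl i), DefinableFun.proj _, fun w v h => h _⟩
      · exact ⟨fun w => w (Sum.inr j), DefinableFun.proj _, fun w v h => h _⟩
    | func f _ => exact (hL _).elim f
  have hatom : ∀ {k l : ℕ} (ts : Fin l → L₁.Term (((Set.univ : Set U₁) ⊕ Fin n) ⊕ Fin k))
      (Q : (Fin l → U₁) → Prop), (Set.univ : Set U₂).Definable L₂
      {w : Fin l → U₂ | ∃ v : Fin l → U₁, (∀ i, I (w i) (v i)) ∧ Q v} →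
      (Set.univ : Set U₂).Definable L₂ {w : Fin n ⊕ Fin k → U₂ |
        ∃ v : Fin n ⊕ Fin k → U₁, (∀ i, I (w i) (v i)) ∧ Q fun i => (ts i).realize
          (Sum.elim (Sum.elim (fun u => u.1) (v ∘ Sum.inl)) (v ∘ Sum.inr))} := by
    intro k l ts Q hQ
    choose g hg hgI using fun i => hterm (ts i)
    have hg' : (Set.univ : Set U₂).DefinableMap L₂ (fun w i => g i w) := hg
    convert (hdom (α := Fin n ⊕ Fin k)).inter (Definable.preimage_map hg' hQ) using 1
    ext w
    constructor
    · rintro ⟨v, hv, hq⟩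
      exact ⟨⟨v, hv⟩, _, fun i => hgI i w v hv, hq⟩
    · rintro ⟨⟨v, hv⟩, v', hv', hq⟩
      refine ⟨v, hv, ?_⟩
      rwa [huniq (fun i => hgI i w v hv) hv']
  have key : ∀ {k : ℕ} (ψ : L₁.BoundedFormula ((Set.univ : Set U₁) ⊕ Fin n) k),
      (Set.univ : Set U₂).Definable L₂ {w : Fin n ⊕ Fin k → U₂ |
        ∃ v : Fin n ⊕ Fin k → U₁, (∀ i, I (w i) (v i)) ∧
          ψ.Realize (Sum.elim (fun u => u.1) (v ∘ Sum.inl)) (v ∘ Sum.inr)} := by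
    intro k ψ
    induction ψ with
    | falsum =>
      convert definable_empty
      ext w
      simp [BoundedFormula.Realize]
    | equal t₁ t₂ =>
      refine hatom ![t₁, t₂] (fun v => v 0 = v 1) ?_
      convert heq using 1
      ext w
      constructor
      · rintro ⟨v, hv, e⟩
        exact ⟨v 0, hv 0, e ▸ hv 1⟩
      · rintro ⟨a, h0, h1⟩
        exact ⟨fun _ => a, fun i => by fin_cases i <;> assumption, rfl⟩
    | rel R ts => exact hatom ts _ (hrel _ R)
    | imp f₁ f₂ ih₁ ih₂ =>
      convert (hdom (α := Fin n ⊕ Fin _)).inter (ih₁.compl.union ih₂) using 1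
      ext w
      constructor
      · rintro ⟨v, hv, h⟩
        refine ⟨⟨v, hv⟩, ?_⟩
        by_cases h1 : f₁.Realize (Sum.elim (fun u => u.1) (v ∘ Sum.inl)) (v ∘ Sum.inr)
        · exact Or.inr ⟨v, hv, h h1⟩
        · refine Or.inl ?_
          rintro ⟨v', hv', h'⟩
          rw [huniq hv' hv] at h'
          exact h1 h'
      · rintro ⟨⟨v, hv⟩, h⟩
        refine ⟨v, hv, fun h1 => ?_⟩
        rcases h with h | ⟨v', hv', h'⟩
        · exact (h ⟨v, hv, h1⟩).elim
        · rwa [huniq hv hv']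
    | @all m f ih =>
      let e : Fin n ⊕ Fin m → Fin n ⊕ Fin (m + 1) := Sum.map id Fin.castSucc
      -- The universal quantifier is the complement of a projection: no representing tuple that
      -- extends the given one falsifies the body.
      convert (hdom (α := Fin n ⊕ Fin m)).inter
        (((hdom (α := Fin n ⊕ Fin (m + 1))).inter ih.compl).image_comp e).compl using 1
      have hsnoc : ∀ (v : Fin n ⊕ Fin (m + 1) → U₁),
          v ∘ Sum.inr = Fin.snoc ((v ∘ e) ∘ Sum.inr) (v (Sum.inr (Fin.last m))) := by
        intro v
        funext j
        refine Fin.lastCases ?_ (fun j => ?_) j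
        · simp
        · simp [e]
      have hinl : ∀ (v : Fin n ⊕ Fin (m + 1) → U₁), (v ∘ e) ∘ Sum.inl = v ∘ Sum.inl := fun v => rfl
      ext w
      constructor
      · rintro ⟨v, hv, h⟩
        refine ⟨⟨v, hv⟩, ?_⟩
        rintro ⟨w', ⟨⟨v', hv'⟩, hn⟩, rfl⟩
        refine hn ⟨v', hv', ?_⟩
        have hve : v' ∘ e = v := huniq (w := w' ∘ e) (fun i => hv' (e i)) hv
        rw [hsnoc, ← hinl, hve]
        exact h _
      · rintro ⟨⟨v, hv⟩, h⟩
        refine ⟨v, hv, fun a => ?_⟩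
        obtain ⟨d, hd⟩ := hsurj a
        by_contra hcon
        refine h ⟨Sum.elim (w ∘ Sum.inl) (Fin.snoc (w ∘ Sum.inr) d), ⟨⟨Sum.elim (v ∘ Sum.inl)
          (Fin.snoc (v ∘ Sum.inr) a), ?_⟩, ?_⟩, ?_⟩
        · rintro (i | j)
          · exact hv _
          · refine Fin.lastCases ?_ (fun j => ?_) j
            · simpa using hd
            · simpa using hv _
        · rintro ⟨v', hv', h'⟩
          have : v' = Sum.elim (v ∘ Sum.inl) (Fin.snoc (v ∘ Sum.inr) a) := by
            refine huniq hv' ?_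
            rintro (i | j)
            · exact hv _
            · refine Fin.lastCases ?_ (fun j => ?_) j
              · simpa using hd
              · simpa using hv _
          rw [this] at h'
          exact hcon h'
        · funext i
          rcases i with i | j <;> simp [e]
  obtain ⟨φ, rfl⟩ := definable_iff_exists_formula_sum.1 hS
  have hform : ∀ v : Fin n ⊕ Fin 0 → U₁,
      BoundedFormula.Realize φ (Sum.elim (fun u => u.1) (v ∘ Sum.inl)) (v ∘ Sum.inr) ↔
        φ.Realize (Sum.elim (fun u => u.1) (v ∘ Sum.inl)) := by
    intro v
    rw [Formula.Realize, Subsingleton.elim (v ∘ Sum.inr) default]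
  convert (key φ).image_comp (Sum.inl : Fin n → Fin n ⊕ Fin 0) using 1
  ext w
  constructor
  · rintro ⟨v, hv, h⟩
    refine ⟨Sum.elim w Fin.elim0, ⟨Sum.elim v Fin.elim0, ?_, (hform _).2 h⟩, ?_⟩
    · rintro (i | j)
      · exact hv i
      · exact j.elim0
    · funext i; rfl
  · rintro ⟨w, ⟨v, hv, h⟩, rfl⟩
    exact ⟨v ∘ Sum.inl, fun i => hv _, (hform v).1 h⟩


/-! ### The one-sorted structure `(C, ∈)` inside class theory -/

theorem isEmpty_setLang_functions (n : ℕ) : IsEmpty (setLang.Functions n) :=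
  inferInstanceAs (IsEmpty Empty)

theorem isEmpty_classLang_functions (n : ℕ) : IsEmpty (classLang.Functions n) :=
  inferInstanceAs (IsEmpty Empty)

theorem definable_exists {L : FirstOrder.Language.{0, 0}} {U : Type*} [L.Structure U] {n : ℕ}
    {P : (Fin n → U) → U → Prop} (h : (Set.univ : Set U).Definable L
      {w : Fin (n + 1) → U | P (fun i => w i.succ) (w 0)}) :
    (Set.univ : Set U).Definable L {v : Fin n → U | ∃ x, P v x} := by
  convert h.image_comp Fin.succ using 1
  ext v
  constructor
  · rintro ⟨x, h⟩
    exact ⟨Fin.cons x v, by simpa using h, by ext i; simp⟩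
  · rintro ⟨w, hw, rfl⟩
    exact ⟨_, hw⟩

/-- The set underlying an object of a two-sorted universe. -/
def TwoSorted.val {M C : ZFSet.{u}} : TwoSorted M C → ZFSet.{u} := Sum.elim (·.1) (·.1)

theorem IsModelMK.mem_classes {M C : ZFSet.{u}} (h : IsModelMK M C) {X : ZFSet.{u}} (hX : X ⊆ M)
    (hd : Def₁ classLang fun u : TwoSorted M C => ∃ x : {x // x ∈ M}, u = .inl x ∧ x.1 ∈ X) :
    X ∈ C := by
  obtain ⟨Y, hY, hYX⟩ := h.comprehension _ hd
  have : Y = X := by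
    ext z
    refine ⟨fun hz => ?_, fun hz => ?_⟩
    · obtain ⟨x, hx, hx'⟩ := (hYX ⟨z, h.classes_subset Y hY hz⟩).1 hz
      rw [Sum.inl.injEq] at hx
      rwa [← hx] at hx'
    · exact (hYX ⟨z, hX hz⟩).2 ⟨_, rfl, hz⟩
  exact this ▸ hY

theorem definable_classMem {M C : ZFSet.{u}} : (Set.univ : Set (TwoSorted M C)).Definable classLang
    {w : Fin 2 → TwoSorted M C | (w 0).Mem (w 1)} := by
  refine Definable.mono (empty_definable_iff.2
      ⟨BoundedFormula.rel (n := 0) (L := classLang) (l := 2) ClassRel.mem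
        fun i => Term.var (Sum.inl i), ?_⟩) (Set.empty_subset _)
  ext v
  rfl

theorem definable_classIsSet {M C : ZFSet.{u}} : (Set.univ : Set (TwoSorted M C)).Definable classLang
    {w : Fin 1 → TwoSorted M C | (w 0).isLeft = true} := by
  refine Definable.mono (empty_definable_iff.2
      ⟨BoundedFormula.rel (n := 0) (L := classLang) (l := 1) ClassRel.isSet
        fun i => Term.var (Sum.inl i), ?_⟩) (Set.empty_subset _)
  ext v
  rfl

theorem TwoSorted.mem_iff {M C : ZFSet.{u}} {a b : TwoSorted M C} :
    a.Mem b ↔ a.isLeft ∧ a.val ∈ b.val := by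
  rcases a with a | a <;> rcases b with b | b <;> simp [TwoSorted.Mem, TwoSorted.val]

theorem IsModelMK.val_subset {M C : ZFSet.{u}} (h : IsModelMK M C) (a : TwoSorted M C) :
    a.val ⊆ M := by
  rcases a with a | a
  · exact h.transitive _ a.2
  · exact h.classes_subset _ a.2

/-- A set and the class with the same elements are different objects of the two-sorted universe but
the same element of `C`. Coextensionality expresses this identification in the two-sorted language.
-/
theorem IsModelMK.val_eq_iff {M C : ZFSet.{u}} (h : IsModelMK M C) (a b : TwoSorted M C) :
    a.val = b.val ↔ ¬ ∃ x : TwoSorted M C, ¬ (x.Mem a ↔ x.Mem b) := by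
  push Not
  constructor
  · intro e x
    rw [TwoSorted.mem_iff, TwoSorted.mem_iff, e]
  · intro H
    ext z
    constructor
    · intro hz
      have := (H (.inl ⟨z, h.val_subset a hz⟩)).1 (TwoSorted.mem_iff.2 ⟨rfl, hz⟩)
      exact (TwoSorted.mem_iff.1 this).2
    · intro hz
      have := (H (.inl ⟨z, h.val_subset b hz⟩)).2 (TwoSorted.mem_iff.2 ⟨rfl, hz⟩)
      exact (TwoSorted.mem_iff.1 this).2

theorem IsModelMK.sets_subset_classes {M C : ZFSet.{u}} (h : IsModelMK M C) : M ⊆ C := by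
  intro x hx
  refine h.mem_classes (h.transitive x hx) ?_
  have h1 : (Set.univ : Set (TwoSorted M C)).DefinableMap classLang
      (fun (w : Fin 1 → TwoSorted M C) (i : Fin 2) => ![w 0, .inl ⟨x, hx⟩] i) := by
    intro i
    fin_cases i
    · exact DefinableFun.proj _
    · exact definableFun_const _ _ (Set.mem_univ _)
  unfold Def₁
  refine (congrArg _ ?_).mpr (Definable.preimage_map h1 definable_classMem)
  ext w
  simp only [Set.mem_ofPred_eq, Set.mem_preimage]
  rcases hw : w 0 with a | a
  · simp [TwoSorted.Mem]
  · simp [TwoSorted.Mem]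

theorem IsModelMK.transitive_classes {M C : ZFSet.{u}} (h : IsModelMK M C) : C.IsTransitive :=
  fun X hX x hx => h.sets_subset_classes (h.classes_subset X hX hx)

theorem IsModelMK.sets_mem_classes {M C : ZFSet.{u}} (h : IsModelMK M C) : M ∈ C := by
  refine h.mem_classes (fun _ => id) ?_
  unfold Def₁
  refine (congrArg _ ?_).mpr definable_classIsSet
  ext w
  simp only [Set.mem_ofPred_eq]
  rcases hw : w 0 with a | a <;> simp

/-- Definability over the one-sorted structure `(C, ∈)` gives definability in class theory. -/
theorem IsModelMK.definable_of_dp {M C : ZFSet.{u}} (h : IsModelMK M C) {n : ℕ}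
    {P : (Fin n → ZFSet.{u}) → Prop} (hP : Dp C P) :
    (Set.univ : Set (TwoSorted M C)).Definable classLang
      {w : Fin n → TwoSorted M C | P fun i => (w i).val} := by
  have hval : ∀ a : TwoSorted M C, a.val ∈ C := by
    rintro (a | a)
    · exact h.sets_subset_classes a.2
    · exact a.2
  have heq : (Set.univ : Set (TwoSorted M C)).Definable classLang
      {w : Fin 2 → TwoSorted M C | (w 0).val = (w 1).val} := by
    have h1 := definable_classMem (M := M) (C := C) |>.preimage_comp
      (![0, 1] : Fin 2 → Fin 3)
    have h2 := definable_classMem (M := M) (C := C) |>.preimage_comp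
      (![0, 2] : Fin 2 → Fin 3)
    have h3 := definable_exists (n := 2) (P := fun (v : Fin 2 → TwoSorted M C) (x : TwoSorted M C) => ¬ (x.Mem (v 0) ↔ x.Mem (v 1))) (by
      convert (h1.sdiff h2).union (h2.sdiff h1) using 1
      ext w
      simp only [Set.mem_ofPred_eq, Set.mem_union, Set.mem_sdiff, Set.mem_preimage]
      change ¬ ((w 0).Mem (w 1) ↔ (w 0).Mem (w 2)) ↔ ((w 0).Mem (w 1) ∧ ¬ (w 0).Mem (w 2)) ∨
        ((w 0).Mem (w 2) ∧ ¬ (w 0).Mem (w 1))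
      tauto)
    convert h3.compl using 1
    ext w
    exact h.val_eq_iff _ _
  -- `Mem` fails when its left argument is a class, so that argument is first replaced by an object
  -- of the sort of sets with the same elements.
  have hmem : (Set.univ : Set (TwoSorted M C)).Definable classLang
      {w : Fin 2 → TwoSorted M C | (w 0).val ∈ (w 1).val} := by
    have h1 := heq.preimage_comp (![0, 1] : Fin 2 → Fin 3)
    have h2 := definable_classMem (M := M) (C := C) |>.preimage_comp
      (![0, 2] : Fin 2 → Fin 3)
    convert definable_exists (n := 2) (P := fun (v : Fin 2 → TwoSorted M C) (x : TwoSorted M C) => x.val = (v 0).val ∧ x.Mem (v 1))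
      (h1.inter h2) using 1
    ext w
    constructor
    · intro hw
      exact ⟨.inl ⟨(w 0).val, h.val_subset _ hw⟩, rfl, TwoSorted.mem_iff.2 ⟨rfl, hw⟩⟩
    · rintro ⟨x, hx, hx'⟩
      rw [TwoSorted.mem_iff, hx] at hx'
      exact hx'.2
  have := definable_interpret (L₂ := classLang) isEmpty_setLang_functions
    (fun (a : TwoSorted M C) (u : {x // x ∈ C}) => a.val = u.1)
    (fun u => ⟨.inr u, rfl⟩) (fun d u u' h h' => Subtype.ext (h.symm.trans h')) ?_ ?_ hP.out
  · convert this using 1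
    ext w
    constructor
    · intro hw
      exact ⟨fun i => ⟨(w i).val, hval _⟩, fun i => rfl, hw⟩
    · rintro ⟨v, hv, h⟩
      simpa [hv] using h
  · convert heq using 1
    ext w
    constructor
    · rintro ⟨u, h0, h1⟩
      exact h0.trans h1.symm
    · intro hw
      exact ⟨⟨(w 0).val, hval _⟩, rfl, hw.symm⟩
  · rintro n ⟨⟩
    convert hmem using 1
    ext w
    constructor
    · rintro ⟨v, hv, hr⟩
      have hr : (v 0).1 ∈ (v 1).1 := hr
      simpa [hv] using hr
    · intro hw
      exact ⟨fun i => ⟨(w i).val, hval _⟩, fun i => rfl, hw⟩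


/-! ### Transitive models without Power Set: ranks and well-foundedness -/

/-- Transitive models of ZF without Power Set and Infinity, with Collection. -/
structure IsZF (N : ZFSet.{u}) : Prop where
  trans : N.IsTransitive
  empty_mem : ∅ ∈ N
  upair_mem : ∀ {x y}, x ∈ N → y ∈ N → {x, y} ∈ N
  sUnion_mem : ∀ {x}, x ∈ N → ZFSet.sUnion x ∈ N
  sep_mem : ∀ (P : ZFSet.{u} → Prop), Dp N (fun v : Fin 1 → ZFSet.{u} => P (v 0)) →
    ∀ {a}, a ∈ N → a.sep P ∈ N
  coll : ∀ (φ : ZFSet.{u} → ZFSet.{u} → Prop), Dp N (fun v : Fin 2 → ZFSet.{u} => φ (v 0) (v 1)) →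
    ∀ {a}, a ∈ N → (∀ x ∈ a, ∃ y ∈ N, φ x y) → ∃ b ∈ N, ∀ x ∈ a, ∃ y ∈ b, φ x y

namespace IsZF

variable {N : ZFSet.{u}} (h : IsZF N)
include h

theorem mem_of_mem {x y : ZFSet.{u}} (hy : y ∈ N) (hx : x ∈ y) : x ∈ N := h.trans.mem_trans hx hy

theorem singleton_mem {x : ZFSet.{u}} (hx : x ∈ N) : {x} ∈ N := by
  rw [← ZFSet.pair_eq_singleton]
  exact h.upair_mem hx hx

theorem pair_mem {x y : ZFSet.{u}} (hx : x ∈ N) (hy : y ∈ N) : ZFSet.pair x y ∈ N :=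
  h.upair_mem (h.singleton_mem hx) (h.upair_mem hx hy)

theorem union_mem {x y : ZFSet.{u}} (hx : x ∈ N) (hy : y ∈ N) : x ∪ y ∈ N := by
  rw [← ZFSet.sUnion_pair]
  exact h.sUnion_mem (h.upair_mem hx hy)

theorem insert_mem {x y : ZFSet.{u}} (hx : x ∈ N) (hy : y ∈ N) : insert x y ∈ N := by
  rw [ZFSet.insert_eq]
  exact h.union_mem (h.singleton_mem hx) hy

theorem replacement {a : ZFSet.{u}} (ha : a ∈ N) {G : ZFSet.{u} → ZFSet.{u}}
    (hG : ∀ x ∈ a, G x ∈ N) {φ : ZFSet.{u} → ZFSet.{u} → Prop}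
    (hφ : Dp N fun v : Fin 2 → ZFSet.{u} => φ (v 0) (v 1))
    (hφG : ∀ x ∈ a, ∀ y ∈ N, φ x y ↔ y = G x) :
    ∃ b ∈ N, ∀ y, y ∈ b ↔ ∃ x ∈ a, y = G x := by
  have := Fact.mk h.trans
  have := Fact.mk ha
  obtain ⟨b, hb, hb'⟩ := h.coll φ hφ ha fun x hx => ⟨G x, hG x hx, (hφG x hx _ (hG x hx)).2 rfl⟩
  have : ∀ {n : ℕ} (t s : (Fin n → ZFSet.{u}) → ZFSet.{u}) [Tm N t] [Tm N s],
    Dp N fun v => φ (t v) (s v) := fun t s => hφ.lam₂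
  refine ⟨b.sep fun y => ∃ x ∈ a, φ x y, h.sep_mem _ inferInstance hb, fun y => ?_⟩
  rw [ZFSet.mem_sep]
  constructor
  · rintro ⟨hy, x, hx, hxy⟩
    exact ⟨x, hx, (hφG x hx _ (h.mem_of_mem hb hy)).1 hxy⟩
  · rintro ⟨x, hx, rfl⟩
    obtain ⟨y, hy, hxy⟩ := hb' x hx
    have := (hφG x hx _ (h.mem_of_mem hb hy)).1 hxy
    subst this
    exact ⟨hy, x, hx, hxy⟩

/-- As in `replacement`, `G` is a function of the ambient universe, and `φ` has to describe it only
for arguments in `a` and values in `N`. Replacement is applied to the map that sends `x` to the pair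
of `x` and `G x`. -/
theorem graph {a : ZFSet.{u}} (ha : a ∈ N) {G : ZFSet.{u} → ZFSet.{u}}
    (hG : ∀ x ∈ a, G x ∈ N) {φ : ZFSet.{u} → ZFSet.{u} → Prop}
    (hφ : Dp N fun v : Fin 2 → ZFSet.{u} => φ (v 0) (v 1))
    (hφG : ∀ x ∈ a, ∀ y ∈ N, φ x y ↔ y = G x) :
    ∃ b ∈ N, ∀ p, p ∈ b ↔ ∃ x ∈ a, p = ZFSet.pair x (G x) := by
  have := Fact.mk h.trans
  have : ∀ {n : ℕ} (t s : (Fin n → ZFSet.{u}) → ZFSet.{u}) [Tm N t] [Tm N s],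
    Dp N fun v => φ (t v) (s v) := fun t s => hφ.lam₂
  refine h.replacement ha (G := fun x => ZFSet.pair x (G x))
    (φ := fun x p => ∃ y ∈ N, φ x y ∧ p = ZFSet.pair x y)
    (fun x hx => h.pair_mem (h.mem_of_mem ha hx) (hG x hx)) inferInstance fun x hx p hp => ?_
  constructor
  · rintro ⟨y, hy, hxy, rfl⟩
    rw [(hφG x hx y hy).1 hxy]
  · rintro rfl
    exact ⟨G x, hG x hx, (hφG x hx _ (hG x hx)).2 rfl, rfl⟩

/-- Power Set is not available, so the product is the union of the fibres over `x ∈ a`: Replacement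
is used once for each fibre and once for the family of fibres. -/
theorem prod_mem {a b : ZFSet.{u}} (ha : a ∈ N) (hb : b ∈ N) : a.prod b ∈ N := by
  have := Fact.mk h.trans
  have := Fact.mk hb
  have h1 : ∀ x ∈ N, ({x} : ZFSet).prod b ∈ N := by
    intro x hx
    have := Fact.mk hx
    obtain ⟨c, hc, hc'⟩ := h.replacement hb (G := fun y => ZFSet.pair x y)
      (φ := fun y p => p = ZFSet.pair x y) (fun y hy => h.pair_mem hx (h.mem_of_mem hb hy))
      inferInstance fun _ _ _ _ => Iff.rfl
    convert hc using 1
    ext p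
    rw [hc', ZFSet.mem_prod]
    simp
  obtain ⟨c, hc, hc'⟩ := h.replacement ha (G := fun x => ({x} : ZFSet).prod b)
    (φ := fun x c => (∀ p ∈ c, ∃ y ∈ b, p = ZFSet.pair x y) ∧ ∀ y ∈ b, ∃ p ∈ c, p = ZFSet.pair x y)
    (fun x hx => h1 x (h.mem_of_mem ha hx)) inferInstance (by
      intro x hx c hc
      constructor
      · rintro ⟨h1, h2⟩
        ext p
        rw [ZFSet.mem_prod]
        simp only [ZFSet.mem_singleton, exists_eq_left]
        refine ⟨h1 p, ?_⟩
        rintro ⟨y, hy, rfl⟩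
        obtain ⟨p, hp, rfl⟩ := h2 y hy
        exact hp
      · rintro rfl
        simp [ZFSet.mem_prod])
  convert h.sUnion_mem hc using 1
  ext p
  simp only [ZFSet.mem_sUnion, hc', ZFSet.mem_prod]
  constructor
  · rintro ⟨x, hx, y, hy, rfl⟩
    exact ⟨_, ⟨x, hx, rfl⟩, by simp [hy]⟩
  · rintro ⟨_, ⟨x, hx, rfl⟩, hp⟩
    simp only [ZFSet.mem_prod, ZFSet.mem_singleton, exists_eq_left] at hp
    obtain ⟨y, hy, rfl⟩ := hp
    exact ⟨x, hx, y, hy, rfl⟩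

/-- A property `Φ` that is closed under unions, and a witnessing relation `ψ` that is monotone:
witnesses for all elements of a set can be amalgamated. -/
theorem amalgamate {Φ : ZFSet.{u} → Prop} {ψ : ZFSet.{u} → ZFSet.{u} → Prop}
    (hΦ : Dp N fun v : Fin 1 → ZFSet.{u} => Φ (v 0))
    (hψ : Dp N fun v : Fin 2 → ZFSet.{u} => ψ (v 0) (v 1))
    (hunion : ∀ F, (∀ f ∈ F, Φ f) → Φ (ZFSet.sUnion F))
    (hmono : ∀ x f g, f ⊆ g → ψ x f → ψ x g) {a : ZFSet.{u}} (ha : a ∈ N)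
    (hex : ∀ x ∈ a, ∃ f ∈ N, Φ f ∧ ψ x f) : ∃ f ∈ N, Φ f ∧ ∀ x ∈ a, ψ x f := by
  have : ∀ {n : ℕ} (t : (Fin n → ZFSet.{u}) → ZFSet.{u}) [Tm N t],
    Dp N fun v => Φ (t v) := fun t => hΦ.lam₁
  have : ∀ {n : ℕ} (t s : (Fin n → ZFSet.{u}) → ZFSet.{u}) [Tm N t] [Tm N s],
    Dp N fun v => ψ (t v) (s v) := fun t s => hψ.lam₂
  obtain ⟨b, hb, hb'⟩ := h.coll (fun x f => Φ f ∧ ψ x f) inferInstance ha hex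
  refine ⟨_, h.sUnion_mem (h.sep_mem Φ hΦ hb), hunion _ fun f hf => (ZFSet.mem_sep.1 hf).2, ?_⟩
  intro x hx
  obtain ⟨f, hf, hΦf, hψf⟩ := hb' x hx
  exact hmono x f _ (fun z hz => ZFSet.mem_sUnion_of_mem hz (ZFSet.mem_sep.2 ⟨hf, hΦf⟩)) hψf

/-- The ∈-induction takes place in the ambient universe. Unions of transitive sets are transitive,
so any witnesses for the elements of `x` can be amalgamated, and adjoining `x` to the result keeps
it transitive. -/
theorem exists_transitive {x : ZFSet.{u}} (hx : x ∈ N) : ∃ t ∈ N, t.IsTransitive ∧ x ∈ t := by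
  have := Fact.mk h.trans
  induction x using ZFSet.inductionOn with
  | _ x ih =>
    obtain ⟨t, ht, htt, hxt⟩ := h.amalgamate (Φ := fun t => t.IsTransitive) (ψ := fun x t => x ∈ t)
      inferInstance inferInstance (fun F hF => ZFSet.IsTransitive.sUnion' hF)
      (fun x f g hfg hx => hfg hx) hx fun y hy => ih y hy (h.mem_of_mem hx hy)
    refine ⟨insert x t, h.insert_mem hx ht, ?_, ZFSet.mem_insert _ _⟩
    intro y hy z hz
    rcases ZFSet.mem_insert_iff.1 hy with rfl | hy
    · exact ZFSet.mem_insert_of_mem _ (hxt z hz)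
    · exact ZFSet.mem_insert_of_mem _ (htt.mem_trans hz hy)

end IsZF

/-- `S` relates every `R`-predecessor of a node to an element of any set that it relates to the
node. -/
def Tracks (N : ZFSet.{u}) (R : ZFSet.{u} → ZFSet.{u} → Prop) (S : ZFSet.{u}) : Prop :=
  ∀ b y, PairRel S b y → ∀ b' ∈ N, R b' b → ∃ y' ∈ y, PairRel S b' y'

theorem Tracks.sUnion {N : ZFSet.{u}} {R : ZFSet.{u} → ZFSet.{u} → Prop} {F : ZFSet.{u}}
    (hF : ∀ S ∈ F, Tracks N R S) : Tracks N R (ZFSet.sUnion F) := by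
  intro b y hby b' hb' hR
  obtain ⟨S, hS, hp⟩ := ZFSet.mem_sUnion.1 hby
  obtain ⟨y', hy', hp'⟩ := hF S hS b y hp b' hb' hR
  exact ⟨y', hy', ZFSet.mem_sUnion_of_mem hp' hS⟩

theorem Tracks.insert {N : ZFSet.{u}} {R : ZFSet.{u} → ZFSet.{u} → Prop} {S a z : ZFSet.{u}}
    (hS : Tracks N R S) (ha : ∀ b ∈ N, R b a → ∃ y ∈ z, PairRel S b y) :
    Tracks N R (insert (ZFSet.pair a z) S) := by
  intro b y hby b' hb' hR
  rcases ZFSet.mem_insert_iff.1 hby with e | hby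
  · obtain ⟨rfl, rfl⟩ := ZFSet.pair_inj.1 e
    obtain ⟨y, hy, hp⟩ := ha b' hb' hR
    exact ⟨y, hy, ZFSet.mem_insert_of_mem _ hp⟩
  · obtain ⟨y', hy', hp⟩ := hS b y hby b' hb' hR
    exact ⟨y', hy', ZFSet.mem_insert_of_mem _ hp⟩

/-- A tracking relation copies every descent from `x` to a descent from `y`, so ∈-induction compares
the ranks. -/
theorem Tracks.rank_le {N S x y : ZFSet.{u}} (hN : N.IsTransitive) (hS : Tracks N (· ∈ ·) S)
    (hx : x ∈ N) (hp : PairRel S x y) : x.rank ≤ y.rank := by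
  induction x using ZFSet.inductionOn generalizing y with
  | _ x ih =>
    rw [ZFSet.rank_le_iff]
    intro z hz
    obtain ⟨w, hw, hp'⟩ := hS x y hp z (hN.mem_trans hz hx) hz
    exact (ih z hz (hN.mem_trans hz hx) hp').trans_lt (ZFSet.rank_lt_of_mem hw)

/-- Descent along `E` is copied to descent along membership, which ends. -/
theorem Tracks.acc {N E S x y : ZFSet.{u}} (hN : N.IsTransitive) (hE : E ∈ N)
    (hS : Tracks N (PairRel E) S) (hp : PairRel S x y) : Acc (PairRel E) x := by
  induction y using ZFSet.inductionOn generalizing x with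
  | _ y ih =>
    constructor
    intro x' hx'
    obtain ⟨y', hy', hp'⟩ := hS x y hp x' (pairRel_fst_mem hN hE hx') hx'
    exact ih y' hy' hp'

namespace IsZF

variable {N : ZFSet.{u}} (h : IsZF N)
include h

theorem exists_tracks_rank {x y : ZFSet.{u}} (hx : x ∈ N) (hy : y ∈ N) (hr : x.rank ≤ y.rank) :
    ∃ S ∈ N, Tracks N (· ∈ ·) S ∧ PairRel S x y := by
  have := Fact.mk h.trans
  induction x using ZFSet.inductionOn generalizing y with
  | _ x ih =>
    have := Fact.mk hy
    obtain ⟨S, hS, hST, hSx⟩ := h.amalgamate (Φ := fun S => Tracks N (· ∈ ·) S)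
      (ψ := fun z S => ∃ w ∈ y, PairRel S z w)
      (by unfold Tracks; infer_instance) inferInstance (fun F hF => Tracks.sUnion hF)
      (fun x f g hfg ⟨w, hw, hp⟩ => ⟨w, hw, hfg hp⟩) hx (by
        intro z hz
        obtain ⟨w, hw, hzw⟩ := ZFSet.lt_rank_iff.1 ((ZFSet.rank_lt_of_mem hz).trans_le hr)
        obtain ⟨S, hS, hT, hp⟩ := ih z hz (h.mem_of_mem hx hz) (h.mem_of_mem hy hw) hzw
        exact ⟨S, hS, hT, w, hw, hp⟩)
    exact ⟨_, h.insert_mem (h.pair_mem hx hy) hS, hST.insert fun z _ hz => hSx z hz,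
      ZFSet.mem_insert _ _⟩

/-- Ranks are ordinals of the ambient universe and need not be available as elements of `N`. The
existence of a tracking relation in `N` says the same about two sets without mentioning ranks. -/
theorem dp_rank_le {n : ℕ} {t s : (Fin n → ZFSet.{u}) → ZFSet.{u}} [ht : Tm N t] [hs : Tm N s] :
    Dp N fun v => (t v).rank ≤ (s v).rank := by
  have := Fact.mk h.trans
  have : Dp N fun v => ∃ S ∈ N, Tracks N (· ∈ ·) S ∧ PairRel S (t v) (s v) := by
    unfold Tracks; infer_instance
  refine this.congr fun v hv => ⟨fun hr => ?_, ?_⟩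
  · exact h.exists_tracks_rank (ht.mem hv) (hs.mem hv) hr
  · rintro ⟨S, hS, hT, hp⟩
    exact hT.rank_le h.trans (ht.mem hv) hp

/-- A relation of the model that is well-founded in the sense of the model is well-founded. -/
theorem wellFounded_of_internal {E A : ZFSet.{u}} (hE : E ∈ N) (hA : A ∈ N)
    (hEA : ∀ x y, PairRel E x y → x ∈ A)
    (hmin : ∀ X ∈ N, X ⊆ A → X.Nonempty → ∃ m ∈ X, ∀ y ∈ X, ¬ PairRel E y m) :
    WellFounded (PairRel E) := by
  have := Fact.mk h.trans
  have := Fact.mk hE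
  let ranked : ZFSet.{u} → Prop := fun b => ∃ S ∈ N, ∃ y ∈ N, Tracks N (PairRel E) S ∧ PairRel S b y
  have hd : ∀ {n : ℕ} (t : (Fin n → ZFSet.{u}) → ZFSet.{u}) [Tm N t],
      Dp N fun v => ranked (t v) := by
    intro n t _
    simp only [ranked]
    unfold Tracks; infer_instance
  have hacc : ∀ b, ranked b → Acc (PairRel E) b := fun b ⟨S, _, y, _, hT, hp⟩ =>
    hT.acc h.trans hE hp
  have hstep : ∀ a ∈ N, (∀ b, PairRel E b a → ranked b) → ranked a := by
    intro a ha hb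
    have := Fact.mk ha
    have hD := h.sep_mem (fun b => PairRel E b a) inferInstance hA
    obtain ⟨S, hS, hST, hSx⟩ := h.amalgamate (Φ := fun S => Tracks N (PairRel E) S)
      -- The conjunct `w = w` only gives the quantifier the guarded form that the instances for `Dp`
      -- recognise.
      (ψ := fun z S => ∃ w, PairRel S z w ∧ w = w)
      (by unfold Tracks; infer_instance) inferInstance (fun F hF => Tracks.sUnion hF)
      (fun x f g hfg ⟨w, hp, _⟩ => ⟨w, hfg hp, rfl⟩) hD (by
        intro z hz
        obtain ⟨S, hS, y, hy, hT, hp⟩ := hb z (ZFSet.mem_sep.1 hz).2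
        exact ⟨S, hS, hT, y, hp, rfl⟩)
    -- The set `⋃⋃S` contains all second entries of pairs in `S`, so it can serve as the value at
    -- `a`.
    have hU := h.sUnion_mem (h.sUnion_mem hS)
    refine ⟨_, h.insert_mem (h.pair_mem ha hU) hS, _, hU, hST.insert ?_, ZFSet.mem_insert _ _⟩
    intro b _ hba
    obtain ⟨w, hp, _⟩ := hSx b (ZFSet.mem_sep.2 ⟨hEA _ _ hba, hba⟩)
    refine ⟨w, ZFSet.mem_sUnion_of_mem (?_ : w ∈ ({b, w} : ZFSet))
      (ZFSet.mem_sUnion_of_mem (?_ : {b, w} ∈ ZFSet.pair b w) hp), hp⟩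
    · simp
    · simp [ZFSet.pair]
  have hall : ∀ a ∈ A, ranked a := by
    by_contra hcon
    push Not at hcon
    obtain ⟨a, ha, hna⟩ := hcon
    obtain ⟨m, hm, hm'⟩ := hmin _ (h.sep_mem (fun b => ¬ ranked b) inferInstance hA)
      ZFSet.sep_subset ⟨a, ZFSet.mem_sep.2 ⟨ha, hna⟩⟩
    refine (ZFSet.mem_sep.1 hm).2 (hstep m (h.mem_of_mem hA (ZFSet.mem_sep.1 hm).1) fun b hb => ?_)
    by_contra hnb
    exact hm' b (ZFSet.mem_sep.2 ⟨hEA _ _ hb, hnb⟩) hb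
  exact ⟨fun a => ⟨a, fun b hb => hacc b (hall b (hEA _ _ hb))⟩⟩

end IsZF

/-! ### Mostowski collapse -/

open Classical in
/-- The Mostowski collapse of a well-founded relation. -/
noncomputable def collapse (E : ZFSet.{u}) : ZFSet.{u} → ZFSet.{u} :=
  if hE : WellFounded (PairRel E) then
    -- Both entries of a pair in `E` belong to `⋃⋃E`; the restriction makes the predecessors a small
    -- family.
    hE.fix fun a f => ZFSet.range fun b : {b : (E.sUnion.sUnion : ZFSet.{u}) // PairRel E b.1 a} =>
      f b.1.1 b.2
  else fun _ => ∅

theorem mem_collapse {E : ZFSet.{u}} (hE : WellFounded (PairRel E)) {a x : ZFSet.{u}} :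
    x ∈ collapse E a ↔ ∃ b, PairRel E b a ∧ collapse E b = x := by
  have : collapse E a =
      ZFSet.range fun b : {b : (E.sUnion.sUnion : ZFSet.{u}) // PairRel E b.1 a} =>
        collapse E b.1.1 := by
    simp only [collapse, hE, dif_pos]
    rw [hE.fix_eq]
  rw [this, ZFSet.mem_range]
  constructor
  · rintro ⟨b, hb⟩
    exact ⟨_, b.2, hb⟩
  · rintro ⟨b, hb, e⟩
    refine ⟨⟨⟨b, ?_⟩, hb⟩, e⟩
    refine ZFSet.mem_sUnion_of_mem (?_ : b ∈ ({b} : ZFSet))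
      (ZFSet.mem_sUnion_of_mem (?_ : {b} ∈ ZFSet.pair b a) hb)
    · simp
    · simp [ZFSet.pair]

/-- `S` is a bisimulation between `E` and membership. -/
def Sim (E S : ZFSet.{u}) : Prop :=
  ∀ b y, PairRel S b y → (∀ b', PairRel E b' b → ∃ y' ∈ y, PairRel S b' y') ∧
    ∀ y' ∈ y, ∃ b', PairRel E b' b ∧ PairRel S b' y'

instance Dp.sim {T : ZFSet.{u}} [Fact T.IsTransitive] {n : ℕ}
    {t s : (Fin n → ZFSet.{u}) → ZFSet.{u}} [ht : Tm T t] [hs : Tm T s] :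
    Dp T fun v => Sim (t v) (s v) := by
  unfold Sim; infer_instance

theorem Sim.eq_collapse {E S x y : ZFSet.{u}} (hE : WellFounded (PairRel E)) (hS : Sim E S)
    (hp : PairRel S x y) : y = collapse E x := by
  induction x using hE.induction generalizing y with
  | _ x ih =>
    ext z
    rw [mem_collapse hE]
    constructor
    · intro hz
      obtain ⟨b, hb, hp'⟩ := (hS x y hp).2 z hz
      exact ⟨b, hb, (ih b hb hp').symm⟩
    · rintro ⟨b, hb, rfl⟩
      obtain ⟨y', hy', hp'⟩ := (hS x y hp).1 b hb
      rwa [← ih b hb hp']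

/-- Induction along `E`. Bisimulations for the predecessors of `a` are amalgamated; their values are
forced to be the collapses by `Sim.eq_collapse`. Replacement therefore collects the values into a
set of `N`, and one more pair is adjoined for `a`. In particular `N` is closed under collapses. -/
theorem IsZF.exists_sim {N : ZFSet.{u}} (h : IsZF N) {E a : ZFSet.{u}}
    (hE : WellFounded (PairRel E)) (hEN : E ∈ N) (ha : a ∈ N) :
    collapse E a ∈ N ∧ ∃ S ∈ N, Sim E S ∧ PairRel S a (collapse E a) := by
  have := Fact.mk h.trans
  have := Fact.mk hEN
  induction a using hE.induction with
  | _ a ih =>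
    have := Fact.mk ha
    have hD := h.sep_mem (fun b => PairRel E b a) inferInstance (h.sUnion_mem (h.sUnion_mem hEN))
    have hD' : ∀ b, PairRel E b a → b ∈ (E.sUnion.sUnion).sep fun b => PairRel E b a := by
      intro b hb
      refine ZFSet.mem_sep.2 ⟨ZFSet.mem_sUnion_of_mem (?_ : b ∈ ({b} : ZFSet))
        (ZFSet.mem_sUnion_of_mem (?_ : {b} ∈ ZFSet.pair b a) hb), hb⟩
      · simp
      · simp [ZFSet.pair]
    have hN : ∀ b, PairRel E b a → b ∈ N := fun b hb => pairRel_fst_mem h.trans hEN hb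
    obtain ⟨S, hS, hST, hSx⟩ := h.amalgamate (Φ := fun S => Sim E S)
      (ψ := fun z S => ∃ w, PairRel S z w ∧ w = w) inferInstance inferInstance (by
        intro F hF b y hby
        obtain ⟨S, hS, hp⟩ := ZFSet.mem_sUnion.1 hby
        refine ⟨fun b' hb' => ?_, fun y' hy' => ?_⟩
        · obtain ⟨y', hy', hp'⟩ := (hF S hS b y hp).1 b' hb'
          exact ⟨y', hy', ZFSet.mem_sUnion_of_mem hp' hS⟩
        · obtain ⟨b', hb', hp'⟩ := (hF S hS b y hp).2 y' hy'
          exact ⟨b', hb', ZFSet.mem_sUnion_of_mem hp' hS⟩)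
      (fun x f g hfg ⟨w, hp, _⟩ => ⟨w, hfg hp, rfl⟩) hD (by
        intro z hz
        have hz := (ZFSet.mem_sep.1 hz).2
        obtain ⟨_, S, hS, hT, hp⟩ := ih z hz (hN z hz)
        exact ⟨S, hS, hT, _, hp, rfl⟩)
    have hSc : ∀ b, PairRel E b a → PairRel S b (collapse E b) := by
      intro b hb
      obtain ⟨w, hp, _⟩ := hSx b (hD' b hb)
      rwa [← hST.eq_collapse hE hp]
    have := Fact.mk hS
    obtain ⟨c, hc, hc'⟩ := h.replacement hD (G := collapse E)
      (φ := fun b y => PairRel S b y) (fun b hb => (ih b (ZFSet.mem_sep.1 hb).2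
        (hN b (ZFSet.mem_sep.1 hb).2)).1) inferInstance (by
        intro b hb y hy
        exact ⟨fun hp => hST.eq_collapse hE hp, fun e => e ▸ hSc b (ZFSet.mem_sep.1 hb).2⟩)
    have hca : collapse E a = c := by
      ext x
      rw [mem_collapse hE, hc']
      exact ⟨fun ⟨b, hb, e⟩ => ⟨b, hD' b hb, e.symm⟩,
        fun ⟨b, hb, e⟩ => ⟨b, (ZFSet.mem_sep.1 hb).2, e.symm⟩⟩
    have hcaN : collapse E a ∈ N := hca ▸ hc
    refine ⟨hcaN, _, h.insert_mem (h.pair_mem ha hcaN) hS, ?_, ZFSet.mem_insert _ _⟩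
    intro b y hby
    rcases ZFSet.mem_insert_iff.1 hby with e | hby
    · obtain ⟨rfl, rfl⟩ := ZFSet.pair_inj.1 e
      refine ⟨fun b' hb' => ⟨_, (mem_collapse hE).2 ⟨b', hb', rfl⟩,
        ZFSet.mem_insert_of_mem _ (hSc b' hb')⟩, fun y' hy' => ?_⟩
      obtain ⟨b', hb', rfl⟩ := (mem_collapse hE).1 hy'
      exact ⟨b', hb', ZFSet.mem_insert_of_mem _ (hSc b' hb')⟩
    · refine ⟨fun b' hb' => ?_, fun y' hy' => ?_⟩
      · obtain ⟨y', hy', hp'⟩ := (hST b y hby).1 b' hb'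
        exact ⟨y', hy', ZFSet.mem_insert_of_mem _ hp'⟩
      · obtain ⟨b', hb', hp'⟩ := (hST b y hby).2 y' hy'
        exact ⟨b', hb', ZFSet.mem_insert_of_mem _ hp'⟩

/-- "`y` is the collapse of `a` with respect to `E`", as a relation of the model. -/
def CollapsesTo (N E a y : ZFSet.{u}) : Prop := ∃ S ∈ N, Sim E S ∧ PairRel S a y

instance Dp.collapsesTo {T : ZFSet.{u}} [Fact T.IsTransitive] {n : ℕ}
    {t s r : (Fin n → ZFSet.{u}) → ZFSet.{u}} [ht : Tm T t] [hs : Tm T s] [Tm T r] :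
    Dp T fun v => CollapsesTo T (t v) (s v) (r v) := by
  unfold CollapsesTo; infer_instance

theorem IsZF.collapsesTo_iff {N : ZFSet.{u}} (h : IsZF N) {E a y : ZFSet.{u}}
    (hE : WellFounded (PairRel E)) (hEN : E ∈ N) (ha : a ∈ N) :
    CollapsesTo N E a y ↔ y = collapse E a := by
  constructor
  · rintro ⟨S, hS, hST, hp⟩
    exact hST.eq_collapse hE hp
  · rintro rfl
    exact (h.exists_sim hE hEN ha).2


theorem IsModelZFCminus.isZF {N : ZFSet.{u}} (hN : N.IsTransitive) (h : IsModelZFCminus N) :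
    IsZF N where
  trans := hN
  empty_mem := by
    obtain ⟨_, _, ⟨e, he, _, h0⟩, _⟩ := h.infinity
    convert he
    symm
    rw [ZFSet.eq_empty]
    exact fun y hy => h0 y (hN.mem_trans hy he) hy
  upair_mem := by
    intro x y hx hy
    obtain ⟨p, hp, hp'⟩ := h.pairing x hx y hy
    convert hp
    ext z
    rw [ZFSet.mem_pair]
    refine ⟨fun hz => (hp' z ?_).2 hz, fun hz => (hp' z (hN.mem_trans hz hp)).1 hz⟩
    rcases hz with rfl | rfl <;> assumption
  sUnion_mem := by
    intro x hx
    obtain ⟨p, hp, hp'⟩ := h.union x hx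
    convert hp
    ext z
    rw [ZFSet.mem_sUnion]
    constructor
    · rintro ⟨y, hy, hz⟩
      have hyN := hN.mem_trans hy hx
      exact (hp' z (hN.mem_trans hz hyN)).2 ⟨y, hyN, hy, hz⟩
    · intro hz
      obtain ⟨y, _, hy, hz⟩ := (hp' z (hN.mem_trans hz hp)).1 hz
      exact ⟨y, hy, hz⟩
  sep_mem := by
    intro P hP a ha
    obtain ⟨b, hb, hb'⟩ := h.separation (fun x => P x.1) hP.out a ha
    convert hb
    ext z
    rw [ZFSet.mem_sep]
    exact ⟨fun hz => (hb' ⟨z, hN.mem_trans hz.1 ha⟩).2 hz,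
      fun hz => (hb' ⟨z, hN.mem_trans hz hb⟩).1 hz⟩
  coll := by
    intro φ hφ a ha hex
    obtain ⟨b, hb, hb'⟩ := h.collection (fun x y => φ x.1 y.1) hφ.out a ha (by
      rintro ⟨x, hx⟩ hxa
      obtain ⟨y, hy, hxy⟩ := hex x hxa
      exact ⟨⟨y, hy⟩, hxy⟩)
    refine ⟨b, hb, fun x hx => ?_⟩
    obtain ⟨y, hy, hxy⟩ := hb' ⟨x, hN.mem_trans hx ha⟩ hx
    exact ⟨y.1, hy, hxy⟩

/-! ### Interpreting a two-sorted structure in a model of set theory -/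

/-- A set that represents an object of the two-sorted universe. -/
noncomputable def TwoSorted.tag {M C : ZFSet.{u}} : TwoSorted M C → ZFSet.{u} :=
  Sum.elim (fun x => ZFSet.pair ∅ x.1) (fun X => ZFSet.pair {∅} X.1)

theorem TwoSorted.tag_injective {M C : ZFSet.{u}} {a b : TwoSorted M C} (h : a.tag = b.tag) :
    a = b := by
  rcases a with a | a <;> rcases b with b | b <;> simp only [TwoSorted.tag, Sum.elim_inl,
    Sum.elim_inr, ZFSet.pair_inj] at h
  · rw [Subtype.ext h.2]
  · exact absurd h.1.symm (by rw [ZFSet.eq_empty]; push Not; exact ⟨∅, by simp⟩)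
  · exact absurd h.1 (by rw [ZFSet.eq_empty]; push Not; exact ⟨∅, by simp⟩)
  · rw [Subtype.ext h.2]

section Interpretation

variable {N M C : ZFSet.{u}} (h : IsZF N) (hM : M ∈ N) (hC : C = M.powerset ∩ N)
include h hM hC

theorem IsZF.mem_classes_iff {X : ZFSet.{u}} : X ∈ C ↔ X ∈ N ∧ X ⊆ M := by
  rw [hC, ZFSet.mem_inter, ZFSet.mem_powerset, and_comm]

theorem IsZF.tag_mem (a : TwoSorted M C) : a.tag ∈ N := by
  rcases a with a | a
  · exact h.pair_mem h.empty_mem (h.mem_of_mem hM a.2)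
  · exact h.pair_mem (h.singleton_mem h.empty_mem) ((h.mem_classes_iff hM hC).1 a.2).1

/-- The same element of `N` can occur both as a set and as a class, so the sorts are separated by
the tags `∅` and `{∅}`. With `M` as a parameter, being a tagged set or a tagged class is definable
in `N`, and `definable_interpret` applies. -/
theorem IsZF.dp_of_definable {n : ℕ} {S : Set (Fin n → TwoSorted M C)}
    (hS : (Set.univ : Set (TwoSorted M C)).Definable classLang S) :
    Dp N fun w : Fin n → ZFSet.{u} => ∃ v : Fin n → TwoSorted M C, (∀ i, w i = (v i).tag) ∧ v ∈ S := by
  have := Fact.mk h.trans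
  have := Fact.mk hM
  have := Fact.mk h.empty_mem
  have := Fact.mk (h.singleton_mem h.empty_mem)
  have hmemC : ∀ {X}, X ∈ C ↔ X ∈ N ∧ X ⊆ M := h.mem_classes_iff hM hC
  have key := definable_interpret (L₂ := setLang) isEmpty_classLang_functions
    (fun (d : {x // x ∈ N}) (a : TwoSorted M C) => d.1 = a.tag)
    (fun a => ⟨⟨a.tag, h.tag_mem hM hC a⟩, rfl⟩)
    (fun d a b ha hb => TwoSorted.tag_injective (ha.symm.trans hb)) ?_ ?_ hS
  · exact ⟨key⟩
  · have : Dp N fun w : Fin 2 → ZFSet.{u} => w 0 = w 1 ∧ ((∃ x ∈ M, w 0 = ZFSet.pair ∅ x) ∨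
        ∃ X ∈ N, X ⊆ M ∧ w 0 = ZFSet.pair {∅} X) := inferInstance
    convert this.out using 1
    ext w
    constructor
    · rintro ⟨a, h0, h1⟩
      refine ⟨h0.trans h1.symm, ?_⟩
      rcases a with a | a
      · exact Or.inl ⟨a, a.2, h0⟩
      · exact Or.inr ⟨a, (hmemC.1 a.2).1, (hmemC.1 a.2).2, h0⟩
    · rintro ⟨h01, ⟨x, hx, hw⟩ | ⟨X, hX, hXM, hw⟩⟩
      · exact ⟨.inl ⟨x, hx⟩, hw, Eq.trans (Eq.symm h01) hw⟩
      · exact ⟨.inr ⟨X, hmemC.2 ⟨hX, hXM⟩⟩, hw, Eq.trans (Eq.symm h01) hw⟩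
  · rintro n ⟨⟩
    · have : Dp N fun w : Fin 1 → ZFSet.{u} => ∃ x ∈ M, w 0 = ZFSet.pair ∅ x := inferInstance
      convert this.out using 1
      ext w
      constructor
      · rintro ⟨a, h0, h1⟩
        have h1 : (a 0).isLeft = true := h1
        have h0 := h0 0
        rcases ha : a 0 with x | x
        · exact ⟨x, x.2, h0.trans (by rw [ha]; rfl)⟩
        · rw [ha] at h1; simp at h1
      · rintro ⟨x, hx, hw⟩
        exact ⟨fun _ => .inl ⟨x, hx⟩, fun i => by fin_cases i; exact hw, rfl⟩
    · have : Dp N fun w : Fin 2 → ZFSet.{u} => ∃ x ∈ M, w 0 = ZFSet.pair ∅ x ∧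
          ((∃ y ∈ M, w 1 = ZFSet.pair ∅ y ∧ x ∈ y) ∨
            ∃ X ∈ N, X ⊆ M ∧ w 1 = ZFSet.pair {∅} X ∧ x ∈ X) := inferInstance
      convert this.out using 1
      ext w
      constructor
      · rintro ⟨a, h0, h1⟩
        have h1 : (a 0).Mem (a 1) := h1
        have hw0 := h0 0
        have hw1 := h0 1
        generalize a 0 = a0 at *
        generalize a 1 = a1 at *
        rcases a0 with x | x
        · refine ⟨x, x.2, hw0, ?_⟩
          rcases a1 with y | y
          · exact Or.inl ⟨y, y.2, hw1, h1⟩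
          · exact Or.inr ⟨y, (hmemC.1 y.2).1, (hmemC.1 y.2).2, hw1, h1⟩
        · exact h1.elim
      · rintro ⟨x, hx, hw0, ⟨y, hy, hw1, hxy⟩ | ⟨X, hX, hXM, hw1, hxy⟩⟩
        · refine ⟨![.inl ⟨x, hx⟩, .inl ⟨y, hy⟩], fun i => ?_, hxy⟩
          fin_cases i
          exacts [hw0, hw1]
        · refine ⟨![.inl ⟨x, hx⟩, .inr ⟨X, hmemC.2 ⟨hX, hXM⟩⟩], fun i => ?_, hxy⟩
          fin_cases i
          exacts [hw0, hw1]

theorem IsZF.dp_of_def₁ {φ : TwoSorted M C → Prop} (hφ : Def₁ classLang φ) :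
    Dp N fun w : Fin 1 → ZFSet.{u} => ∃ hx : w 0 ∈ M, φ (.inl ⟨w 0, hx⟩) := by
  have := Fact.mk h.trans
  have := Fact.mk hM
  have := Fact.mk h.empty_mem
  have h1 := h.dp_of_definable hM hC hφ
  have : ∀ {n : ℕ} (t : (Fin n → ZFSet.{u}) → ZFSet.{u}) [Tm N t],
      Dp N fun w => ∃ v : Fin 1 → TwoSorted M C, (∀ i, ![t w] i = (v i).tag) ∧
        v ∈ {v | φ (v 0)} := by
    intro n t _
    have := h1.subst ![t] fun i => by fin_cases i; assumption
    refine this.congr fun v _ => ?_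
    simp
  refine (inferInstance : Dp N fun w : Fin 1 → ZFSet.{u} => w 0 ∈ M ∧ ∃ d ∈ N, d = ZFSet.pair ∅ (w 0) ∧
    ∃ v : Fin 1 → TwoSorted M C, (∀ i, ![d] i = (v i).tag) ∧ v ∈ {v | φ (v 0)}).congr fun w hw => ?_
  constructor
  · rintro ⟨hx, hp⟩
    exact ⟨hx, _, h.pair_mem h.empty_mem (hw 0), rfl, fun _ => .inl ⟨w 0, hx⟩,
      fun i => by fin_cases i; rfl, hp⟩
  · rintro ⟨hx, d, hd, rfl, v, hv, hp⟩
    have : v 0 = .inl ⟨w 0, hx⟩ := TwoSorted.tag_injective ((hv 0).symm.trans rfl)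
    exact ⟨hx, this ▸ hp⟩

theorem IsZF.dp_of_def₂ {φ : TwoSorted M C → TwoSorted M C → Prop} (hφ : Def₂ classLang φ) :
    Dp N fun w : Fin 2 → ZFSet.{u} => ∃ (hx : w 0 ∈ M) (hX : w 1 ∈ C),
      φ (.inl ⟨w 0, hx⟩) (.inr ⟨w 1, hX⟩) := by
  have := Fact.mk h.trans
  have := Fact.mk hM
  have := Fact.mk h.empty_mem
  have h1 := h.dp_of_definable hM hC hφ
  have := Fact.mk (h.singleton_mem h.empty_mem)
  have hmemC : ∀ {X}, X ∈ C ↔ X ∈ N ∧ X ⊆ M := h.mem_classes_iff hM hC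
  have : ∀ {n : ℕ} (t s : (Fin n → ZFSet.{u}) → ZFSet.{u}) [Tm N t] [Tm N s],
      Dp N fun w => ∃ v : Fin 2 → TwoSorted M C, (t w = (v 0).tag ∧ s w = (v 1).tag) ∧
        v ∈ {v | φ (v 0) (v 1)} := by
    intro n t s _ _
    have := h1.subst ![t, s] fun i => by fin_cases i <;> assumption
    refine this.congr fun v _ => ?_
    simp [Fin.forall_fin_two]
  refine (inferInstance : Dp N fun w : Fin 2 → ZFSet.{u} => w 0 ∈ M ∧ w 1 ⊆ M ∧
    ∃ d ∈ N, d = ZFSet.pair ∅ (w 0) ∧ ∃ e ∈ N, e = ZFSet.pair {∅} (w 1) ∧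
    ∃ v : Fin 2 → TwoSorted M C, (d = (v 0).tag ∧ e = (v 1).tag) ∧
      v ∈ {v | φ (v 0) (v 1)}).congr fun w hw => ?_
  constructor
  · rintro ⟨hx, hX, hp⟩
    exact ⟨hx, (hmemC.1 hX).2, _, h.pair_mem h.empty_mem (hw 0), rfl, _,
      h.pair_mem (h.singleton_mem h.empty_mem) (hw 1), rfl,
      ![.inl ⟨w 0, hx⟩, .inr ⟨w 1, hX⟩], ⟨rfl, rfl⟩, hp⟩
  · rintro ⟨hx, hX, d, hd, rfl, e, he, rfl, v, hv, hp⟩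
    have hXC : w 1 ∈ C := hmemC.2 ⟨hw 1, hX⟩
    have h0 : v 0 = .inl ⟨w 0, hx⟩ := TwoSorted.tag_injective (hv.1.symm.trans rfl)
    have h1 : v 1 = .inr ⟨w 1, hXC⟩ := TwoSorted.tag_injective (hv.2.symm.trans rfl)
    refine ⟨hx, hXC, ?_⟩
    have hp : φ (v 0) (v 1) := hp
    rwa [h0, h1] at hp

theorem IsZF.dp_of_def₃ {φ : TwoSorted M C → TwoSorted M C → TwoSorted M C → Prop}
    (hφ : Def₃ classLang φ) :
    Dp N fun w : Fin 3 → ZFSet.{u} => ∃ (hx : w 0 ∈ M) (hX : w 1 ∈ C) (hY : w 2 ∈ C),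
      φ (.inl ⟨w 0, hx⟩) (.inr ⟨w 1, hX⟩) (.inr ⟨w 2, hY⟩) := by
  have := Fact.mk h.trans
  have := Fact.mk hM
  have := Fact.mk h.empty_mem
  have h1 := h.dp_of_definable hM hC hφ
  have := Fact.mk (h.singleton_mem h.empty_mem)
  have hmemC : ∀ {X}, X ∈ C ↔ X ∈ N ∧ X ⊆ M := h.mem_classes_iff hM hC
  have : ∀ {n : ℕ} (t s r : (Fin n → ZFSet.{u}) → ZFSet.{u}) [Tm N t] [Tm N s] [Tm N r],
      Dp N fun w => ∃ v : Fin 3 → TwoSorted M C,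
        (t w = (v 0).tag ∧ s w = (v 1).tag ∧ r w = (v 2).tag) ∧
        v ∈ {v | φ (v 0) (v 1) (v 2)} := by
    intro n t s r _ _ _
    have := h1.subst ![t, s, r] fun i => by fin_cases i <;> assumption
    refine this.congr fun v _ => ?_
    simp [Fin.forall_fin_succ]
  refine (inferInstance : Dp N fun w : Fin 3 → ZFSet.{u} => w 0 ∈ M ∧ w 1 ⊆ M ∧ w 2 ⊆ M ∧
    ∃ d ∈ N, d = ZFSet.pair ∅ (w 0) ∧ ∃ e ∈ N, e = ZFSet.pair {∅} (w 1) ∧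
    ∃ f ∈ N, f = ZFSet.pair {∅} (w 2) ∧
    ∃ v : Fin 3 → TwoSorted M C, (d = (v 0).tag ∧ e = (v 1).tag ∧ f = (v 2).tag) ∧
      v ∈ {v | φ (v 0) (v 1) (v 2)}).congr fun w hw => ?_
  constructor
  · rintro ⟨hx, hX, hY, hp⟩
    exact ⟨hx, (hmemC.1 hX).2, (hmemC.1 hY).2, _, h.pair_mem h.empty_mem (hw 0), rfl, _,
      h.pair_mem (h.singleton_mem h.empty_mem) (hw 1), rfl, _,
      h.pair_mem (h.singleton_mem h.empty_mem) (hw 2), rfl,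
      ![.inl ⟨w 0, hx⟩, .inr ⟨w 1, hX⟩, .inr ⟨w 2, hY⟩], ⟨rfl, rfl, rfl⟩, hp⟩
  · rintro ⟨hx, hX, hY, d, hd, rfl, e, he, rfl, f, hf, rfl, v, hv, hp⟩
    have hXC : w 1 ∈ C := hmemC.2 ⟨hw 1, hX⟩
    have hYC : w 2 ∈ C := hmemC.2 ⟨hw 2, hY⟩
    have h0 : v 0 = .inl ⟨w 0, hx⟩ := TwoSorted.tag_injective (hv.1.symm.trans rfl)
    have h1 : v 1 = .inr ⟨w 1, hXC⟩ := TwoSorted.tag_injective (hv.2.1.symm.trans rfl)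
    have h2 : v 2 = .inr ⟨w 2, hYC⟩ := TwoSorted.tag_injective (hv.2.2.symm.trans rfl)
    refine ⟨hx, hXC, hYC, ?_⟩
    have hp : φ (v 0) (v 1) (v 2) := hp
    rwa [h0, h1, h2] at hp

end Interpretation


/-! ### Injections and functions in a model -/

/-- There is an injection from `x` to `y` in `N`. -/
def InjIn (N x y : ZFSet.{u}) : Prop := ∃ f ∈ N, IsInjection f x y

theorem IsInjection.exists_fun {f x y : ZFSet.{u}} (hf : IsInjection f x y) :
    ∃ G : ZFSet.{u} → ZFSet.{u}, (∀ a ∈ x, G a ∈ y) ∧ (∀ a ∈ x, ∀ b, PairRel f a b ↔ b = G a) ∧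
      (∀ a ∈ x, ∀ b ∈ x, G a = G b → a = b) ∧ ∀ a b, PairRel f a b → a ∈ x := by
  classical
  obtain ⟨⟨hsub, huniq⟩, hinj⟩ := hf
  choose! G hG using huniq
  have h1 : ∀ a ∈ x, PairRel f a (G a) := fun a ha => (hG a ha).1
  have h2 : ∀ a ∈ x, ∀ b, PairRel f a b → b = G a := fun a ha b hb => (hG a ha).2 b hb
  refine ⟨G, fun a ha => (ZFSet.pair_mem_prod.1 (hsub (h1 a ha))).2,
    fun a ha b => ⟨h2 a ha b, fun e => e ▸ h1 a ha⟩, fun a ha b hb e => ?_,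
    fun a b hab => (ZFSet.pair_mem_prod.1 (hsub hab)).1⟩
  exact hinj a b (G a) (h1 a ha) (e ▸ h1 b hb)

theorem isInjection_of {f x y : ZFSet.{u}} {G : ZFSet.{u} → ZFSet.{u}} (hG : ∀ a ∈ x, G a ∈ y)
    (hinj : ∀ a ∈ x, ∀ b ∈ x, G a = G b → a = b)
    (hf : ∀ p, p ∈ f ↔ ∃ a ∈ x, p = ZFSet.pair a (G a)) : IsInjection f x y := by
  refine ⟨⟨fun p hp => ?_, fun a ha => ⟨G a, (hf _).2 ⟨a, ha, rfl⟩, fun b hb => ?_⟩⟩, ?_⟩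
  · obtain ⟨a, ha, rfl⟩ := (hf p).1 hp
    exact ZFSet.pair_mem_prod.2 ⟨ha, hG a ha⟩
  · obtain ⟨a', _, e⟩ := (hf _).1 hb
    obtain ⟨rfl, rfl⟩ := ZFSet.pair_inj.1 e
    rfl
  · intro a b c ha hb
    obtain ⟨a', ha', e⟩ := (hf _).1 ha
    obtain ⟨b', hb', e'⟩ := (hf _).1 hb
    obtain ⟨rfl, rfl⟩ := ZFSet.pair_inj.1 e
    obtain ⟨rfl, e''⟩ := ZFSet.pair_inj.1 e'
    exact hinj _ ha' _ hb' e''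

theorem isFunc_of {f x y : ZFSet.{u}} {G : ZFSet.{u} → ZFSet.{u}} (hG : ∀ a ∈ x, G a ∈ y)
    (hf : ∀ p, p ∈ f ↔ ∃ a ∈ x, p = ZFSet.pair a (G a)) : ZFSet.IsFunc x y f := by
  refine ⟨fun p hp => ?_, fun a ha => ⟨G a, (hf _).2 ⟨a, ha, rfl⟩, fun b hb => ?_⟩⟩
  · obtain ⟨a, ha, rfl⟩ := (hf p).1 hp
    exact ZFSet.pair_mem_prod.2 ⟨ha, hG a ha⟩
  · obtain ⟨a', _, e⟩ := (hf _).1 hb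
    obtain ⟨rfl, rfl⟩ := ZFSet.pair_inj.1 e
    rfl

namespace IsZF

variable {N : ZFSet.{u}} (h : IsZF N)
include h

theorem injIn_of {x y : ZFSet.{u}} (hx : x ∈ N) (hy : y ∈ N) {G : ZFSet.{u} → ZFSet.{u}}
    (hG : ∀ a ∈ x, G a ∈ y) (hinj : ∀ a ∈ x, ∀ b ∈ x, G a = G b → a = b)
    {φ : ZFSet.{u} → ZFSet.{u} → Prop} (hφ : Dp N fun v : Fin 2 → ZFSet.{u} => φ (v 0) (v 1))
    (hφG : ∀ a ∈ x, ∀ b ∈ N, φ a b ↔ b = G a) : InjIn N x y := by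
  obtain ⟨f, hf, hf'⟩ := h.graph hx (fun a ha => h.mem_of_mem hy (hG a ha)) hφ hφG
  exact ⟨f, hf, isInjection_of hG hinj hf'⟩

theorem injIn_of_subset {x y : ZFSet.{u}} (hx : x ∈ N) (hy : y ∈ N) (hxy : x ⊆ y) : InjIn N x y :=
  have := Fact.mk h.trans
  h.injIn_of hx hy (G := id) (fun a ha => hxy ha) (fun _ _ _ _ e => e) (φ := fun a b => b = a)
    inferInstance fun _ _ _ _ => Iff.rfl

theorem injIn_trans {x y z : ZFSet.{u}} (hx : x ∈ N) (hz : z ∈ N) (h1 : InjIn N x y)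
    (h2 : InjIn N y z) : InjIn N x z := by
  have := Fact.mk h.trans
  obtain ⟨f, hf, hf'⟩ := h1
  obtain ⟨g, hg, hg'⟩ := h2
  have := Fact.mk hf
  have := Fact.mk hg
  obtain ⟨F, hF, hFf, hFi, -⟩ := hf'.exists_fun
  obtain ⟨G, hG, hGg, hGi, -⟩ := hg'.exists_fun
  refine h.injIn_of hx hz (G := G ∘ F) (fun a ha => hG _ (hF a ha))
    (fun a ha b hb e => hFi a ha b hb (hGi _ (hF a ha) _ (hF b hb) e))
    (φ := fun a b => ∃ c, PairRel f a c ∧ PairRel g c b) inferInstance fun a ha b hb => ?_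
  constructor
  · rintro ⟨c, hc, hcb⟩
    rw [(hFf a ha c).1 hc] at hcb
    exact (hGg _ (hF a ha) b).1 hcb
  · rintro rfl
    exact ⟨F a, (hFf a ha _).2 rfl, (hGg _ (hF a ha) _).2 rfl⟩

/-- A well-ordering of `x` in the model gives a bijection between `x` and an ordinal. -/
theorem exists_ordinal_bijection {x W : ZFSet.{u}} (hx : x ∈ N) (hW : W ∈ N)
    (hWO : WellOrders N W x) : ∃ θ ∈ N, θ.IsOrdinal ∧ ∃ f ∈ N, IsInjection f x θ ∧
      ∀ α ∈ θ, ∃ a ∈ x, PairRel f a α := by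
  have := Fact.mk h.trans
  have := Fact.mk hx
  obtain ⟨hirr, htrans, htot, hmin⟩ := hWO
  have hE := h.sep_mem (fun p => ∃ a ∈ x, ∃ b ∈ x, p = ZFSet.pair a b) inferInstance hW
  -- `WellOrders` says nothing about `W` outside `x`, so `W` is cut down before it is collapsed.
  set E := W.sep fun p => ∃ a ∈ x, ∃ b ∈ x, p = ZFSet.pair a b with hEdef
  have hEiff : ∀ a b, PairRel E a b ↔ a ∈ x ∧ b ∈ x ∧ PairRel W a b := by
    intro a b
    rw [PairRel, hEdef, ZFSet.mem_sep]
    constructor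
    · rintro ⟨h1, a', ha, b', hb, e⟩
      obtain ⟨rfl, rfl⟩ := ZFSet.pair_inj.1 e
      exact ⟨ha, hb, h1⟩
    · rintro ⟨ha, hb, h1⟩
      exact ⟨h1, a, ha, b, hb, rfl⟩
  have hwf : WellFounded (PairRel E) := by
    refine h.wellFounded_of_internal hE hx (fun a b hab => ((hEiff a b).1 hab).1) fun X hX hXx hne => ?_
    obtain ⟨m, hm, hm'⟩ := hmin X hX hXx hne
    refine ⟨m, hm, fun y hy hym => ?_⟩
    have hym := ((hEiff _ _).1 hym).2.2
    by_cases e : y = m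
    · subst e
      exact hirr _ (hXx hm) hym
    · exact hirr _ (hXx hm) (htrans m (hXx hm) y (hXx hy) m (hXx hm) (hm' y hy e) hym)
  have := Fact.mk hE
  have hcN : ∀ a ∈ x, collapse E a ∈ N := fun a ha => (h.exists_sim hwf hE (h.mem_of_mem hx ha)).1
  have hφ : ∀ a ∈ x, ∀ y ∈ N, CollapsesTo N E a y ↔ y = collapse E a := fun a ha y hy =>
    h.collapsesTo_iff hwf hE (h.mem_of_mem hx ha)
  obtain ⟨θ, hθ, hθ'⟩ := h.replacement hx hcN (φ := fun a y => CollapsesTo N E a y) inferInstance hφ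
  have htr : ∀ a, (collapse E a).IsTransitive := by
    intro a y hy z hz
    obtain ⟨b, hb, rfl⟩ := (mem_collapse hwf).1 hy
    obtain ⟨c, hc, rfl⟩ := (mem_collapse hwf).1 hz
    obtain ⟨hbx, hax, hba⟩ := (hEiff _ _).1 hb
    obtain ⟨hcx, _, hcb⟩ := (hEiff _ _).1 hc
    exact (mem_collapse hwf).2 ⟨c, (hEiff _ _).2 ⟨hcx, hax, htrans c hcx b hbx a hax hcb hba⟩, rfl⟩
  obtain ⟨f, hf, hf'⟩ := h.graph hx hcN (φ := fun a y => CollapsesTo N E a y) inferInstance hφ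
  refine ⟨θ, hθ, ?_, f, hf, ?_, ?_⟩
  · rw [ZFSet.isOrdinal_iff_forall_mem_isTransitive]
    constructor
    · intro y hy z hz
      obtain ⟨a, ha, rfl⟩ := (hθ' y).1 hy
      obtain ⟨b, hb, rfl⟩ := (mem_collapse hwf).1 hz
      exact (hθ' _).2 ⟨b, ((hEiff _ _).1 hb).1, rfl⟩
    · intro y hy
      obtain ⟨a, ha, rfl⟩ := (hθ' y).1 hy
      exact htr a
  · refine isInjection_of (fun a ha => (hθ' _).2 ⟨a, ha, rfl⟩) (fun a ha b hb e => ?_) hf'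
    rcases htot a ha b hb with e' | hab | hba
    · exact e'
    · have : collapse E a ∈ collapse E b := (mem_collapse hwf).2 ⟨a, (hEiff _ _).2 ⟨ha, hb, hab⟩, rfl⟩
      rw [e] at this
      exact (ZFSet.mem_irrefl _ this).elim
    · have : collapse E b ∈ collapse E a := (mem_collapse hwf).2 ⟨b, (hEiff _ _).2 ⟨hb, ha, hba⟩, rfl⟩
      rw [e] at this
      exact (ZFSet.mem_irrefl _ this).elim
  · intro α hα
    obtain ⟨a, ha, rfl⟩ := (hθ' α).1 hα
    exact ⟨a, ha, (hf' _).2 ⟨a, ha, rfl⟩⟩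

end IsZF

/-- An ordinal with a property has a least element with it. -/
theorem exists_least {κ : ZFSet.{u}} {P : ZFSet.{u} → Prop} (hex : ∃ ξ ∈ κ, P ξ) :
    ∃ ξ ∈ κ, P ξ ∧ ∀ ζ ∈ ξ, ¬ (ζ ∈ κ ∧ P ζ) := by
  obtain ⟨ξ, hξ, hmin⟩ := ZFSet.mem_wf.has_min {ξ | ξ ∈ κ ∧ P ξ} hex
  exact ⟨ξ, hξ.1, hξ.2, fun ζ hζ hP => hmin ζ hP hζ⟩

theorem least_unique {κ ξ ζ : ZFSet.{u}} (hκ : κ.IsOrdinal) {P : ZFSet.{u} → Prop}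
    (hξ : ξ ∈ κ ∧ P ξ ∧ ∀ η ∈ ξ, ¬ (η ∈ κ ∧ P η)) (hζ : ζ ∈ κ ∧ P ζ ∧ ∀ η ∈ ζ, ¬ (η ∈ κ ∧ P η)) :
    ξ = ζ := by
  rcases (hκ.mem hξ.1).mem_trichotomous (hκ.mem hζ.1) with h | h | h
  · exact (hζ.2.2 _ h ⟨hξ.1, hξ.2.1⟩).elim
  · exact h
  · exact (hξ.2.2 _ h ⟨hζ.1, hζ.2.1⟩).elim

/-! ### Strongly inaccessible cardinals -/

namespace IsStronglyInaccessibleIn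

variable {N κ : ZFSet.{u}} (h : IsZF N) (hκ : IsStronglyInaccessibleIn N κ)
include h hκ

theorem isOrdinal : κ.IsOrdinal := hκ.cardinal.2.1

theorem mem : κ ∈ N := hκ.cardinal.1

theorem empty_mem : ∅ ∈ κ :=
  (isOrdinal h hκ).mem_trans ZFSet.omega_zero hκ.uncountable

theorem not_injIn {α : ZFSet.{u}} (hα : α ∈ κ) : ¬ InjIn N κ α := hκ.cardinal.2.2 α hα

/-- If `κ` were the successor of `γ`, all ordinals below `κ` would be subsets of `γ`, and `κ` would
inject into the power set of `γ`, hence into some `β < κ`. -/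
theorem insert_mem {γ : ZFSet.{u}} (hγ : γ ∈ κ) : insert γ γ ∈ κ := by
  have hord := isOrdinal h hκ
  have hγo := hord.mem hγ
  have hso := ZFSet.isOrdinal_succ hγo
  rcases hso.mem_trichotomous hord with h1 | h1 | h1
  · exact h1
  · obtain ⟨p, hp, hpγ, β, hβ, f, hf, hfi⟩ := hκ.strong_limit γ hγ
    refine (not_injIn h hκ hβ (h.injIn_trans (mem h hκ) (h.mem_of_mem (mem h hκ) hβ)
      (h.injIn_of_subset (mem h hκ) hp fun δ hδ => ?_) ⟨f, hf, hfi⟩)).elim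
    refine (hpγ δ (h.mem_of_mem (mem h hκ) hδ)).2 ?_
    rw [← h1] at hδ
    rcases ZFSet.mem_insert_iff.1 hδ with rfl | hδ
    · exact fun _ => id
    · exact hγo.subset_of_mem hδ
  · rcases ZFSet.mem_insert_iff.1 h1 with rfl | h1
    · exact (ZFSet.mem_irrefl _ hγ).elim
    · exact (ZFSet.mem_asymm h1 hγ).elim

/-- A small family of bounds below `κ` is bounded below `κ`. -/
theorem exists_bound {x β : ZFSet.{u}} (hx : x ∈ N) (hβ : β ∈ κ) (hinj : InjIn N x β)
    {φ : ZFSet.{u} → ZFSet.{u} → Prop} (hφ : Dp N fun v : Fin 2 → ZFSet.{u} => φ (v 0) (v 1))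
    (hmono : ∀ z ∈ x, ∀ ξ ∈ κ, ∀ ζ ∈ ξ, φ z ζ → φ z ξ) (hex : ∀ z ∈ x, ∃ ξ ∈ κ, φ z ξ) :
    ∃ ξ ∈ κ, ∀ z ∈ x, φ z ξ := by
  classical
  have hord := isOrdinal h hκ
  have hκN := mem h hκ
  have := Fact.mk h.trans
  have := Fact.mk hκN
  have := Fact.mk hx
  obtain ⟨f, hf, hfi⟩ := hinj
  have := Fact.mk hf
  obtain ⟨F, hF, hFf, hFi, -⟩ := hfi.exists_fun
  have : ∀ {n : ℕ} (t s : (Fin n → ZFSet.{u}) → ZFSet.{u}) [Tm N t] [Tm N s],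
    Dp N fun v => φ (t v) (s v) := fun t s => hφ.lam₂
  have hleast := fun z hz => exists_least (hex z hz)
  choose! L hL hLφ hLmin using hleast
  -- Regularity is about functions on an ordinal below `κ`, so the least bounds `L z` are moved
  -- along the injection `F` into `β`; indices outside the image of `F` receive the harmless value
  -- `∅`.
  let G : ZFSet.{u} → ZFSet.{u} := fun j => if hj : ∃ z ∈ x, F z = j then L hj.choose else ∅
  have hGF : ∀ z ∈ x, G (F z) = L z := by
    intro z hz
    have hj : ∃ w ∈ x, F w = F z := ⟨z, hz, rfl⟩
    simp only [G, hj, dif_pos]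
    rw [hFi _ hj.choose_spec.1 z hz hj.choose_spec.2]
  have hGκ : ∀ j ∈ β, G j ∈ κ := by
    intro j _
    by_cases hj : ∃ z ∈ x, F z = j
    · simp only [G, hj, dif_pos]
      exact hL _ hj.choose_spec.1
    · simp only [G, hj, dif_neg, not_false_eq_true]
      exact empty_mem h hκ
  obtain ⟨g, hg, hg'⟩ := h.graph (h.mem_of_mem hκN hβ) (G := G)
    (fun j hj => h.mem_of_mem hκN (hGκ j hj))
    (φ := fun j ξ => (∃ z ∈ x, PairRel f z j ∧ (ξ ∈ κ ∧ φ z ξ ∧ ∀ η ∈ ξ, ¬ (η ∈ κ ∧ φ z η))) ∨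
      (¬ ∃ z ∈ x, PairRel f z j) ∧ ξ = ∅) inferInstance (by
      intro j hj ξ hξ
      by_cases hz : ∃ z ∈ x, F z = j
      · obtain ⟨z, hz, rfl⟩ := hz
        rw [hGF z hz]
        constructor
        · rintro (⟨w, hw, hp, hmin⟩ | ⟨hn, _⟩)
          · have : z = w := hFi _ hz _ hw ((hFf w hw _).1 hp)
            subst this
            exact least_unique hord hmin ⟨hL z hz, hLφ z hz, hLmin z hz⟩
          · exact (hn ⟨z, hz, (hFf z hz _).2 rfl⟩).elim
        · rintro rfl
          exact Or.inl ⟨z, hz, (hFf z hz _).2 rfl, hL z hz, hLφ z hz, hLmin z hz⟩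
      · have hn : ¬ ∃ z ∈ x, PairRel f z j := fun ⟨z, hzx, hp⟩ => hz ⟨z, hzx, ((hFf z hzx _).1 hp).symm⟩
        have hGj : G j = ∅ := by simp only [G, hz, dif_neg, not_false_eq_true]
        rw [hGj]
        constructor
        · rintro (⟨w, hw, hp, _⟩ | ⟨_, e⟩)
          · exact (hn ⟨w, hw, hp⟩).elim
          · exact e
        · intro e
          exact Or.inr ⟨hn, e⟩)
  obtain ⟨ξ, hξ, hξ'⟩ := hκ.regular β hβ g hg (isFunc_of hGκ hg')
  refine ⟨ξ, hξ, fun z hz => hmono z hz ξ hξ (L z) ?_ (hLφ z hz)⟩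
  rw [← hGF z hz]
  exact hξ' (F z) _ ((hg' _).2 ⟨_, hF z hz, rfl⟩)

end IsStronglyInaccessibleIn

/-! ### The levels of the cumulative hierarchy below an inaccessible -/

theorem mem_VIn {N γ x : ZFSet.{u}} : x ∈ VIn N γ ↔ x ∈ N ∧ x.rank < γ.rank := by
  rw [VIn, ZFSet.mem_sep]

theorem mem_VIn_succ {N γ x : ZFSet.{u}} : x ∈ VIn N (insert γ γ) ↔ x ∈ N ∧ x.rank ≤ γ.rank := by
  rw [mem_VIn, ZFSet.rank_insert, max_eq_left (Order.le_succ _), Order.lt_succ_iff]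

theorem mem_VIn_iff_exists {N γ x : ZFSet.{u}} : x ∈ VIn N γ ↔ ∃ δ ∈ γ, x ∈ VIn N (insert δ δ) := by
  rw [mem_VIn, ZFSet.lt_rank_iff]
  simp only [mem_VIn_succ]
  constructor
  · rintro ⟨hx, δ, hδ, hr⟩
    exact ⟨δ, hδ, hx, hr⟩
  · rintro ⟨δ, hδ, hx, hr⟩
    exact ⟨hx, δ, hδ, hr⟩

theorem mem_VIn_succ_iff_subset {N γ x : ZFSet.{u}} (hN : N.IsTransitive) :
    x ∈ VIn N (insert γ γ) ↔ x ∈ N ∧ x ⊆ VIn N γ := by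
  rw [mem_VIn_succ, ZFSet.rank_le_iff]
  constructor
  · rintro ⟨hx, hr⟩
    exact ⟨hx, fun y hy => mem_VIn.2 ⟨hN.mem_trans hy hx, hr hy⟩⟩
  · rintro ⟨hx, hr⟩
    exact ⟨hx, fun y hy => (mem_VIn.1 (hr hy)).2⟩

namespace IsZF

variable {N : ZFSet.{u}} (h : IsZF N)
include h

/-- The level `V_γ` is the union of the levels `V_{δ+1}` for `δ < γ`. These are definable from `δ`
by comparison of ranks, so Replacement and Union suffice. -/
theorem VIn_mem_of_succ {γ : ZFSet.{u}} (hγ : γ ∈ N) (hs : ∀ δ ∈ γ, VIn N (insert δ δ) ∈ N) :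
    VIn N γ ∈ N := by
  have := Fact.mk h.trans
  have : ∀ {n : ℕ} (t s : (Fin n → ZFSet.{u}) → ZFSet.{u}) [Tm N t] [Tm N s],
    Dp N fun v => (t v).rank ≤ (s v).rank := fun t s => h.dp_rank_le
  obtain ⟨b, hb, hb'⟩ := h.replacement hγ (G := fun δ => VIn N (insert δ δ)) hs
    (φ := fun δ y => ∀ x ∈ N, x ∈ y ↔ x.rank ≤ δ.rank) inferInstance (by
      intro δ hδ y hy
      constructor
      · intro H
        ext x
        rw [mem_VIn_succ]
        exact ⟨fun hx => ⟨h.mem_of_mem hy hx, (H x (h.mem_of_mem hy hx)).1 hx⟩,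
          fun hx => (H x hx.1).2 hx.2⟩
      · rintro rfl x hx
        rw [mem_VIn_succ]
        exact and_iff_right hx)
  convert h.sUnion_mem hb using 1
  ext x
  rw [mem_VIn_iff_exists, ZFSet.mem_sUnion]
  constructor
  · rintro ⟨δ, hδ, hx⟩
    exact ⟨_, (hb' _).2 ⟨δ, hδ, rfl⟩, hx⟩
  · rintro ⟨y, hy, hx⟩
    obtain ⟨δ, hδ, rfl⟩ := (hb' y).1 hy
    exact ⟨δ, hδ, hx⟩

/-- Since `N` may lack power sets, `V_{γ+1}` is obtained from the power set `p` of `β`. With an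
injection `F` of `V_γ` into `β`, let `K` take images and `H` preimages of subsets. As `H (K x) = x`
for `x ⊆ V_γ`, the level `V_{γ+1}` is the image of `p` under `H`, and `K` injects it into `p`. -/
theorem VIn_succ_small {γ β p : ZFSet.{u}} (hV : VIn N γ ∈ N) (hβ : β ∈ N)
    (hinj : InjIn N (VIn N γ) β) (hp : p ∈ N) (hpβ : ∀ z ∈ N, z ∈ p ↔ z ⊆ β) :
    VIn N (insert γ γ) ∈ N ∧ InjIn N (VIn N (insert γ γ)) p := by
  have := Fact.mk h.trans
  have := Fact.mk hV
  have := Fact.mk hβ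
  have := Fact.mk hp
  obtain ⟨f, hf, hfi⟩ := hinj
  have := Fact.mk hf
  obtain ⟨F, hF, hFf, hFi, -⟩ := hfi.exists_fun
  let H : ZFSet.{u} → ZFSet.{u} := fun s => (VIn N γ).sep fun z => F z ∈ s
  let K : ZFSet.{u} → ZFSet.{u} := fun x => β.sep fun c => ∃ z ∈ x, PairRel f z c
  have hK : ∀ x ∈ N, K x ∈ p := by
    intro x hx
    have := Fact.mk hx
    exact (hpβ _ (h.sep_mem (fun c => ∃ z ∈ x, PairRel f z c) inferInstance hβ)).2 ZFSet.sep_subset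
  have hHK : ∀ x, x ⊆ VIn N γ → H (K x) = x := by
    intro x hx
    ext z
    simp only [H, K, ZFSet.mem_sep]
    constructor
    · rintro ⟨hz, _, w, hw, hp⟩
      rwa [hFi z hz w (hx hw) ((hFf w (hx hw) _).1 hp)]
    · intro hz
      exact ⟨hx hz, hF z (hx hz), z, hz, (hFf z (hx hz) _).2 rfl⟩
  have hHN : ∀ s ∈ p, H s ∈ N := by
    intro s hs
    have := Fact.mk (h.mem_of_mem hp hs)
    convert h.sep_mem (fun z => ∃ c ∈ s, PairRel f z c) inferInstance hV using 1
    ext z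
    simp only [H, ZFSet.mem_sep]
    refine and_congr_right fun hz => ⟨fun hs => ⟨_, hs, (hFf z hz _).2 rfl⟩, ?_⟩
    rintro ⟨c, hc, hp⟩
    rwa [← (hFf z hz _).1 hp]
  obtain ⟨b, hb, hb'⟩ := h.replacement hp hHN
    (φ := fun s x => x ⊆ VIn N γ ∧ ∀ z ∈ VIn N γ, z ∈ x ↔ ∃ c ∈ s, PairRel f z c) inferInstance (by
      intro s hs x hx
      have key : ∀ z ∈ VIn N γ, (F z ∈ s ↔ ∃ c ∈ s, PairRel f z c) := fun z hz =>
        ⟨fun hs => ⟨_, hs, (hFf z hz _).2 rfl⟩, by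
          rintro ⟨c, hc, hp⟩
          rwa [← (hFf z hz _).1 hp]⟩
      constructor
      · rintro ⟨hxs, hx⟩
        ext z
        simp only [H, ZFSet.mem_sep]
        exact ⟨fun hz => ⟨hxs hz, (key z (hxs hz)).2 ((hx z (hxs hz)).1 hz)⟩,
          fun hz => (hx z hz.1).2 ((key z hz.1).1 hz.2)⟩
      · rintro rfl
        refine ⟨ZFSet.sep_subset, fun z hz => ?_⟩
        simp only [H, ZFSet.mem_sep]
        rw [← key z hz]
        exact and_iff_right hz)
  have hbV : b = VIn N (insert γ γ) := by
    ext x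
    rw [hb', mem_VIn_succ_iff_subset h.trans]
    constructor
    · rintro ⟨s, hs, rfl⟩
      exact ⟨hHN s hs, ZFSet.sep_subset⟩
    · rintro ⟨hx, hxs⟩
      exact ⟨K x, hK x hx, (hHK x hxs).symm⟩
  rw [← hbV]
  refine ⟨hb, h.injIn_of hb hp (G := K) (fun x hx => hK x (h.mem_of_mem hb hx)) ?_
    (φ := fun x s => s ⊆ β ∧ ∀ c ∈ β, c ∈ s ↔ ∃ z ∈ x, PairRel f z c) inferInstance ?_⟩
  · intro x hx y hy e
    rw [hbV, mem_VIn_succ_iff_subset h.trans] at hx hy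
    rw [← hHK x hx.2, ← hHK y hy.2, e]
  · intro x hx s hs
    constructor
    · rintro ⟨hsβ, hs⟩
      ext c
      simp only [K, ZFSet.mem_sep]
      exact ⟨fun hc => ⟨hsβ hc, (hs c (hsβ hc)).1 hc⟩, fun hc => (hs c hc.1).2 hc.2⟩
    · rintro rfl
      refine ⟨ZFSet.sep_subset, fun c hc => ?_⟩
      simp only [K, ZFSet.mem_sep]
      exact and_iff_right hc

end IsZF

namespace IsStronglyInaccessibleIn

variable {N κ : ZFSet.{u}} (h : IsZF N) (hκ : IsStronglyInaccessibleIn N κ)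
include h hκ

/-- Enumerate `V_γ` by an ordinal `θ` and suppose `κ ⊆ θ`. For each `δ < γ`, the indices below `κ`
of elements of `V_{δ+1}` form a small set, so they are bounded below `κ`; regularity bounds these
bounds by one `ξ < κ`. The element with index `ξ` lies in some `V_{δ+1}`, which gives `ξ ∈ ξ`. -/
theorem VIn_limit_small (hch : ∀ x ∈ N, ∃ W ∈ N, WellOrders N W x) {γ : ZFSet.{u}} (hγ : γ ∈ κ)
    (hV : VIn N γ ∈ N) (hs : ∀ δ ∈ γ, ∃ β ∈ κ, InjIn N (VIn N (insert δ δ)) β) :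
    ∃ β ∈ κ, InjIn N (VIn N γ) β := by
  have hord := isOrdinal h hκ
  have hκN := mem h hκ
  have hγN := h.mem_of_mem hκN hγ
  have := Fact.mk h.trans
  have := Fact.mk hκN
  have : ∀ {n : ℕ} (t s : (Fin n → ZFSet.{u}) → ZFSet.{u}) [Tm N t] [Tm N s],
    Dp N fun v => (t v).rank ≤ (s v).rank := fun t s => h.dp_rank_le
  obtain ⟨W, hW, hWO⟩ := hch _ hV
  obtain ⟨θ, hθN, hθ, f, hf, hfi, hsurj⟩ := h.exists_ordinal_bijection hV hW hWO
  have := Fact.mk hf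
  rcases hθ.mem_or_subset hord with hθκ | hκθ
  · exact ⟨θ, hθκ, f, hf, hfi⟩
  exfalso
  obtain ⟨F, hF, hFf, hFi, hFdom⟩ := hfi.exists_fun
  obtain ⟨ξ, hξ, hb⟩ := exists_bound h hκ hγN hγ (h.injIn_of_subset hγN hγN fun _ => id)
    (φ := fun δ ξ => ∀ i ∈ κ, ∀ x, PairRel f x i → (x.rank ≤ δ.rank → i ∈ ξ)) inferInstance
    (fun δ hδ ξ hξ ζ hζ H i hi x hp hr => (hord.mem hξ).mem_trans (H i hi x hp hr) hζ) (by
      intro δ hδ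
      obtain ⟨β, hβ, hinj⟩ := hs δ hδ
      have hA := h.sep_mem (fun i => ∃ x, PairRel f x i ∧ x.rank ≤ δ.rank)
        (by have := Fact.mk (h.mem_of_mem hγN hδ); infer_instance) hκN
      have hVs : VIn N (insert δ δ) ∈ N := by
        convert h.sep_mem (fun x => x.rank ≤ δ.rank)
          (by have := Fact.mk (h.mem_of_mem hγN hδ); infer_instance) hV using 1
        ext x
        rw [mem_VIn_succ, ZFSet.mem_sep, mem_VIn]
        refine ⟨fun hx => ⟨⟨hx.1, hx.2.trans_lt (ZFSet.rank_lt_of_mem hδ)⟩, hx.2⟩,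
          fun hx => ⟨hx.1.1, hx.2⟩⟩
      have hAV : InjIn N (κ.sep fun i => ∃ x, PairRel f x i ∧ x.rank ≤ δ.rank)
          (VIn N (insert δ δ)) := by
        have hpre : ∀ i ∈ κ.sep fun i => ∃ x, PairRel f x i ∧ x.rank ≤ δ.rank,
            ∃ x, PairRel f x i ∧ x.rank ≤ δ.rank := fun i hi => (ZFSet.mem_sep.1 hi).2
        choose! e he using hpre
        refine h.injIn_of hA hVs (G := e) (fun i hi => mem_VIn_succ.2
            ⟨h.mem_of_mem hV (hFdom _ _ (he i hi).1), (he i hi).2⟩) (fun i hi j hj hij => ?_)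
          (φ := fun i x => PairRel f x i) inferInstance fun i hi x hx => ?_
        · have h1 := (he i hi).1
          have h2 := (he j hj).1
          rw [← hij] at h2
          rw [(hFf _ (hFdom _ _ h1) _).1 h1, (hFf _ (hFdom _ _ h2) _).1 h2]
        · refine ⟨fun hp => ?_, fun e => e ▸ (he i hi).1⟩
          exact hfi.2 _ _ _ hp (he i hi).1
      obtain ⟨ξ, hξ, hb⟩ := exists_bound h hκ hA hβ
        (h.injIn_trans hA (h.mem_of_mem hκN hβ) hAV hinj) (φ := fun i ξ => i ∈ ξ) inferInstance
        (fun i hi ξ hξ ζ hζ hiζ => (hord.mem hξ).mem_trans hiζ hζ)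
        (fun i hi => ⟨_, insert_mem h hκ (ZFSet.mem_sep.1 hi).1, ZFSet.mem_insert _ _⟩)
      exact ⟨ξ, hξ, fun i hi x hp hr => hb i (ZFSet.mem_sep.2 ⟨hi, x, hp, hr⟩)⟩)
  obtain ⟨x, hx, hp⟩ := hsurj ξ (hκθ hξ)
  obtain ⟨δ, hδ, hxδ⟩ := mem_VIn_iff_exists.1 hx
  exact ZFSet.mem_irrefl _ (hb δ hδ ξ hξ x hp (mem_VIn_succ.1 hxδ).2)

theorem VIn_small (hch : ∀ x ∈ N, ∃ W ∈ N, WellOrders N W x) {γ : ZFSet.{u}} (hγ : γ ∈ κ) :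
    VIn N γ ∈ N ∧ ∃ β ∈ κ, InjIn N (VIn N γ) β := by
  have hord := isOrdinal h hκ
  have hκN := mem h hκ
  induction γ using ZFSet.inductionOn with
  | _ γ ih =>
    have hsucc : ∀ δ ∈ γ, VIn N (insert δ δ) ∈ N ∧ ∃ β ∈ κ, InjIn N (VIn N (insert δ δ)) β := by
      intro δ hδ
      obtain ⟨hV, β, hβ, hinj⟩ := ih δ hδ (hord.mem_trans hδ hγ)
      obtain ⟨p, hp, hpβ, β', hβ', hinj'⟩ := hκ.strong_limit β hβ
      obtain ⟨h1, h2⟩ := h.VIn_succ_small hV (h.mem_of_mem hκN hβ) hinj hp hpβ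
      exact ⟨h1, β', hβ', h.injIn_trans h1 (h.mem_of_mem hκN hβ') h2 hinj'⟩
    have hV := h.VIn_mem_of_succ (h.mem_of_mem hκN hγ) fun δ hδ => (hsucc δ hδ).1
    exact ⟨hV, VIn_limit_small h hκ hch hγ hV fun δ hδ => (hsucc δ hδ).2⟩

theorem VIn_mem (hch : ∀ x ∈ N, ∃ W ∈ N, WellOrders N W x) : VIn N κ ∈ N :=
  h.VIn_mem_of_succ (mem h hκ) fun δ hδ => (VIn_small h hκ hch (insert_mem h hκ hδ)).1

end IsStronglyInaccessibleIn


/-! ### The β-model of MK** given by an inaccessible of a set model -/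

namespace IsStronglyInaccessibleIn

variable {N κ : ZFSet.{u}} (h : IsZF N) (hκ : IsStronglyInaccessibleIn N κ)
include h hκ

theorem mem_VIn_iff {x : ZFSet.{u}} : x ∈ VIn N κ ↔ x ∈ N ∧ ∃ γ ∈ κ, x.rank ≤ γ.rank := by
  rw [mem_VIn, ZFSet.lt_rank_iff]

theorem VIn_transitive : (VIn N κ).IsTransitive := fun x hx y hy =>
  mem_VIn.2 ⟨h.mem_of_mem (mem_VIn.1 hx).1 hy, (ZFSet.rank_lt_of_mem hy).trans (mem_VIn.1 hx).2⟩

theorem mem_VIn_of_bound {x γ : ZFSet.{u}} (hx : x ∈ N) (hγ : γ ∈ κ)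
    (hb : ∀ y ∈ x, y.rank ≤ γ.rank) : x ∈ VIn N κ := by
  refine (mem_VIn_iff h hκ).2 ⟨hx, _, insert_mem h hκ hγ, ?_⟩
  rw [ZFSet.rank_le_iff]
  exact fun y hy => (hb y hy).trans_lt (ZFSet.rank_lt_of_mem (ZFSet.mem_insert _ _))

theorem subset_VIn : κ ⊆ VIn N κ := fun α hα =>
  mem_VIn.2 ⟨h.mem_of_mem (mem h hκ) hα, ZFSet.rank_lt_of_mem hα⟩

theorem upair_mem_VIn {x y : ZFSet.{u}} (hx : x ∈ VIn N κ) (hy : y ∈ VIn N κ) :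
    {x, y} ∈ VIn N κ := by
  obtain ⟨hxN, γ, hγ, hxγ⟩ := (mem_VIn_iff h hκ).1 hx
  obtain ⟨hyN, δ, hδ, hyδ⟩ := (mem_VIn_iff h hκ).1 hy
  rcases le_total γ.rank δ.rank with hr | hr
  · refine mem_VIn_of_bound h hκ (h.upair_mem hxN hyN) hδ fun z hz => ?_
    rcases ZFSet.mem_pair.1 hz with rfl | rfl
    exacts [hxγ.trans hr, hyδ]
  · refine mem_VIn_of_bound h hκ (h.upair_mem hxN hyN) hγ fun z hz => ?_
    rcases ZFSet.mem_pair.1 hz with rfl | rfl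
    exacts [hxγ, hyδ.trans hr]

theorem pair_mem_VIn {x y : ZFSet.{u}} (hx : x ∈ VIn N κ) (hy : y ∈ VIn N κ) :
    ZFSet.pair x y ∈ VIn N κ := by
  refine upair_mem_VIn h hκ ?_ (upair_mem_VIn h hκ hx hy)
  rw [← ZFSet.pair_eq_singleton]
  exact upair_mem_VIn h hκ hx hx

variable (hch : ∀ x ∈ N, ∃ W ∈ N, WellOrders N W x)
include hch

theorem small_of_mem_VIn {x : ZFSet.{u}} (hx : x ∈ VIn N κ) : ∃ β ∈ κ, InjIn N x β := by
  obtain ⟨hxN, γ, hγ, hr⟩ := (mem_VIn_iff h hκ).1 hx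
  obtain ⟨hV, β, hβ, hinj⟩ := VIn_small h hκ hch hγ
  refine ⟨β, hβ, h.injIn_trans hxN (h.mem_of_mem (mem h hκ) hβ) (h.injIn_of_subset hxN hV fun y hy => ?_)
    hinj⟩
  exact mem_VIn.2 ⟨h.mem_of_mem hxN hy, (ZFSet.rank_lt_of_mem hy).trans_le hr⟩

/-- A set of `N` is in `V_κ` as soon as the ranks of its elements are bounded below `κ`. Power sets
exist since `M ∈ N`, so that the subsets of a set can be separated from `M`. For Replacement, the
domain is small, and `exists_bound` bounds the ranks of the values. -/
theorem isModelMK {M C : ZFSet.{u}} (hM : M = VIn N κ) (hC : C = M.powerset ∩ N) :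
    IsModelMK M C := by
  have hMN : M ∈ N := hM ▸ VIn_mem h hκ hch
  have hMt : M.IsTransitive := hM ▸ VIn_transitive h hκ
  have hmemC : ∀ {X}, X ∈ C ↔ X ∈ N ∧ X ⊆ M := h.mem_classes_iff hMN hC
  have hmemM : ∀ {x}, x ∈ M ↔ x ∈ N ∧ ∃ γ ∈ κ, x.rank ≤ γ.rank := by
    rw [hM]; exact mem_VIn_iff h hκ
  have hMN' : ∀ {x}, x ∈ M → x ∈ N := fun hx => h.mem_of_mem hMN hx
  have hbound : ∀ {x γ}, x ∈ N → γ ∈ κ → (∀ y ∈ x, y.rank ≤ γ.rank) → x ∈ M := by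
    rw [hM]; exact mem_VIn_of_bound h hκ
  have := Fact.mk h.trans
  have := Fact.mk hMN
  have : ∀ {n : ℕ} (t s : (Fin n → ZFSet.{u}) → ZFSet.{u}) [Tm N t] [Tm N s],
    Dp N fun v => (t v).rank ≤ (s v).rank := fun t s => h.dp_rank_le
  refine ⟨hMt, fun X hX => (hmemC.1 hX).2, ?_, ?_, ?_, ?_, ?_, ?_, ?_, ?_, ?_, ?_⟩
  · intro x hx y hy H
    ext z
    exact ⟨fun hz => (H z (hMt.mem_trans hz hx)).1 hz, fun hz => (H z (hMt.mem_trans hz hy)).2 hz⟩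
  · intro x hx y hy
    refine ⟨{x, y}, ?_, fun z _ => ZFSet.mem_pair⟩
    rw [hM] at hx hy ⊢
    exact upair_mem_VIn h hκ hx hy
  · have hω : ZFSet.omega ∈ M := hM ▸ subset_VIn h hκ hκ.uncountable
    refine ⟨_, hω, ⟨∅, hMt.mem_trans ZFSet.omega_zero hω, ZFSet.omega_zero,
      fun z _ => ZFSet.notMem_empty z⟩, fun x hx hxω => ⟨insert x x, hMt.mem_trans
        (ZFSet.omega_succ hxω) hω, ZFSet.omega_succ hxω, fun z _ => ?_⟩⟩
    rw [ZFSet.mem_insert_iff, or_comm]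
  · intro x hx
    refine ⟨ZFSet.sUnion x, ?_, fun z _ => ?_⟩
    · obtain ⟨hxN, γ, hγ, hr⟩ := hmemM.1 hx
      exact hmemM.2 ⟨h.sUnion_mem hxN, γ, hγ, (ZFSet.rank_sUnion_le x).trans hr⟩
    · rw [ZFSet.mem_sUnion]
      exact ⟨fun ⟨y, hy, hz⟩ => ⟨y, hMt.mem_trans hy hx, hy, hz⟩, fun ⟨y, _, hy, hz⟩ => ⟨y, hy, hz⟩⟩
  · intro x hx
    obtain ⟨hxN, γ, hγ, hr⟩ := hmemM.1 hx
    have := Fact.mk hxN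
    have hp := h.sep_mem (fun z => z ⊆ x) inferInstance hMN
    refine ⟨_, hbound hp hγ fun y hy => ?_, fun z hz => ?_⟩
    · exact (ZFSet.rank_mono (ZFSet.mem_sep.1 hy).2).trans hr
    · rw [ZFSet.mem_sep, ZFSet.subset_def]
      exact ⟨fun H w _ hw => H.2 hw, fun H => ⟨hz, fun w hw => H w (hMt.mem_trans hw hz) hw⟩⟩
  · rintro X hX ⟨x, -, hx⟩
    obtain ⟨m, hm, hmin⟩ := ZFSet.mem_wf.has_min {x | x ∈ X} ⟨x, hx⟩
    exact ⟨m, (hmemC.1 hX).2 hm, hm, fun y _ hy => hmin y hy⟩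
  · intro X hX Y hY H
    ext z
    exact ⟨fun hz => (H z ((hmemC.1 hX).2 hz)).1 hz, fun hz => (H z ((hmemC.1 hY).2 hz)).2 hz⟩
  · intro F hF _ hFf x hx
    have hFN := (hmemC.1 hF).1
    have hFM := (hmemC.1 hF).2
    have := Fact.mk hFN
    have := Fact.mk (hMN' hx)
    have hy := h.sep_mem (fun w => ∃ z ∈ x, PairRel F z w) inferInstance hMN
    obtain ⟨β, hβ, hinj⟩ := small_of_mem_VIn h hκ hch (hM ▸ hx)
    obtain ⟨ξ, hξ, hb⟩ := exists_bound h hκ (hMN' hx) hβ hinj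
      (φ := fun z ξ => ∀ w, PairRel F z w → w.rank ≤ ξ.rank) inferInstance
      (fun z hz ξ hξ ζ hζ H w hw => (H w hw).trans (ZFSet.rank_lt_of_mem hζ).le) (by
        intro z hz
        by_cases hw : ∃ w, PairRel F z w
        · obtain ⟨w, hw⟩ := hw
          have hwM : w ∈ M := snd_mem_of_transitive hMt (hFM hw)
          obtain ⟨-, γ, hγ, hr⟩ := hmemM.1 hwM
          exact ⟨γ, hγ, fun w' hw' => (hFf z w w' hw hw') ▸ hr⟩
        · exact ⟨∅, empty_mem h hκ, fun w hw' => (hw ⟨w, hw'⟩).elim⟩)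
    refine ⟨_, hbound hy hξ fun w hw => ?_, fun w hw => ?_⟩
    · obtain ⟨-, z, hz, hp⟩ := ZFSet.mem_sep.1 hw
      exact hb z hz w hp
    · rw [ZFSet.mem_sep]
      exact ⟨fun ⟨_, z, hz, hp⟩ => ⟨z, hMt.mem_trans hz hx, hz, hp⟩, fun ⟨z, _, hz, hp⟩ => ⟨hw, z, hz, hp⟩⟩
  · intro φ hφ
    refine ⟨_, hmemC.2 ⟨h.sep_mem (fun x => ∃ hx : x ∈ M, φ (.inl ⟨x, hx⟩))
      (h.dp_of_def₁ hMN hC hφ) hMN, ZFSet.sep_subset⟩, fun x => ?_⟩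
    rw [ZFSet.mem_sep]
    exact ⟨fun ⟨_, _, H⟩ => H, fun H => ⟨x.2, x.2, H⟩⟩
  · obtain ⟨W, hW, hirr, htr, htot, hmin⟩ := hch M hMN
    -- A class must be a subset of `M`. No relevant pair is lost, as `M` is closed under pairs.
    have hW' := h.sep_mem (fun p => p ∈ M) inferInstance hW
    have hiff : ∀ x ∈ M, ∀ y ∈ M, PairRel (W.sep fun p => p ∈ M) x y ↔ PairRel W x y := by
      intro x hx y hy
      rw [PairRel, ZFSet.mem_sep, PairRel]
      refine and_iff_left ?_
      rw [hM] at hx hy ⊢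
      exact pair_mem_VIn h hκ hx hy
    refine ⟨_, hmemC.2 ⟨hW', fun p hp => (ZFSet.mem_sep.1 hp).2⟩, ?_, ?_, ?_, ?_⟩
    · intro x hx
      rw [hiff x hx x hx]
      exact hirr x hx
    · intro x hx y hy z hz
      rw [hiff x hx y hy, hiff y hy z hz, hiff x hx z hz]
      exact htr x hx y hy z hz
    · intro x hx y hy
      rw [hiff x hx y hy, hiff y hy x hx]
      exact htot x hx y hy
    · intro S hS hSM hne
      obtain ⟨m, hm, hm'⟩ := hmin S (hmemC.1 hS).1 hSM hne
      refine ⟨m, hm, fun y hy hne => ?_⟩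
      rw [hiff m (hSM hm) y (hSM hy)]
      exact hm' y hy hne

theorem isBeta {M C : ZFSet.{u}} (hM : M = VIn N κ) (hC : C = M.powerset ∩ N) : IsBeta C := by
  have hMN : M ∈ N := hM ▸ VIn_mem h hκ hch
  have hMt : M.IsTransitive := hM ▸ VIn_transitive h hκ
  have hmemC : ∀ {X}, X ∈ C ↔ X ∈ N ∧ X ⊆ M := h.mem_classes_iff hMN hC
  intro R hR
  constructor
  · intro H
    refine h.wellFounded_of_internal (hmemC.1 hR).1 hMN
      (fun x y hxy => fst_mem_of_transitive hMt ((hmemC.1 hR).2 hxy)) ?_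
    exact fun X hX hXM hne => H X (hmemC.2 ⟨hX, hXM⟩) hne
  · rintro hwf X - ⟨x, hx⟩
    obtain ⟨m, hm, hmin⟩ := hwf.has_min {x | x ∈ X} ⟨x, hx⟩
    exact ⟨m, hm, hmin⟩

/-- Collection in `N` bounds the witnesses by a set `b`, and a well-ordering of `b` in `N` picks the
least witness for each `x`. The class `B` has this witness as its slice at `x`, so the index `y` can
be taken to be `x`. -/
theorem classBounding {M C : ZFSet.{u}} (hM : M = VIn N κ) (hC : C = M.powerset ∩ N) :
    ClassBounding M C := by
  have hMN : M ∈ N := hM ▸ VIn_mem h hκ hch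
  have hMt : M.IsTransitive := hM ▸ VIn_transitive h hκ
  have hmemC : ∀ {X}, X ∈ C ↔ X ∈ N ∧ X ⊆ M := h.mem_classes_iff hMN hC
  have := Fact.mk h.trans
  have := Fact.mk hMN
  have hpairM : ∀ {x y}, x ∈ M → y ∈ M → ZFSet.pair x y ∈ M := by
    rw [hM]; exact pair_mem_VIn h hκ
  intro φ hφ hex
  let ψ : ZFSet.{u} → ZFSet.{u} → Prop := fun x A => ∃ (hx : x ∈ M) (hA : A ∈ C),
    φ (.inl ⟨x, hx⟩) (.inr ⟨A, hA⟩)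
  have hψ : Dp N fun v : Fin 2 → ZFSet.{u} => ψ (v 0) (v 1) := h.dp_of_def₂ hMN hC hφ
  have : ∀ {n : ℕ} (t s : (Fin n → ZFSet.{u}) → ZFSet.{u}) [Tm N t] [Tm N s],
    Dp N fun v => ψ (t v) (s v) := fun t s => hψ.lam₂
  obtain ⟨b, hb, hb'⟩ := h.coll ψ hψ hMN fun x hx => by
    obtain ⟨A, hA⟩ := hex ⟨x, hx⟩
    exact ⟨A.1, (hmemC.1 A.2).1, hx, A.2, hA⟩
  obtain ⟨W, hW, hirr, htr, htot, hmin⟩ := hch b hb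
  have := Fact.mk hb
  have := Fact.mk hW
  let best : ZFSet.{u} → ZFSet.{u} → Prop := fun x A =>
    A ∈ b ∧ ψ x A ∧ ∀ A' ∈ b, ψ x A' → A' = A ∨ PairRel W A A'
  have hbest : ∀ x ∈ M, ∃ A, best x A := by
    intro x hx
    have := Fact.mk (h.mem_of_mem hMN hx)
    obtain ⟨A, hA, hAψ⟩ := hb' x hx
    obtain ⟨m, hm, hm'⟩ := hmin _ (h.sep_mem (fun A => ψ x A) inferInstance hb) ZFSet.sep_subset
      ⟨A, ZFSet.mem_sep.2 ⟨hA, hAψ⟩⟩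
    refine ⟨m, (ZFSet.mem_sep.1 hm).1, (ZFSet.mem_sep.1 hm).2, fun A' hA' hψ' => ?_⟩
    by_cases e : A' = m
    · exact Or.inl e
    · exact Or.inr (hm' A' (ZFSet.mem_sep.2 ⟨hA', hψ'⟩) e)
  have hbu : ∀ x A A', best x A → best x A' → A = A' := by
    rintro x A A' ⟨h1, h2, h3⟩ ⟨h1', h2', h3'⟩
    rcases h3 A' h1' h2' with e | e
    · exact e.symm
    rcases h3' A h1 h2 with e' | e'
    · exact e'
    · exact (hirr A h1 (htr A h1 A' h1' A h1 e e')).elim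
  have hB := h.sep_mem (fun p => ∃ x ∈ M, ∃ A ∈ N,
      (A ∈ b ∧ ψ x A ∧ ∀ A' ∈ b, ψ x A' → A' = A ∨ PairRel W A A') ∧ ∃ z ∈ A,
      p = ZFSet.pair x z) inferInstance hMN
  refine ⟨_, hmemC.2 ⟨hB, ZFSet.sep_subset⟩, fun x => ?_⟩
  obtain ⟨A, hA⟩ := hbest x x.2
  obtain ⟨hx, hAC, hφA⟩ := hA.2.1
  refine ⟨x, x.2, ⟨A, hAC⟩, ?_, hφA⟩
  ext z
  rw [mem_slice, ZFSet.mem_sep]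
  constructor
  · intro hz
    refine ⟨?_, x, x.2, A, (hmemC.1 hAC).1, hA, z, hz, rfl⟩
    exact hpairM x.2 ((hmemC.1 hAC).2 hz)
  · rintro ⟨-, x', hx', A', hA'N, hA', z', hz', e⟩
    obtain ⟨rfl, rfl⟩ := ZFSet.pair_inj.1 e
    exact hbu x A A' hA hA' ▸ hz'

end IsStronglyInaccessibleIn

instance Dp.indexedBy {T : ZFSet.{u}} [hT : Fact T.IsTransitive] {n : ℕ}
    {t s : (Fin n → ZFSet.{u}) → ZFSet.{u}} [ht : Tm T t] [hs : Tm T s] :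
    Dp T fun v => IndexedBy (t v) (s v) :=
  (inferInstance : Dp T fun v => ∀ p ∈ t v, ∃ i ∈ s v, ∃ z ∈ T, p = ZFSet.pair i z).congr
    fun v hv => by
      refine forall₂_congr fun p hp => exists_congr fun i => and_congr_right fun hi =>
        ⟨fun ⟨z, hz⟩ => ⟨z, ?_, hz⟩, fun ⟨z, _, hz⟩ => ⟨z, hz⟩⟩
      subst hz
      exact snd_mem_of_transitive hT.out (hT.out.mem_trans hp (ht.mem hv))

instance Dp.isSeq {T : ZFSet.{u}} [hT : Fact T.IsTransitive] {n : ℕ}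
    {t s : (Fin n → ZFSet.{u}) → ZFSet.{u}} [ht : Tm T t] [hs : Tm T s] :
    Dp T fun v => IsSeq (t v) (s v) :=
  (inferInstance : Dp T fun v => IndexedBy (t v) (s v) ∧ ∀ i ∈ s v, ∃ y, PairRel (t v) i y ∧
    ∀ z, PairRel (t v) i z → z = y).congr fun v hv => Iff.rfl

theorem IsSeq.length_unique {f α β : ZFSet.{u}} (hα : IsSeq f α) (hβ : IsSeq f β) : α = β := by
  have key : ∀ {f α β : ZFSet.{u}}, IsSeq f α → IsSeq f β → α ⊆ β := by
    intro f α β hα hβ i hi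
    obtain ⟨y, hy, -⟩ := hα.2 i hi
    obtain ⟨j, hj, z, e⟩ := hβ.1 _ hy
    obtain ⟨rfl, -⟩ := ZFSet.pair_inj.1 e
    exact hj
  exact subset_antisymm (key hα hβ) (key hβ hα)

theorem mem_restrict {F i p : ZFSet.{u}} :
    p ∈ restrict F i ↔ p ∈ F ∧ ∃ j ∈ i, ∃ z, p = ZFSet.pair j z := by
  rw [restrict, ZFSet.mem_sep]

theorem pair_mem_restrict {F i j z : ZFSet.{u}} :
    ZFSet.pair j z ∈ restrict F i ↔ ZFSet.pair j z ∈ F ∧ j ∈ i := by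
  rw [mem_restrict]
  refine and_congr_right fun _ => ⟨?_, fun hj => ⟨j, hj, z, rfl⟩⟩
  rintro ⟨j', hj, z', e⟩
  rwa [(ZFSet.pair_inj.1 e).1]

theorem IsSeq.restrict {f α i : ZFSet.{u}} (hf : IsSeq f α) (hi : i ⊆ α) :
    IsSeq (restrict f i) i := by
  refine ⟨fun p hp => (mem_restrict.1 hp).2, fun j hj => ?_⟩
  obtain ⟨y, hy, hy'⟩ := hf.2 j (hi hj)
  exact ⟨y, pair_mem_restrict.2 ⟨hy, hj⟩, fun z hz => hy' z (pair_mem_restrict.1 hz).1⟩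

theorem IsStronglyInaccessibleIn.subset_of_injIn {N κ μ : ZFSet.{u}} (hκ : IsCardinalIn N κ)
    (hμ : μ.IsOrdinal) (hinj : ∃ f ∈ N, IsInjection f κ μ) : κ ⊆ μ := by
  rcases hμ.mem_or_subset hκ.2.1 with hm | hm
  · exact (hκ.2.2 μ hm hinj).elim
  · exact hm

/-- A sequence of classes in the sense of `N` is flattened to a class of pairs, and `χ` asserts `φ`
for the flattened sequence. As `χ` is vacuous for sequences of length outside `κ`, its hypothesis
holds for all lengths below `μ`, and `μ`-Dependent Choice applies although only `κ ⊆ μ` is known.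
The first `κ` terms of the result are flattened again. -/
theorem IsStronglyInaccessibleIn.classDC {N κ : ZFSet.{u}} (h : IsZF N)
    (hκ : IsStronglyInaccessibleIn N κ) (hch : ∀ x ∈ N, ∃ W ∈ N, WellOrders N W x)
    {μ : ZFSet.{u}} (hκμ : κ ⊆ μ) (hDC : DCIn N μ)
    {M C : ZFSet.{u}} (hM : M = VIn N κ) (hC : C = M.powerset ∩ N) : ClassDC M C := by
  have hMN : M ∈ N := hM ▸ VIn_mem h hκ hch
  have hκN := mem h hκ
  have hord := isOrdinal h hκ
  have hMt : M.IsTransitive := hM ▸ VIn_transitive h hκ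
  have hmemC : ∀ {X}, X ∈ C ↔ X ∈ N ∧ X ⊆ M := h.mem_classes_iff hMN hC
  have hκM : κ ⊆ M := hM ▸ subset_VIn h hκ
  have hpairM : ∀ {x y}, x ∈ M → y ∈ M → ZFSet.pair x y ∈ M := by
    rw [hM]; exact pair_mem_VIn h hκ
  have := Fact.mk h.trans
  have := Fact.mk hMN
  have := Fact.mk hκN
  intro φ hφ hex X₀ hX₀
  let ψ : ZFSet.{u} → ZFSet.{u} → ZFSet.{u} → Prop := fun α X Y =>
    ∃ (hα : α ∈ M) (hX : X ∈ C) (hY : Y ∈ C), φ (.inl ⟨α, hα⟩) (.inr ⟨X, hX⟩) (.inr ⟨Y, hY⟩)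
  have hψ : Dp N fun v : Fin 3 → ZFSet.{u} => ψ (v 0) (v 1) (v 2) := h.dp_of_def₃ hMN hC hφ
  have : ∀ {n : ℕ} (t s r : (Fin n → ZFSet.{u}) → ZFSet.{u}) [Tm N t] [Tm N s] [Tm N r],
    Dp N fun v => ψ (t v) (s v) (r v) := fun t s r => hψ.lam₃
  -- the class of pairs that is given by the sequence `f`
  let flat : ZFSet.{u} → ZFSet.{u} → ZFSet.{u} := fun f i =>
    M.sep fun p => ∃ j ∈ i, ∃ s, PairRel f j s ∧ ∃ z ∈ s, p = ZFSet.pair j z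
  have hflat : ∀ f ∈ N, ∀ i ∈ N, flat f i ∈ C := by
    intro f hf i hi
    have := Fact.mk hf
    have := Fact.mk hi
    exact hmemC.2 ⟨h.sep_mem (fun p => ∃ j ∈ i, ∃ s, PairRel f j s ∧ ∃ z ∈ s, p = ZFSet.pair j z)
      inferInstance hMN, ZFSet.sep_subset⟩
  let χ : {x // x ∈ N} → {x // x ∈ N} → Prop := fun f y => ∀ α ∈ κ, ∀ X ∈ N, IsSeq f.1 α →
    (∀ p ∈ M, p ∈ X ↔ ∃ j ∈ α, ∃ s, PairRel f.1 j s ∧ ∃ z ∈ s, p = ZFSet.pair j z) → X ⊆ M →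
    ψ α X y.1
  have hχ : Def₂ setLang χ := (inferInstance : Dp N fun v : Fin 2 → ZFSet.{u} => ∀ α ∈ κ, ∀ X ∈ N,
    IsSeq (v 0) α →
    (∀ p ∈ M, p ∈ X ↔ ∃ j ∈ α, ∃ s, PairRel (v 0) j s ∧ ∃ z ∈ s, p = ZFSet.pair j z) → X ⊆ M →
    ψ α X (v 1)).out
  have hX₀N := (hmemC.1 hX₀).1
  have hflat_eq : ∀ {f i X}, X ⊆ M →
      (∀ p ∈ M, p ∈ X ↔ ∃ j ∈ i, ∃ s, PairRel f j s ∧ ∃ z ∈ s, p = ZFSet.pair j z) →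
      X = flat f i := by
    intro f i X hXM hX
    ext p
    rw [ZFSet.mem_sep]
    exact ⟨fun hp => ⟨hXM hp, (hX p (hXM hp)).1 hp⟩, fun hp => (hX p hp.1).2 hp.2⟩
  obtain ⟨z, hz, hzs, hz0, hzi⟩ := hDC χ hχ (by
    intro α hα f hf
    by_cases hακ : α ∈ κ
    · have hαN := h.mem_of_mem hκN hακ
      obtain ⟨Y, hY⟩ := hex ⟨α, hκM hακ⟩ (hord.mem hακ) ⟨_, hflat f.1 f.2 α hαN⟩ (by
        intro p (hp : p ∈ flat f.1 α)
        obtain ⟨-, j, hj, s, -, z, -, rfl⟩ := ZFSet.mem_sep.1 hp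
        exact ⟨j, hj, z, rfl⟩)
      refine ⟨⟨Y.1, (hmemC.1 Y.2).1⟩, fun α' hα' X hX hseq hXf hXM => ?_⟩
      obtain rfl := hf.length_unique hseq
      obtain rfl := hflat_eq hXM hXf
      exact ⟨hκM hακ, _, Y.2, hY⟩
    · refine ⟨⟨∅, h.empty_mem⟩, fun α' hα' X hX hseq => ?_⟩
      exact (hακ (hf.length_unique hseq ▸ hα')).elim) X₀ hX₀N
  have hZslice : ∀ i ∈ κ, ∀ y, ZFSet.pair i y ∈ z → y ⊆ M → slice (flat z κ) i = y := by
    intro i hi y hy hyM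
    ext w
    rw [mem_slice, ZFSet.mem_sep]
    constructor
    · rintro ⟨-, j, hj, s, hs, w', hw', e⟩
      obtain ⟨rfl, rfl⟩ := ZFSet.pair_inj.1 e
      rwa [(hzs.2 i (hκμ hi)).unique hy hs]
    · intro hw
      exact ⟨hpairM (hκM hi) (hyM hw), i, hi, y, hy, w, hw, rfl⟩
  refine ⟨flat z κ, hflat z hz κ hκN, hZslice ∅ (empty_mem h hκ) X₀ hz0 (hmemC.1 hX₀).2, ?_⟩
  rintro ⟨i, hiM⟩ hio hi0
  -- The ordinals in `M = V_κ` are those below `κ`, as ranks compare ordinals.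
  have hiκ : i ∈ κ := by
    rw [← ZFSet.IsOrdinal.rank_lt_iff_mem hio hord]
    rw [hM] at hiM
    exact (mem_VIn.1 hiM).2
  obtain ⟨⟨f, hf⟩, ⟨y, hyN⟩, rfl, hy, hfy⟩ := hzi i (hκμ hiκ) hi0
  have hrestrict : restrict (flat z κ) i = flat (restrict z i) i := by
    ext p
    rw [mem_restrict, ZFSet.mem_sep, ZFSet.mem_sep]
    constructor
    · rintro ⟨⟨hp, j, hj, s, hs, w, hw, rfl⟩, j', hj', w', e⟩
      obtain ⟨rfl, rfl⟩ := ZFSet.pair_inj.1 e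
      exact ⟨hp, j, hj', s, pair_mem_restrict.2 ⟨hs, hj'⟩, w, hw, rfl⟩
    · rintro ⟨hp, j, hj, s, hs, w, hw, rfl⟩
      exact ⟨⟨hp, j, hord.mem_trans hj hiκ, s, (pair_mem_restrict.1 hs).1, w, hw, rfl⟩,
        j, hj, w, rfl⟩
  have hiN := h.mem_of_mem hκN hiκ
  have hPC := hflat _ hf i hiN
  obtain ⟨_, _, hyC, hφy⟩ := hfy i hiκ (flat (restrict z i) i) (hmemC.1 hPC).1
    (hzs.restrict (hord.subset_of_mem hiκ |>.trans hκμ)) (by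
      intro p hp
      rw [ZFSet.mem_sep]
      exact and_iff_right hp) ZFSet.sep_subset
  exact ⟨⟨_, hPC⟩, ⟨y, hyC⟩, hrestrict.symm, (hZslice i hiκ y hy (hmemC.1 hyC).2).symm, hφy⟩

theorem IsModelSetMKss.isModelMKss_and_isBeta {N κ M C : ZFSet.{u}} (hN : N.IsTransitive)
    (hmod : IsModelSetMKss N) (hκ : IsStronglyInaccessibleIn N κ) (hM : M = VIn N κ)
    (hC : C = M.powerset ∩ N) : IsModelMKss M C ∧ IsBeta C := by
  have h : IsZF N := hmod.toIsModelZFCminus.isZF hN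
  have hch := hmod.choice
  obtain ⟨μ, hμ, hinj, hDC⟩ := hmod.inaccessible
  -- The given inaccessible `κ` may differ a priori from the cardinal `μ` of the axioms, but it
  -- injects into `μ`.
  have hκμ : κ ⊆ μ := IsStronglyInaccessibleIn.subset_of_injIn hκ.cardinal hμ.cardinal.2.1
    (hinj κ hκ.cardinal.1)
  exact ⟨⟨hκ.isModelMK h hch hM hC, hκ.classBounding h hch hM hC,
    hκ.classDC h hch hκμ hDC hM hC⟩, hκ.isBeta h hch hM hC⟩


/-! ### The hull of a β-model -/

theorem pair_ne_empty (x y : ZFSet.{u}) : ZFSet.pair x y ≠ ∅ := by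
  intro e
  rw [ZFSet.eq_empty] at e
  exact e {x} (by simp [ZFSet.pair])

theorem singleton_empty_ne : ({∅} : ZFSet.{u}) ≠ ∅ := by
  intro e
  rw [ZFSet.eq_empty] at e
  exact e ∅ (by simp)

namespace IsModelMK

variable {M C : ZFSet.{u}} (h : IsModelMK M C)
include h

/-- Class comprehension for formulas of the one-sorted structure `(C, ∈)`, in the form that `Dp`
instances can feed. -/
theorem sep_mem (P : ZFSet.{u} → Prop) (hP : Dp C fun v : Fin 1 → ZFSet.{u} => P (v 0)) :
    M.sep P ∈ C := by
  obtain ⟨Y, hY, hYP⟩ := h.comprehension (fun a => P a.val) (h.definable_of_dp hP)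
  convert hY using 1
  ext z
  rw [ZFSet.mem_sep]
  exact ⟨fun hz => (hYP ⟨z, hz.1⟩).2 hz.2, fun hz => ⟨h.classes_subset Y hY hz,
    (hYP ⟨z, h.classes_subset Y hY hz⟩).1 hz⟩⟩

theorem upair_mem {x y : ZFSet.{u}} (hx : x ∈ M) (hy : y ∈ M) : {x, y} ∈ M := by
  obtain ⟨p, hp, hp'⟩ := h.pairing x hx y hy
  convert hp using 1
  ext z
  rw [ZFSet.mem_pair]
  refine ⟨fun hz => (hp' z ?_).2 hz, fun hz => (hp' z (h.transitive.mem_trans hz hp)).1 hz⟩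
  rcases hz with rfl | rfl <;> assumption

theorem singleton_mem {x : ZFSet.{u}} (hx : x ∈ M) : {x} ∈ M := by
  rw [← ZFSet.pair_eq_singleton]
  exact h.upair_mem hx hx

theorem pair_mem {x y : ZFSet.{u}} (hx : x ∈ M) (hy : y ∈ M) : ZFSet.pair x y ∈ M :=
  h.upair_mem (h.singleton_mem hx) (h.upair_mem hx hy)

theorem sUnion_mem {x : ZFSet.{u}} (hx : x ∈ M) : ZFSet.sUnion x ∈ M := by
  obtain ⟨p, hp, hp'⟩ := h.union x hx
  convert hp using 1
  ext z
  rw [ZFSet.mem_sUnion]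
  constructor
  · rintro ⟨y, hy, hz⟩
    have hyN := h.transitive.mem_trans hy hx
    exact (hp' z (h.transitive.mem_trans hz hyN)).2 ⟨y, hyN, hy, hz⟩
  · intro hz
    obtain ⟨y, _, hy, hz⟩ := (hp' z (h.transitive.mem_trans hz hp)).1 hz
    exact ⟨y, hy, hz⟩

theorem insert_mem {x y : ZFSet.{u}} (hx : x ∈ M) (hy : y ∈ M) : insert x y ∈ M := by
  have : insert x y = ZFSet.sUnion {{x}, y} := by
    rw [ZFSet.sUnion_pair, ZFSet.insert_eq]
  rw [this]
  exact h.sUnion_mem (h.upair_mem (h.singleton_mem hx) hy)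

theorem empty_mem : ∅ ∈ M := by
  obtain ⟨_, _, ⟨e, he, _, h0⟩, _⟩ := h.infinity
  convert he
  symm
  rw [ZFSet.eq_empty]
  exact fun y hy => h0 y (h.transitive.mem_trans hy he) hy

theorem pairRel_mem {E a b : ZFSet.{u}} (hE : E ∈ C) (hp : PairRel E a b) : a ∈ M ∧ b ∈ M :=
  have hp := h.classes_subset E hE hp
  ⟨fst_mem_of_transitive h.transitive hp, snd_mem_of_transitive h.transitive hp⟩

theorem slice_mem {B i : ZFSet.{u}} (hB : B ∈ C) (hi : i ∈ M) : slice B i ∈ C := by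
  have := Fact.mk h.transitive_classes
  have := Fact.mk hB
  have := Fact.mk (h.sets_subset_classes hi)
  convert h.sep_mem (fun z => ZFSet.pair i z ∈ B) inferInstance using 1
  ext z
  rw [mem_slice, ZFSet.mem_sep]
  exact ⟨fun hz => ⟨(h.pairRel_mem hB hz).2, hz⟩, And.right⟩

/-- The sets that are coded by members of a family of codes form a set that is coded. -/
theorem exists_code_family {B D : ZFSet.{u}} (hB : B ∈ C) (hD : D ∈ C)
    (hwf : ∀ i t, PairRel D i t → WellFounded (PairRel (slice B i))) :
    ∃ X ∈ C, WellFounded (PairRel X) ∧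
      ∀ y, y ∈ collapse X ∅ ↔ ∃ i t, PairRel D i t ∧ y = collapse (slice B i) t := by
  have := Fact.mk h.transitive_classes
  have := Fact.mk hB
  have := Fact.mk hD
  -- A node `u` of the `i`-th code becomes the pair of `i` and `u`, so the codes are disjoint. The
  -- new root is `∅`, which is not a pair; below it lie the pairs of `i` and `t` with `(i, t) ∈ D`.
  let P : ZFSet.{u} → Prop := fun p =>
    (∃ i t, PairRel D i t ∧ ∃ q, PairRel B i q ∧ ∃ u ∈ C, ∃ v ∈ C, q = ZFSet.pair u v ∧
      ∃ a ∈ C, ∃ b ∈ C, a = ZFSet.pair i u ∧ b = ZFSet.pair i v ∧ p = ZFSet.pair a b) ∨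
    ∃ i t, PairRel D i t ∧ ∃ a ∈ C, ∃ b ∈ C, a = ZFSet.pair i t ∧ b = ∅ ∧ p = ZFSet.pair a b
  have hX : M.sep P ∈ C := h.sep_mem P (by simp only [P]; infer_instance)
  have hMC : ∀ {x}, x ∈ M → x ∈ C := fun hx => h.sets_subset_classes hx
  have hXiff : ∀ a b, PairRel (M.sep P) a b ↔
      (∃ i t, PairRel D i t ∧ ∃ u v, PairRel (slice B i) u v ∧ a = ZFSet.pair i u ∧
        b = ZFSet.pair i v) ∨ ∃ i t, PairRel D i t ∧ a = ZFSet.pair i t ∧ b = ∅ := by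
    intro a b
    rw [PairRel, ZFSet.mem_sep]
    constructor
    · rintro ⟨-, ⟨i, t, hit, q, hq, u, -, v, -, rfl, a', -, b', -, rfl, rfl, e⟩ |
        ⟨i, t, hit, a', -, b', -, rfl, rfl, e⟩⟩
      · obtain ⟨rfl, rfl⟩ := ZFSet.pair_inj.1 e
        exact Or.inl ⟨i, t, hit, u, v, mem_slice.2 hq, rfl, rfl⟩
      · obtain ⟨rfl, rfl⟩ := ZFSet.pair_inj.1 e
        exact Or.inr ⟨i, t, hit, rfl, rfl⟩
    · rintro (⟨i, t, hit, u, v, hq, rfl, rfl⟩ | ⟨i, t, hit, rfl, rfl⟩)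
      · have hq := mem_slice.1 hq
        obtain ⟨hi, hq'⟩ := h.pairRel_mem hB hq
        have hu := fst_mem_of_transitive h.transitive hq'
        have hv := snd_mem_of_transitive h.transitive hq'
        exact ⟨h.pair_mem (h.pair_mem hi hu) (h.pair_mem hi hv), Or.inl ⟨i, t, hit, _, hq, u, hMC hu, v,
          hMC hv, rfl, _, hMC (h.pair_mem hi hu), _, hMC (h.pair_mem hi hv), rfl, rfl, rfl⟩⟩
      · obtain ⟨hi, ht⟩ := h.pairRel_mem hD hit
        exact ⟨h.pair_mem (h.pair_mem hi ht) h.empty_mem, Or.inr ⟨i, t, hit, _,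
          hMC (h.pair_mem hi ht), _, hMC h.empty_mem, rfl, rfl, rfl⟩⟩
  have hpred : ∀ i t, PairRel D i t → ∀ a v, PairRel (M.sep P) a (ZFSet.pair i v) ↔
      ∃ u, PairRel (slice B i) u v ∧ a = ZFSet.pair i u := by
    intro i t hit a v
    rw [hXiff]
    constructor
    · rintro (⟨i', t', hit', u, v', hp, rfl, e⟩ | ⟨i', t', hit', rfl, e⟩)
      · obtain ⟨rfl, rfl⟩ := ZFSet.pair_inj.1 e
        exact ⟨u, hp, rfl⟩
      · exact (pair_ne_empty _ _ e).elim
    · rintro ⟨u, hp, rfl⟩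
      exact Or.inl ⟨i, t, hit, u, v, hp, rfl, rfl⟩
  have hacc : ∀ i t, PairRel D i t → ∀ u, Acc (PairRel (M.sep P)) (ZFSet.pair i u) := by
    intro i t hit u
    induction u using (hwf i t hit).induction with
    | _ u ih =>
      constructor
      intro a ha
      obtain ⟨u', hp, rfl⟩ := (hpred i t hit a u).1 ha
      exact ih u' hp
  have hXwf : WellFounded (PairRel (M.sep P)) := by
    refine ⟨fun b => ⟨b, fun a ha => ?_⟩⟩
    rcases (hXiff a b).1 ha with ⟨i, t, hit, u, v, hp, rfl, rfl⟩ | ⟨i, t, hit, rfl, rfl⟩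
    · exact hacc i t hit u
    · exact hacc i t hit t
  have hcol : ∀ i t, PairRel D i t → ∀ u, collapse (M.sep P) (ZFSet.pair i u) =
      collapse (slice B i) u := by
    intro i t hit u
    induction u using (hwf i t hit).induction with
    | _ u ih =>
      ext y
      rw [mem_collapse hXwf, mem_collapse (hwf i t hit)]
      constructor
      · rintro ⟨a, ha, rfl⟩
        obtain ⟨u', hp, rfl⟩ := (hpred i t hit a u).1 ha
        exact ⟨u', hp, (ih u' hp).symm⟩
      · rintro ⟨u', hp, rfl⟩
        exact ⟨_, (hpred i t hit _ u).2 ⟨u', hp, rfl⟩, ih u' hp⟩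
  refine ⟨_, hX, hXwf, fun y => ?_⟩
  rw [mem_collapse hXwf]
  constructor
  · rintro ⟨a, ha, rfl⟩
    rcases (hXiff a ∅).1 ha with ⟨i, t, hit, u, v, hp, rfl, e⟩ | ⟨i, t, hit, rfl, -⟩
    · exact (pair_ne_empty _ _ e.symm).elim
    · exact ⟨i, t, hit, hcol i t hit t⟩
  · rintro ⟨i, t, hit, rfl⟩
    exact ⟨_, (hXiff _ _).2 (Or.inr ⟨i, t, hit, rfl, rfl⟩), hcol i t hit t⟩

/-- Any definable class of nodes of a code gives a coded set. -/
theorem exists_code_nodes {E : ZFSet.{u}} (hE : E ∈ C) (hwf : WellFounded (PairRel E))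
    (Q : ZFSet.{u} → Prop) (hQ : Dp C fun v : Fin 1 → ZFSet.{u} => Q (v 0)) :
    ∃ X ∈ C, WellFounded (PairRel X) ∧
      ∀ y, y ∈ collapse X ∅ ↔ ∃ u ∈ M, Q u ∧ y = collapse E u := by
  have := Fact.mk h.transitive_classes
  have := Fact.mk hE
  have := Fact.mk h.sets_mem_classes
  have : ∀ {n : ℕ} (t : (Fin n → ZFSet.{u}) → ZFSet.{u}) [Tm C t],
    Dp C fun v => Q (t v) := fun t => hQ.lam₁
  -- The family has the single member `E`, with index `∅`, and one top for each node satisfying `Q`.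
  have hB := h.sep_mem (fun p => ∃ i ∈ C, ∃ q ∈ E, i = ∅ ∧ p = ZFSet.pair i q) inferInstance
  have hD := h.sep_mem (fun p => ∃ i ∈ C, ∃ u ∈ M, i = ∅ ∧ Q u ∧ p = ZFSet.pair i u) inferInstance
  have hslice : slice (M.sep fun p => ∃ i ∈ C, ∃ q ∈ E, i = ∅ ∧ p = ZFSet.pair i q) ∅ = E := by
    ext q
    rw [mem_slice, ZFSet.mem_sep]
    constructor
    · rintro ⟨-, i, -, q', hq, rfl, e⟩
      rwa [(ZFSet.pair_inj.1 e).2]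
    · intro hq
      exact ⟨h.pair_mem h.empty_mem (h.classes_subset E hE hq), ∅, h.sets_subset_classes h.empty_mem,
        q, hq, rfl, rfl⟩
  have hDiff : ∀ i t, PairRel (M.sep fun p => ∃ i ∈ C, ∃ u ∈ M, i = ∅ ∧ Q u ∧ p = ZFSet.pair i u) i t ↔
      i = ∅ ∧ t ∈ M ∧ Q t := by
    intro i t
    rw [PairRel, ZFSet.mem_sep]
    constructor
    · rintro ⟨-, i', -, u, hu, rfl, hQu, e⟩
      obtain ⟨rfl, rfl⟩ := ZFSet.pair_inj.1 e
      exact ⟨rfl, hu, hQu⟩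
    · rintro ⟨rfl, ht, hQt⟩
      exact ⟨h.pair_mem h.empty_mem ht, ∅, h.sets_subset_classes h.empty_mem, t, ht, rfl, hQt, rfl⟩
  obtain ⟨X, hX, hXwf, hX'⟩ := h.exists_code_family hB hD (by
    intro i t hit
    rw [((hDiff i t).1 hit).1, hslice]
    exact hwf)
  refine ⟨X, hX, hXwf, fun y => (hX' y).trans ?_⟩
  constructor
  · rintro ⟨i, t, hit, rfl⟩
    obtain ⟨rfl, ht, hQt⟩ := (hDiff i t).1 hit
    exact ⟨t, ht, hQt, by rw [hslice]⟩
  · rintro ⟨u, hu, hQu, rfl⟩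
    exact ⟨∅, u, (hDiff _ _).2 ⟨rfl, hu, hQu⟩, by rw [hslice]⟩

end IsModelMK

/-! ### Codes up to bisimulation and the hull -/

/-- `B` is a bisimulation between `E` and `F`. -/
def Bisim (E F B : ZFSet.{u}) : Prop :=
  ∀ a b, PairRel B a b → (∀ a', PairRel E a' a → ∃ b', PairRel F b' b ∧ PairRel B a' b') ∧
    ∀ b', PairRel F b' b → ∃ a', PairRel E a' a ∧ PairRel B a' b'

/-- Some bisimulation that is a class relates `a` to `b`. -/
def EqCode (C E a F b : ZFSet.{u}) : Prop := ∃ B ∈ C, Bisim E F B ∧ PairRel B a b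

instance Dp.eqCode {C : ZFSet.{u}} [Fact C.IsTransitive] {n : ℕ}
    {t s r q : (Fin n → ZFSet.{u}) → ZFSet.{u}} [Tm C t] [Tm C s] [Tm C r] [Tm C q] :
    Dp C fun v => EqCode C (t v) (s v) (r v) (q v) := by
  unfold EqCode Bisim; infer_instance

theorem Bisim.collapse_eq {E F B a b : ZFSet.{u}} (hE : WellFounded (PairRel E))
    (hF : WellFounded (PairRel F)) (hB : Bisim E F B) (hp : PairRel B a b) :
    collapse E a = collapse F b := by
  induction a using hE.induction generalizing b with
  | _ a ih =>
    ext y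
    rw [mem_collapse hE, mem_collapse hF]
    constructor
    · rintro ⟨a', ha', rfl⟩
      obtain ⟨b', hb', hp'⟩ := (hB a b hp).1 a' ha'
      exact ⟨b', hb', (ih a' ha' hp').symm⟩
    · rintro ⟨b', hb', rfl⟩
      obtain ⟨a', ha', hp'⟩ := (hB a b hp).2 b' hb'
      exact ⟨a', ha', ih a' ha' hp'⟩

/-- For the converse, impredicative comprehension provides the union of all class bisimulations
between `E` and `F`. By induction it already relates all predecessors of `a` and `b` that have equal
collapses, so adjoining the pair of `a` and `b` gives a class bisimulation. -/
theorem IsModelMK.eqCode_iff {M C : ZFSet.{u}} (h : IsModelMK M C) {E F a b : ZFSet.{u}} (hEC : E ∈ C)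
    (hFC : F ∈ C) (hE : WellFounded (PairRel E)) (hF : WellFounded (PairRel F)) (ha : a ∈ M)
    (hb : b ∈ M) : EqCode C E a F b ↔ collapse E a = collapse F b := by
  have := Fact.mk h.transitive_classes
  have := Fact.mk hEC
  have := Fact.mk hFC
  constructor
  · rintro ⟨B, hB, hBis, hp⟩
    exact hBis.collapse_eq hE hF hp
  induction a using hE.induction generalizing b with
  | _ a ih =>
    intro e
    have := Fact.mk (h.sets_subset_classes ha)
    have := Fact.mk (h.sets_subset_classes hb)
    let P : ZFSet.{u} → Prop := fun p => ∃ x ∈ C, ∃ y ∈ C, p = ZFSet.pair x y ∧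
      (EqCode C E x F y ∨ (x = a ∧ y = b))
    have hB : M.sep P ∈ C := h.sep_mem P (by simp only [P]; infer_instance)
    have hBiff : ∀ x y, PairRel (M.sep P) x y ↔ EqCode C E x F y ∨ (x = a ∧ y = b) := by
      intro x y
      rw [PairRel, ZFSet.mem_sep]
      constructor
      · rintro ⟨-, x', -, y', -, e, hxy⟩
        obtain ⟨rfl, rfl⟩ := ZFSet.pair_inj.1 e
        exact hxy
      · intro hxy
        have hM : x ∈ M ∧ y ∈ M := by
          rcases hxy with ⟨B, hB, -, hp⟩ | ⟨rfl, rfl⟩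
          · exact h.pairRel_mem hB hp
          · exact ⟨ha, hb⟩
        exact ⟨h.pair_mem hM.1 hM.2, x, h.sets_subset_classes hM.1, y, h.sets_subset_classes hM.2,
          rfl, hxy⟩
    refine ⟨_, hB, ?_, (hBiff a b).2 (Or.inr ⟨rfl, rfl⟩)⟩
    intro x y hxy
    rcases (hBiff x y).1 hxy with ⟨B, hBC, hBis, hp⟩ | ⟨rfl, rfl⟩
    · refine ⟨fun x' hx' => ?_, fun y' hy' => ?_⟩
      · obtain ⟨y', hy', hp'⟩ := (hBis x y hp).1 x' hx'
        exact ⟨y', hy', (hBiff _ _).2 (Or.inl ⟨B, hBC, hBis, hp'⟩)⟩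
      · obtain ⟨x', hx', hp'⟩ := (hBis x y hp).2 y' hy'
        exact ⟨x', hx', (hBiff _ _).2 (Or.inl ⟨B, hBC, hBis, hp'⟩)⟩
    · refine ⟨fun x' hx' => ?_, fun y' hy' => ?_⟩
      · have : collapse E x' ∈ collapse F y := e ▸ (mem_collapse hE).2 ⟨x', hx', rfl⟩
        obtain ⟨y', hy', e'⟩ := (mem_collapse hF).1 this
        exact ⟨y', hy', (hBiff _ _).2 (Or.inl (ih x' hx' (h.pairRel_mem hEC hx').1
          (h.pairRel_mem hFC hy').1 e'.symm))⟩
      · have : collapse F y' ∈ collapse E x := e ▸ (mem_collapse hF).2 ⟨y', hy', rfl⟩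
        obtain ⟨x', hx', e'⟩ := (mem_collapse hE).1 this
        exact ⟨x', hx', (hBiff _ _).2 (Or.inl (ih x' hx' (h.pairRel_mem hEC hx').1
          (h.pairRel_mem hFC hy').1 e'))⟩

/-- The collapses of the well-founded classes. -/
noncomputable def hull (C : ZFSet.{u}) : ZFSet.{u} :=
  ZFSet.range fun X : (C.sep fun X => WellFounded (PairRel X) : ZFSet.{u}) => collapse X.1 ∅

theorem mem_hull {C x : ZFSet.{u}} :
    x ∈ hull C ↔ ∃ X ∈ C, WellFounded (PairRel X) ∧ collapse X ∅ = x := by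
  rw [hull, ZFSet.mem_range]
  constructor
  · rintro ⟨⟨X, hX⟩, e⟩
    exact ⟨X, (ZFSet.mem_sep.1 hX).1, (ZFSet.mem_sep.1 hX).2, e⟩
  · rintro ⟨X, hX, hwf, e⟩
    exact ⟨⟨X, ZFSet.mem_sep.2 ⟨hX, hwf⟩⟩, e⟩

/-- The hull uses only the top node `∅`; a code with another top `a` is rebuilt from the
predecessors of `a`. -/
theorem IsModelMK.collapse_mem_hull {M C : ZFSet.{u}} (h : IsModelMK M C) {E a : ZFSet.{u}}
    (hE : E ∈ C) (hwf : WellFounded (PairRel E)) (ha : a ∈ M) : collapse E a ∈ hull C := by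
  have := Fact.mk h.transitive_classes
  have := Fact.mk hE
  have := Fact.mk (h.sets_subset_classes ha)
  obtain ⟨X, hX, hXwf, hX'⟩ := h.exists_code_nodes hE hwf (fun u => PairRel E u a) inferInstance
  refine mem_hull.2 ⟨X, hX, hXwf, ?_⟩
  ext y
  rw [hX', mem_collapse hwf]
  exact ⟨fun ⟨u, _, hu, e⟩ => ⟨u, hu, e.symm⟩, fun ⟨u, hu, e⟩ => ⟨u, (h.pairRel_mem hE hu).1, hu, e.symm⟩⟩

/-- Membership on `M`, as a class. -/
theorem IsModelMK.exists_memClass {M C : ZFSet.{u}} (h : IsModelMK M C) : ∃ E ∈ C, (∀ x y, PairRel E x y ↔ x ∈ y ∧ y ∈ M) ∧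
    WellFounded (PairRel E) ∧ ∀ x ∈ M, collapse E x = x := by
  have hT := Fact.mk h.transitive_classes
  have hE := h.sep_mem (fun p => ∃ x ∈ C, ∃ y ∈ C, p = ZFSet.pair x y ∧ x ∈ y) inferInstance
  set E := M.sep fun p => ∃ x ∈ C, ∃ y ∈ C, p = ZFSet.pair x y ∧ x ∈ y with hEdef
  have hiff : ∀ x y, PairRel E x y ↔ x ∈ y ∧ y ∈ M := by
    intro x y
    rw [PairRel, hEdef, ZFSet.mem_sep]
    constructor
    · rintro ⟨hp, x', -, y', -, e, hxy⟩
      obtain ⟨rfl, rfl⟩ := ZFSet.pair_inj.1 e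
      exact ⟨hxy, snd_mem_of_transitive h.transitive hp⟩
    · rintro ⟨hxy, hy⟩
      have hx := h.transitive.mem_trans hxy hy
      exact ⟨h.pair_mem hx hy, x, h.sets_subset_classes hx, y, h.sets_subset_classes hy, rfl, hxy⟩
  have hwf : WellFounded (PairRel E) :=
    Subrelation.wf (fun {x y} hxy => ((hiff x y).1 hxy).1) ZFSet.mem_wf
  refine ⟨E, hE, hiff, hwf, fun x => ?_⟩
  induction x using ZFSet.inductionOn with
  | _ x ih =>
    intro hx
    ext y
    rw [mem_collapse hwf]
    constructor
    · rintro ⟨b, hb, rfl⟩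
      have hb := ((hiff _ _).1 hb).1
      rwa [ih b hb (h.transitive.mem_trans hb hx)]
    · intro hy
      exact ⟨y, (hiff _ _).2 ⟨hy, hx⟩, ih y hy (h.transitive.mem_trans hy hx)⟩

/-! ### The hull of a β-model as a model of set theory -/

section Beta

variable {M C : ZFSet.{u}} (h : IsModelMK M C) (hβ : IsBeta C)
include h hβ

/-- The β-property enters here: being a code, a notion of the ambient universe, becomes a formula
with quantifiers over classes. -/
theorem IsBeta.dp_wellFounded {n : ℕ} {t : (Fin n → ZFSet.{u}) → ZFSet.{u}} [ht : Tm C t] :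
    Dp C fun v => WellFounded (PairRel (t v)) := by
  have := Fact.mk h.transitive_classes
  refine (inferInstance : Dp C fun v => ∀ X ∈ C, (∃ x ∈ X, x = x) →
    ∃ m ∈ X, ∀ y ∈ X, ¬ PairRel (t v) y m).congr fun v hv => ?_
  rw [← hβ _ (ht.mem hv)]
  refine forall₂_congr fun X hX => imp_congr_left ?_
  rw [ZFSet.nonempty_def]
  simp

/-- The hull is interpreted in the class theory. -/
theorem IsBeta.dp_of_hull {n : ℕ} {P : (Fin n → ZFSet.{u}) → Prop} (hP : Dp (hull C) P) :
    Dp C fun w : Fin n → ZFSet.{u} => (∀ i, WellFounded (PairRel (w i))) ∧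
      P fun i => collapse (w i) ∅ := by
  have hT := Fact.mk h.transitive_classes
  have : ∀ {n : ℕ} (t : (Fin n → ZFSet.{u}) → ZFSet.{u}) [Tm C t],
    Dp C fun v => WellFounded (PairRel (t v)) := fun t => hβ.dp_wellFounded h
  have := Fact.mk (h.sets_subset_classes h.empty_mem)
  have key := definable_interpret (L₂ := setLang) isEmpty_setLang_functions
    (fun (d : {x // x ∈ C}) (a : {x // x ∈ hull C}) =>
      WellFounded (PairRel d.1) ∧ collapse d.1 ∅ = a.1) (by
        rintro ⟨a, ha⟩
        obtain ⟨X, hX, hwf, e⟩ := mem_hull.1 ha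
        exact ⟨⟨X, hX⟩, hwf, e⟩)
    (fun d a b ha hb => Subtype.ext (ha.2.symm.trans hb.2)) ?_ ?_ hP.out
  · have hd : Dp C fun w : Fin n → ZFSet.{u} => ∃ v : Fin n → {x // x ∈ hull C},
        (∀ i, WellFounded (PairRel (w i)) ∧ collapse (w i) ∅ = (v i).1) ∧ P fun i => (v i).1 := ⟨key⟩
    refine hd.congr fun w hw => ?_
    constructor
    · rintro ⟨hwf, hp⟩
      exact ⟨fun i => ⟨collapse (w i) ∅, mem_hull.2 ⟨w i, hw i, hwf i, rfl⟩⟩,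
        fun i => ⟨hwf i, rfl⟩, hp⟩
    · rintro ⟨v, hv, hp⟩
      refine ⟨fun i => (hv i).1, ?_⟩
      have : (fun i => collapse (w i) ∅) = fun i => (v i).1 := funext fun i => (hv i).2
      rw [this]
      exact hp
  · have hd : Dp C fun w : Fin 2 → ZFSet.{u} => WellFounded (PairRel (w 0)) ∧
        WellFounded (PairRel (w 1)) ∧ EqCode C (w 0) ∅ (w 1) ∅ := inferInstance
    convert hd.out using 1
    ext w
    constructor
    · rintro ⟨a, ⟨h0, e0⟩, h1, e1⟩
      exact ⟨h0, h1, (h.eqCode_iff (w 0).2 (w 1).2 h0 h1 h.empty_mem h.empty_mem).2 (e0.trans e1.symm)⟩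
    · rintro ⟨h0, h1, e⟩
      exact ⟨⟨_, mem_hull.2 ⟨_, (w 0).2, h0, rfl⟩⟩, ⟨h0, rfl⟩, h1,
        ((h.eqCode_iff (w 0).2 (w 1).2 h0 h1 h.empty_mem h.empty_mem).1 e).symm⟩
  · rintro n ⟨⟩
    have hd : Dp C fun w : Fin 2 → ZFSet.{u} => WellFounded (PairRel (w 0)) ∧
        WellFounded (PairRel (w 1)) ∧ ∃ b, PairRel (w 1) b ∅ ∧ EqCode C (w 0) ∅ (w 1) b := inferInstance
    convert hd.out using 1
    ext w
    constructor
    · rintro ⟨a, h0, hm⟩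
      have hm : (a 0).1 ∈ (a 1).1 := hm
      rw [← (h0 1).2, mem_collapse (h0 1).1] at hm
      obtain ⟨b, hb, e⟩ := hm
      exact ⟨(h0 0).1, (h0 1).1, b, hb, (h.eqCode_iff (w 0).2 (w 1).2 (h0 0).1 (h0 1).1 h.empty_mem
        (h.pairRel_mem (w 1).2 hb).1).2 ((h0 0).2.trans e.symm)⟩
    · rintro ⟨h0, h1, b, hb, e⟩
      refine ⟨![⟨_, mem_hull.2 ⟨_, (w 0).2, h0, rfl⟩⟩, ⟨_, mem_hull.2 ⟨_, (w 1).2, h1, rfl⟩⟩], ?_, ?_⟩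
      · intro i
        fin_cases i
        exacts [⟨h0, rfl⟩, ⟨h1, rfl⟩]
      · exact (mem_collapse h1).2 ⟨b, hb, ((h.eqCode_iff (w 0).2 (w 1).2 h0 h1 h.empty_mem
          (h.pairRel_mem (w 1).2 hb).1).1 e).symm⟩

/-- Each closure property is witnessed by a code. A pair comes from a family with the two indices
`∅` and `{∅}`, a union from the nodes two steps below the top, and Separation from the nodes whose
values satisfy the interpreted formula. For Collection, the class given by Class-Bounding is a
family of codes of witnesses. -/
theorem IsBeta.isZF_hull (hCB : ClassBounding M C) : IsZF (hull C) := by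
  have hT := Fact.mk h.transitive_classes
  have : ∀ {n : ℕ} (t : (Fin n → ZFSet.{u}) → ZFSet.{u}) [Tm C t],
    Dp C fun v => WellFounded (PairRel (t v)) := fun t => hβ.dp_wellFounded h
  have h0C := h.sets_subset_classes h.empty_mem
  have := Fact.mk h0C
  have hMC : ∀ {x}, x ∈ M → x ∈ C := fun hx => h.sets_subset_classes hx
  refine ⟨?_, ?_, ?_, ?_, ?_, ?_⟩
  · intro x hx y hy
    obtain ⟨X, hX, hwf, rfl⟩ := mem_hull.1 hx
    obtain ⟨b, hb, rfl⟩ := (mem_collapse hwf).1 hy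
    exact h.collapse_mem_hull hX hwf (h.pairRel_mem hX hb).1
  · have hwf : WellFounded (PairRel (∅ : ZFSet.{u})) :=
      ⟨fun a => ⟨a, fun b hb => (ZFSet.notMem_empty _ hb).elim⟩⟩
    refine mem_hull.2 ⟨∅, h0C, hwf, ?_⟩
    rw [ZFSet.eq_empty]
    intro y hy
    obtain ⟨b, hb, -⟩ := (mem_collapse hwf).1 hy
    exact ZFSet.notMem_empty _ hb
  · intro x y hx hy
    obtain ⟨X, hX, hXwf, rfl⟩ := mem_hull.1 hx
    obtain ⟨Y, hY, hYwf, rfl⟩ := mem_hull.1 hy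
    have := Fact.mk hX
    have := Fact.mk hY
    have h1M := h.singleton_mem h.empty_mem
    have := Fact.mk (hMC h1M)
    have hB := h.sep_mem (fun p => (∃ i ∈ C, ∃ q ∈ X, i = ∅ ∧ p = ZFSet.pair i q) ∨
      ∃ i ∈ C, ∃ q ∈ Y, i = {∅} ∧ p = ZFSet.pair i q) inferInstance
    have hD := h.sep_mem (fun p => ∃ t ∈ C, t = ∅ ∧ ∃ i ∈ C, (i = ∅ ∨ i = {∅}) ∧ p = ZFSet.pair i t)
      inferInstance
    set B := M.sep fun p => (∃ i ∈ C, ∃ q ∈ X, i = ∅ ∧ p = ZFSet.pair i q) ∨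
      ∃ i ∈ C, ∃ q ∈ Y, i = {∅} ∧ p = ZFSet.pair i q with hBdef
    set D := M.sep fun p => ∃ t ∈ C, t = ∅ ∧ ∃ i ∈ C, (i = ∅ ∨ i = {∅}) ∧ p = ZFSet.pair i t with hDdef
    have hs0 : slice B ∅ = X := by
      ext q
      rw [mem_slice, hBdef, ZFSet.mem_sep]
      constructor
      · rintro ⟨-, ⟨i, -, q', hq, rfl, e⟩ | ⟨i, -, q', hq, rfl, e⟩⟩
        · rwa [(ZFSet.pair_inj.1 e).2]
        · exact (singleton_empty_ne (ZFSet.pair_inj.1 e).1.symm).elim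
      · intro hq
        exact ⟨h.pair_mem h.empty_mem (h.classes_subset X hX hq), Or.inl ⟨_, h0C, q, hq, rfl, rfl⟩⟩
    have hs1 : slice B {∅} = Y := by
      ext q
      rw [mem_slice, hBdef, ZFSet.mem_sep]
      constructor
      · rintro ⟨-, ⟨i, -, q', hq, rfl, e⟩ | ⟨i, -, q', hq, rfl, e⟩⟩
        · exact (singleton_empty_ne (ZFSet.pair_inj.1 e).1).elim
        · rwa [(ZFSet.pair_inj.1 e).2]
      · intro hq
        exact ⟨h.pair_mem h1M (h.classes_subset Y hY hq), Or.inr ⟨_, hMC h1M, q, hq, rfl, rfl⟩⟩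
    have hDiff : ∀ i t, PairRel D i t ↔ t = ∅ ∧ (i = ∅ ∨ i = {∅}) := by
      intro i t
      rw [PairRel, hDdef, ZFSet.mem_sep]
      constructor
      · rintro ⟨-, t', -, rfl, i', -, hi, e⟩
        obtain ⟨rfl, rfl⟩ := ZFSet.pair_inj.1 e
        exact ⟨rfl, hi⟩
      · rintro ⟨rfl, hi⟩
        have hiM : i ∈ M := by rcases hi with rfl | rfl; exacts [h.empty_mem, h1M]
        exact ⟨h.pair_mem hiM h.empty_mem, ∅, h0C, rfl, i, hMC hiM, hi, rfl⟩
    obtain ⟨Z, hZ, hZwf, hZ'⟩ := h.exists_code_family hB hD (by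
      intro i t hit
      rcases ((hDiff i t).1 hit).2 with rfl | rfl
      · rwa [hs0]
      · rwa [hs1])
    refine mem_hull.2 ⟨Z, hZ, hZwf, ?_⟩
    ext y
    rw [hZ', ZFSet.mem_pair]
    constructor
    · rintro ⟨i, t, hit, rfl⟩
      obtain ⟨rfl, rfl | rfl⟩ := (hDiff i t).1 hit
      · exact Or.inl (by rw [hs0])
      · exact Or.inr (by rw [hs1])
    · rintro (rfl | rfl)
      · exact ⟨∅, ∅, (hDiff _ _).2 ⟨rfl, Or.inl rfl⟩, by rw [hs0]⟩
      · exact ⟨{∅}, ∅, (hDiff _ _).2 ⟨rfl, Or.inr rfl⟩, by rw [hs1]⟩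
  · intro x hx
    obtain ⟨X, hX, hXwf, rfl⟩ := mem_hull.1 hx
    have := Fact.mk hX
    obtain ⟨Z, hZ, hZwf, hZ'⟩ := h.exists_code_nodes hX hXwf
      (fun u => ∃ v, PairRel X v ∅ ∧ PairRel X u v) inferInstance
    refine mem_hull.2 ⟨Z, hZ, hZwf, ?_⟩
    ext y
    rw [hZ', ZFSet.mem_sUnion]
    constructor
    · rintro ⟨u, -, ⟨v, hv, hu⟩, rfl⟩
      exact ⟨_, (mem_collapse hXwf).2 ⟨v, hv, rfl⟩, (mem_collapse hXwf).2 ⟨u, hu, rfl⟩⟩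
    · rintro ⟨z, hz, hy⟩
      obtain ⟨v, hv, rfl⟩ := (mem_collapse hXwf).1 hz
      obtain ⟨u, hu, rfl⟩ := (mem_collapse hXwf).1 hy
      exact ⟨u, (h.pairRel_mem hX hu).1, ⟨v, hv, hu⟩, rfl⟩
  · intro P hP x hx
    obtain ⟨X, hX, hXwf, rfl⟩ := mem_hull.1 hx
    have := Fact.mk hX
    have hP' := hβ.dp_of_hull h hP
    have : ∀ {n : ℕ} (t : (Fin n → ZFSet.{u}) → ZFSet.{u}) [Tm C t],
        Dp C fun v => WellFounded (PairRel (t v)) ∧ P (collapse (t v) ∅) := fun t _ =>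
      (hP'.subst ![t] fun i => by fin_cases i; assumption).congr fun v _ => by simp
    obtain ⟨Z, hZ, hZwf, hZ'⟩ := h.exists_code_nodes hX hXwf
      -- The interpreted formula speaks about codes with top `∅`, so the node `u` is replaced by
      -- some code `U` of its value.
      (fun u => PairRel X u ∅ ∧ ∃ U ∈ C, EqCode C U ∅ X u ∧
        (WellFounded (PairRel U) ∧ P (collapse U ∅))) inferInstance
    refine mem_hull.2 ⟨Z, hZ, hZwf, ?_⟩
    ext y
    rw [hZ', ZFSet.mem_sep, mem_collapse hXwf]
    constructor
    · rintro ⟨u, hu, ⟨hup, U, hU, heq, hUwf, hPU⟩, rfl⟩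
      rw [h.eqCode_iff hU hX hUwf hXwf h.empty_mem hu] at heq
      exact ⟨⟨u, hup, rfl⟩, heq ▸ hPU⟩
    · rintro ⟨⟨u, hup, rfl⟩, hPu⟩
      have hu := (h.pairRel_mem hX hup).1
      obtain ⟨U, hU, hUwf, e⟩ := mem_hull.1 (h.collapse_mem_hull hX hXwf hu)
      exact ⟨u, hu, ⟨hup, U, hU, (h.eqCode_iff hU hX hUwf hXwf h.empty_mem hu).2 e, hUwf,
        e.symm ▸ hPu⟩, rfl⟩
  · intro φ hφ x hx hex
    obtain ⟨X, hX, hXwf, rfl⟩ := mem_hull.1 hx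
    have := Fact.mk hX
    have hφ' := hβ.dp_of_hull h hφ
    have : ∀ {n : ℕ} (t s : (Fin n → ZFSet.{u}) → ZFSet.{u}) [Tm C t] [Tm C s],
        Dp C fun v => (WellFounded (PairRel (t v)) ∧ WellFounded (PairRel (s v))) ∧
          φ (collapse (t v) ∅) (collapse (s v) ∅) := fun t s _ _ =>
      (hφ'.subst ![t, s] fun i => by fin_cases i <;> assumption).congr fun v _ => by
        simp [Fin.forall_fin_two]
    let ψ : ZFSet.{u} → ZFSet.{u} → Prop := fun u A => PairRel X u ∅ →
      ∃ U ∈ C, EqCode C U ∅ X u ∧ ((WellFounded (PairRel U) ∧ WellFounded (PairRel A)) ∧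
        φ (collapse U ∅) (collapse A ∅))
    have hψ : Dp C fun v : Fin 2 → ZFSet.{u} => ψ (v 0) (v 1) := by
      simp only [ψ]; infer_instance
    obtain ⟨B, hB, hB'⟩ := hCB (fun a b => ψ a.val b.val) (h.definable_of_dp hψ) (by
      rintro ⟨u, hu⟩
      by_cases hup : PairRel X u ∅
      · obtain ⟨y, hy, hxy⟩ := hex _ ((mem_collapse hXwf).2 ⟨u, hup, rfl⟩)
        obtain ⟨A, hA, hAwf, rfl⟩ := mem_hull.1 hy
        obtain ⟨U, hU, hUwf, e⟩ := mem_hull.1 (h.collapse_mem_hull hX hXwf hu)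
        exact ⟨⟨A, hA⟩, fun _ => ⟨U, hU, (h.eqCode_iff hU hX hUwf hXwf h.empty_mem hu).2 e,
          ⟨hUwf, hAwf⟩, e.symm ▸ hxy⟩⟩
      · exact ⟨⟨∅, h0C⟩, fun hup' => (hup hup').elim⟩)
    have := Fact.mk hB
    -- Class-Bounding gives no information on the other slices of `B`, so the ill-founded ones are
    -- discarded.
    have hD := h.sep_mem (fun p => ∃ t ∈ C, t = ∅ ∧ ∃ i ∈ C, p = ZFSet.pair i t ∧
      ∃ S ∈ C, (∀ z ∈ C, z ∈ S ↔ PairRel B i z) ∧ WellFounded (PairRel S)) inferInstance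
    set D := M.sep fun p => ∃ t ∈ C, t = ∅ ∧ ∃ i ∈ C, p = ZFSet.pair i t ∧
      ∃ S ∈ C, (∀ z ∈ C, z ∈ S ↔ PairRel B i z) ∧ WellFounded (PairRel S) with hDdef
    have hslice : ∀ i, ∀ S ∈ C, (∀ z ∈ C, z ∈ S ↔ PairRel B i z) ↔ S = slice B i := by
      intro i S hS
      constructor
      · intro H
        ext z
        rw [mem_slice]
        exact ⟨fun hz => (H z (hT.out.mem_trans hz hS)).1 hz,
          fun hz => (H z (hMC (h.pairRel_mem hB hz).2)).2 hz⟩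
      · rintro rfl z -
        exact mem_slice
    have hDiff : ∀ i t, PairRel D i t ↔ t = ∅ ∧ i ∈ M ∧ WellFounded (PairRel (slice B i)) := by
      intro i t
      rw [PairRel, hDdef, ZFSet.mem_sep]
      constructor
      · rintro ⟨hp, t', -, rfl, i', -, e, S, hS, hSB, hSwf⟩
        obtain ⟨rfl, rfl⟩ := ZFSet.pair_inj.1 e
        rw [hslice i S hS] at hSB
        exact ⟨rfl, fst_mem_of_transitive h.transitive hp, hSB ▸ hSwf⟩
      · rintro ⟨rfl, hi, hwf⟩
        exact ⟨h.pair_mem hi h.empty_mem, ∅, h0C, rfl, i, hMC hi, rfl, _, h.slice_mem hB hi,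
          (hslice i _ (h.slice_mem hB hi)).2 rfl, hwf⟩
    obtain ⟨Z, hZ, hZwf, hZ'⟩ := h.exists_code_family hB hD fun i t hit => ((hDiff i t).1 hit).2.2
    refine ⟨_, mem_hull.2 ⟨Z, hZ, hZwf, rfl⟩, fun x hx => ?_⟩
    obtain ⟨u, hup, rfl⟩ := (mem_collapse hXwf).1 hx
    have hu := (h.pairRel_mem hX hup).1
    obtain ⟨i, hi, A, hA, hψA⟩ := hB' ⟨u, hu⟩
    obtain ⟨U, hU, heq, ⟨hUwf, hAwf⟩, hφ⟩ := hψA hup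
    have heq : EqCode C U ∅ X u := heq
    have hAwf : WellFounded (PairRel A.1) := hAwf
    have hφ : φ (collapse U ∅) (collapse A.1 ∅) := hφ
    rw [h.eqCode_iff hU hX hUwf hXwf h.empty_mem hu] at heq
    rw [heq, hA] at hφ
    exact ⟨_, (hZ' _).2 ⟨i, ∅, (hDiff _ _).2 ⟨rfl, hi, hA ▸ hAwf⟩, rfl⟩, hφ⟩

/-- Membership on `M` is a class that collapses to itself, so the nodes lying in a class `X` code
`X`. Conversely, a coded subset of `M` is recovered by comprehension: its elements are the `y` whose
node in the membership class is bisimilar to a node just below the top of the code. -/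
theorem IsBeta.classes_eq_hull : C = M.powerset ∩ hull C := by
  have hT := Fact.mk h.transitive_classes
  obtain ⟨E, hE, hiff, hwf, hcol⟩ := h.exists_memClass
  have := Fact.mk hE
  have := Fact.mk (h.sets_subset_classes h.empty_mem)
  ext X
  rw [ZFSet.mem_inter, ZFSet.mem_powerset]
  constructor
  · intro hX
    have hXM := h.classes_subset X hX
    have := Fact.mk hX
    refine ⟨hXM, ?_⟩
    obtain ⟨Z, hZ, hZwf, hZ'⟩ := h.exists_code_nodes hE hwf (fun u => u ∈ X) inferInstance
    refine mem_hull.2 ⟨Z, hZ, hZwf, ?_⟩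
    ext y
    rw [hZ']
    constructor
    · rintro ⟨u, hu, huX, rfl⟩
      rwa [hcol u hu]
    · intro hy
      exact ⟨y, hXM hy, hy, (hcol y (hXM hy)).symm⟩
  · rintro ⟨hXM, hX⟩
    obtain ⟨Z, hZ, hZwf, rfl⟩ := mem_hull.1 hX
    have := Fact.mk hZ
    convert h.sep_mem (fun u => ∃ v, PairRel Z v ∅ ∧ EqCode C Z v E u) inferInstance using 1
    ext y
    rw [ZFSet.mem_sep]
    constructor
    · intro hy
      obtain ⟨v, hv, e⟩ := (mem_collapse hZwf).1 hy
      refine ⟨hXM hy, v, hv, (h.eqCode_iff hZ hE hZwf hwf (h.pairRel_mem hZ hv).1 (hXM hy)).2 ?_⟩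
      rw [e, hcol y (hXM hy)]
    · rintro ⟨hy, v, hv, heq⟩
      rw [h.eqCode_iff hZ hE hZwf hwf (h.pairRel_mem hZ hv).1 hy, hcol y hy] at heq
      exact (mem_collapse hZwf).2 ⟨v, hv, heq⟩

end Beta


/-! ### The ordinals of `M` as an inaccessible cardinal -/

theorem omega_induction {p : ZFSet.{u} → Prop} (h0 : p ∅) (hs : ∀ n, p n → p (insert n n)) :
    ∀ x ∈ ZFSet.omega, p x := by
  have key : ∀ n : ℕ, p (ZFSet.mk (PSet.ofNat n)) := fun n => by
    induction n with
    | zero => exact h0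
    | succ n ih => exact hs _ ih
  intro x
  refine Quotient.inductionOn x fun y hy => ?_
  obtain ⟨⟨n⟩, hn⟩ := hy
  have : (Quotient.mk _ y : ZFSet) = ZFSet.mk (PSet.ofNat n) := Quotient.sound hn
  rw [this]
  exact key n

/-- Inside an inductive set `w`, the natural numbers are described by a bounded formula: `x` and its
elements are transitive, and each is empty or a successor. Separation thus puts `ω` into the model.
-/
theorem mem_omega_iff {w x : ZFSet.{u}} (h0 : ∅ ∈ w) (hs : ∀ y ∈ w, insert y y ∈ w) :
    x ∈ ZFSet.omega ↔ x ∈ w ∧ ∀ m ∈ w, m = x ∨ m ∈ x → x ⊆ w ∧ m.IsTransitive ∧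
      (m = ∅ ∨ ∃ k ∈ m, m = insert k k) := by
  constructor
  · refine omega_induction (p := fun x => x ∈ w ∧ ∀ m ∈ w, m = x ∨ m ∈ x → x ⊆ w ∧ m.IsTransitive ∧
      (m = ∅ ∨ ∃ k ∈ m, m = insert k k)) ?_ ?_ x
    · refine ⟨h0, fun m _ hm => ?_⟩
      rcases hm with rfl | hm
      · exact ⟨ZFSet.empty_subset _, ZFSet.isTransitive_empty, Or.inl rfl⟩
      · exact (ZFSet.notMem_empty _ hm).elim
    · rintro n ⟨hn, hn'⟩
      obtain ⟨hnw, hnt, -⟩ := hn' n hn (Or.inl rfl)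
      refine ⟨hs n hn, fun m hmw hm => ⟨fun z hz => ?_, ?_⟩⟩
      · rcases ZFSet.mem_insert_iff.1 hz with rfl | hz
        exacts [hn, hnw hz]
      · rcases hm with rfl | hm
        · refine ⟨fun y hy z hz => ?_, Or.inr ⟨n, ZFSet.mem_insert _ _, rfl⟩⟩
          rw [ZFSet.mem_insert_iff] at hy ⊢
          rcases hy with rfl | hy
          · exact Or.inr hz
          · exact Or.inr (hnt y hy hz)
        · rw [ZFSet.mem_insert_iff] at hm
          exact (hn' m hmw hm).2
  · induction x using ZFSet.inductionOn with
    | _ x ih =>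
      rintro ⟨hx, hx'⟩
      obtain ⟨hxw, hxt, rfl | ⟨k, hk, rfl⟩⟩ := hx' x hx (Or.inl rfl)
      · exact ZFSet.omega_zero
      · refine ZFSet.omega_succ (ih k hk ⟨hxw hk, fun m hmw hm => ⟨fun z hz => ?_, ?_⟩⟩)
        · exact hxw (ZFSet.mem_insert_of_mem _ hz)
        · exact (hx' m hmw (Or.inr (ZFSet.mem_insert_iff.2 hm))).2

theorem omega_isOrdinal : ZFSet.omega.{u}.IsOrdinal := by
  have key : ∀ x ∈ ZFSet.omega.{u}, x.IsOrdinal ∧ x ⊆ ZFSet.omega := by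
    intro x hx
    have h1 := omega_induction (p := ZFSet.IsOrdinal) ZFSet.isOrdinal_empty
      (fun n hn => ZFSet.isOrdinal_succ hn) x hx
    refine ⟨h1, ?_⟩
    exact (omega_induction (p := fun x => x ∈ ZFSet.omega ∧ x ⊆ ZFSet.omega)
      ⟨ZFSet.omega_zero, ZFSet.empty_subset _⟩ (fun n hn => ⟨ZFSet.omega_succ hn.1, fun z hz => by
        rcases ZFSet.mem_insert_iff.1 hz with rfl | hz
        exacts [hn.1, hn.2 hz]⟩) x hx).2
  rw [ZFSet.isOrdinal_iff_forall_mem_isOrdinal]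
  exact ⟨fun x hx => (key x hx).2, fun x hx => (key x hx).1⟩

namespace IsModelMK

variable {M C N : ZFSet.{u}} (h : IsModelMK M C) (hN : IsZF N) (hC : ∀ {X}, X ∈ C ↔ X ∈ N ∧ X ⊆ M)
include h hN hC

theorem sets_subset {x : ZFSet.{u}} (hx : x ∈ M) : x ∈ N := (hC.1 (h.sets_subset_classes hx)).1

theorem sets_mem : M ∈ N := (hC.1 h.sets_mem_classes).1

theorem sep_class (P : ZFSet.{u} → Prop) (hP : Dp N fun v : Fin 1 → ZFSet.{u} => P (v 0)) :
    M.sep P ∈ C :=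
  hC.2 ⟨hN.sep_mem P hP (h.sets_mem hN hC), fun x hx => (ZFSet.mem_sep.1 hx).1⟩

/-- The graph is a subset of `M` that belongs to `N`, hence a class, so Replacement of the class
theory applies to functions definable over `N`. -/
theorem image_mem {x : ZFSet.{u}} (hx : x ∈ M) {G : ZFSet.{u} → ZFSet.{u}} (hG : ∀ z ∈ x, G z ∈ M)
    {φ : ZFSet.{u} → ZFSet.{u} → Prop} (hφ : Dp N fun v : Fin 2 → ZFSet.{u} => φ (v 0) (v 1))
    (hφG : ∀ z ∈ x, ∀ w ∈ M, φ z w ↔ w = G z) : ∃ y ∈ M, ∀ w, w ∈ y ↔ ∃ z ∈ x, w = G z := by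
  have := Fact.mk hN.trans
  have := Fact.mk (h.sets_subset hN hC hx)
  have := Fact.mk (h.sets_mem hN hC)
  have : ∀ {n} (t s : (Fin n → ZFSet.{u}) → ZFSet.{u}) [Tm N t] [Tm N s],
    Dp N fun v => φ (t v) (s v) := fun t s => hφ.lam₂
  have hF := h.sep_class hN hC (fun p => ∃ z ∈ x, ∃ w ∈ M, φ z w ∧ p = ZFSet.pair z w) inferInstance
  set F := M.sep fun p => ∃ z ∈ x, ∃ w ∈ M, φ z w ∧ p = ZFSet.pair z w with hFdef
  have hFiff : ∀ z w, ZFSet.pair z w ∈ F ↔ z ∈ x ∧ w = G z := by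
    intro z w
    rw [hFdef, ZFSet.mem_sep]
    constructor
    · rintro ⟨-, z', hz, w', hw, hzw, e⟩
      obtain ⟨rfl, rfl⟩ := ZFSet.pair_inj.1 e
      exact ⟨hz, (hφG z hz w hw).1 hzw⟩
    · rintro ⟨hz, rfl⟩
      exact ⟨h.pair_mem (h.transitive.mem_trans hz hx) (hG z hz), z, hz, _, hG z hz,
        (hφG z hz _ (hG z hz)).2 rfl, rfl⟩
  obtain ⟨y, hy, hy'⟩ := h.replacement F hF (fun p hp => by
      obtain ⟨-, z, -, w, -, -, e⟩ := ZFSet.mem_sep.1 hp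
      exact ⟨z, w, e⟩) (fun a b c hb hc => ((hFiff a b).1 hb).2.trans ((hFiff a c).1 hc).2.symm) x hx
  refine ⟨y, hy, fun w => ⟨fun hw => ?_, ?_⟩⟩
  · obtain ⟨z, -, hz, hp⟩ := (hy' w (h.transitive.mem_trans hw hy)).1 hw
    exact ⟨z, hz, ((hFiff z w).1 hp).2⟩
  · rintro ⟨z, hz, rfl⟩
    exact (hy' _ (hG z hz)).2 ⟨z, h.transitive.mem_trans hz hx, hz, (hFiff _ _).2 ⟨hz, rfl⟩⟩

/-- A nonempty `X ⊆ x` is the image of `x` under the map that fixes `X` and sends everything else to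
one element `c` of `X`. -/
theorem subset_mem {X x : ZFSet.{u}} (hX : X ∈ N) (hx : x ∈ M) (hXx : X ⊆ x) : X ∈ M := by
  classical
  have := Fact.mk hN.trans
  have := Fact.mk hX
  rcases ZFSet.eq_empty_or_nonempty X with rfl | ⟨c, hc⟩
  · exact h.empty_mem
  have := Fact.mk (hN.mem_of_mem hX hc)
  obtain ⟨y, hy, hy'⟩ := h.image_mem hN hC hx (G := fun z => if z ∈ X then z else c) (fun z hz => by
      split_ifs with hzX
      exacts [h.transitive.mem_trans hz hx, h.transitive.mem_trans (hXx hc) hx])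
    (φ := fun z w => (z ∈ X ∧ w = z) ∨ (z ∉ X ∧ w = c)) inferInstance (fun z hz w hw => by
      split_ifs with hzX <;> simp [hzX])
  convert hy using 1
  ext w
  rw [hy']
  constructor
  · intro hw
    exact ⟨w, hXx hw, by rw [if_pos hw]⟩
  · rintro ⟨z, hz, rfl⟩
    split_ifs with hzX
    exacts [hzX, hc]

/-- The set `X` is the image of a subset of `x` under the inverse of the injection. -/
theorem mem_of_injIn {X x : ZFSet.{u}} (hX : X ∈ N) (hXM : X ⊆ M) (hx : x ∈ M) (hinj : InjIn N X x) :
    X ∈ M := by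
  classical
  have := Fact.mk hN.trans
  have := Fact.mk hX
  obtain ⟨f, hf, hfi⟩ := hinj
  have := Fact.mk hf
  obtain ⟨G, hG, hGf, hGi, -⟩ := hfi.exists_fun
  rcases ZFSet.eq_empty_or_nonempty X with rfl | ⟨c, hc⟩
  · exact h.empty_mem
  have := Fact.mk (hN.mem_of_mem hX hc)
  have := Fact.mk (h.sets_subset hN hC hx)
  have hx' := h.subset_mem hN hC (hN.sep_mem (fun z => ∃ a ∈ X, PairRel f a z) inferInstance
    (h.sets_subset hN hC hx)) hx (fun z hz => (ZFSet.mem_sep.1 hz).1)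
  have hex : ∀ z ∈ x.sep (fun z => ∃ a ∈ X, PairRel f a z), ∃ a ∈ X, PairRel f a z :=
    fun z hz => (ZFSet.mem_sep.1 hz).2
  choose! H hH using hex
  obtain ⟨y, hy, hy'⟩ := h.image_mem hN hC hx' (G := H) (fun z hz => hXM (hH z hz).1)
    (φ := fun z a => a ∈ X ∧ PairRel f a z) inferInstance (fun z hz a ha => by
      refine ⟨fun ⟨haX, hp⟩ => hGi a haX _ (hH z hz).1 ?_, fun e => e ▸ hH z hz⟩
      rw [← (hGf a haX z).1 hp, ← (hGf _ (hH z hz).1 z).1 (hH z hz).2])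
  convert hy using 1
  ext w
  rw [hy']
  constructor
  · intro hw
    have hw' : G w ∈ x.sep (fun z => ∃ a ∈ X, PairRel f a z) :=
      ZFSet.mem_sep.2 ⟨hG w hw, w, hw, (hGf w hw _).2 rfl⟩
    refine ⟨G w, hw', hGi w hw _ (hH _ hw').1 ?_⟩
    exact (hGf _ (hH _ hw').1 _).1 (hH _ hw').2
  · rintro ⟨z, hz, rfl⟩
    exact (hH z hz).1

end IsModelMK


/-- The ordinals of `M`. -/
noncomputable def ordinals (M : ZFSet.{u}) : ZFSet.{u} := M.sep ZFSet.IsOrdinal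

theorem mem_ordinals {M α : ZFSet.{u}} : α ∈ ordinals M ↔ α ∈ M ∧ α.IsOrdinal := ZFSet.mem_sep

theorem ordinals_isOrdinal {M : ZFSet.{u}} (hM : M.IsTransitive) : (ordinals M).IsOrdinal := by
  rw [ZFSet.isOrdinal_iff_forall_mem_isOrdinal]
  exact ⟨fun α hα β hβ => mem_ordinals.2 ⟨hM.mem_trans hβ (mem_ordinals.1 hα).1,
    (mem_ordinals.1 hα).2.mem hβ⟩, fun α hα => (mem_ordinals.1 hα).2⟩

theorem sUnion_isOrdinal {x : ZFSet.{u}} (hx : ∀ α ∈ x, α.IsOrdinal) : (ZFSet.sUnion x).IsOrdinal := by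
  rw [ZFSet.isOrdinal_iff_forall_mem_isOrdinal]
  constructor
  · intro β hβ γ hγ
    obtain ⟨α, hα, hβα⟩ := ZFSet.mem_sUnion.1 hβ
    exact ZFSet.mem_sUnion.2 ⟨α, hα, (hx α hα).mem_trans hγ hβα⟩
  · intro β hβ
    obtain ⟨α, hα, hβα⟩ := ZFSet.mem_sUnion.1 hβ
    exact (hx α hα).mem hβα

namespace IsModelMK

variable {M C N : ZFSet.{u}} (h : IsModelMK M C) (hN : IsZF N) (hC : ∀ {X}, X ∈ C ↔ X ∈ N ∧ X ⊆ M)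
include h hN hC

theorem ordinals_mem : ordinals M ∈ N :=
  have := Fact.mk hN.trans
  hN.sep_mem _ inferInstance (h.sets_mem hN hC)

theorem ordinals_notMem : ordinals M ∉ M := fun hm =>
  ZFSet.mem_irrefl _ (mem_ordinals.2 ⟨hm, ordinals_isOrdinal h.transitive⟩)

theorem succ_mem_ordinals {α : ZFSet.{u}} (hα : α ∈ ordinals M) : insert α α ∈ ordinals M := by
  obtain ⟨h1, h2⟩ := mem_ordinals.1 hα
  exact mem_ordinals.2 ⟨h.insert_mem h1 h1, ZFSet.isOrdinal_succ h2⟩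

/-- A map from a set to the ordinals is bounded. -/
theorem exists_bound {x : ZFSet.{u}} (hx : x ∈ M) {G : ZFSet.{u} → ZFSet.{u}}
    (hG : ∀ z ∈ x, G z ∈ ordinals M) {φ : ZFSet.{u} → ZFSet.{u} → Prop}
    (hφ : Dp N fun v : Fin 2 → ZFSet.{u} => φ (v 0) (v 1))
    (hφG : ∀ z ∈ x, ∀ w ∈ M, φ z w ↔ w = G z) : ∃ β ∈ ordinals M, ∀ z ∈ x, G z ∈ β := by
  obtain ⟨y, hy, hy'⟩ := h.image_mem hN hC hx (fun z hz => (mem_ordinals.1 (hG z hz)).1) hφ hφG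
  have ho : (ZFSet.sUnion y).IsOrdinal := sUnion_isOrdinal fun α hα => by
    obtain ⟨z, hz, rfl⟩ := (hy' α).1 hα
    exact (mem_ordinals.1 (hG z hz)).2
  refine ⟨insert (ZFSet.sUnion y) (ZFSet.sUnion y),
    h.succ_mem_ordinals hN hC (mem_ordinals.2 ⟨h.sUnion_mem hy, ho⟩), fun z hz => ?_⟩
  have hsub : G z ⊆ ZFSet.sUnion y := fun w hw => ZFSet.mem_sUnion.2 ⟨G z, (hy' _).2 ⟨z, hz, rfl⟩, hw⟩
  rw [ZFSet.mem_insert_iff]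
  exact ((mem_ordinals.1 (hG z hz)).2.subset_iff_eq_or_mem ho).1 hsub

/-- The elements of `x` are sent to the least ordinals of `M` that bound their ranks; by Replacement
these have a strict upper bound in `M`. -/
theorem exists_rank_le {x : ZFSet.{u}} (hx : x ∈ M) : ∃ α ∈ ordinals M, x.rank ≤ α.rank := by
  have := Fact.mk hN.trans
  have := Fact.mk (h.ordinals_mem hN hC)
  have : ∀ {n : ℕ} (t s : (Fin n → ZFSet.{u}) → ZFSet.{u}) [Tm N t] [Tm N s],
    Dp N fun v => (t v).rank ≤ (s v).rank := fun t s => hN.dp_rank_le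
  have hord := ordinals_isOrdinal h.transitive
  induction x using ZFSet.inductionOn with
  | _ x ih =>
    have hex : ∀ z ∈ x, ∃ α ∈ ordinals M, z.rank ≤ α.rank ∧
        ∀ β ∈ α, ¬ (β ∈ ordinals M ∧ z.rank ≤ β.rank) := fun z hz =>
      exists_least (ih z hz (h.transitive.mem_trans hz hx))
    choose! G hG using hex
    obtain ⟨β, hβ, hβ'⟩ := h.exists_bound hN hC hx (fun z hz => (hG z hz).1)
      (φ := fun z α => α ∈ ordinals M ∧ z.rank ≤ α.rank ∧
        ∀ β ∈ α, ¬ (β ∈ ordinals M ∧ z.rank ≤ β.rank)) inferInstance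
      (fun z hz w hw => ⟨fun hw => least_unique hord (P := fun β => z.rank ≤ β.rank) hw (hG z hz), fun e => e ▸ hG z hz⟩)
    refine ⟨β, hβ, ?_⟩
    rw [ZFSet.rank_le_iff]
    exact fun z hz => (hG z hz).2.1.trans_lt (ZFSet.rank_lt_of_mem (hβ' z hz))

theorem sep_rank_le_mem {α : ZFSet.{u}} (hV : (M.sep fun x => x.rank < α.rank) ∈ M) :
    (M.sep fun x => x.rank ≤ α.rank) ∈ M := by
  obtain ⟨p, hp, hp'⟩ := h.powerset _ hV
  convert hp using 1
  ext z
  rw [ZFSet.mem_sep, ZFSet.rank_le_iff]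
  constructor
  · rintro ⟨hz, hr⟩
    exact (hp' z hz).2 fun w hw hwz => ZFSet.mem_sep.2 ⟨hw, hr hwz⟩
  · intro hz
    have hzM := h.transitive.mem_trans hz hp
    exact ⟨hzM, fun w hw => (ZFSet.mem_sep.1 ((hp' z hzM).1 hz w (h.transitive.mem_trans hw hzM) hw)).2⟩

theorem sep_rank_lt_mem {α : ZFSet.{u}} (hα : α ∈ ordinals M) :
    (M.sep fun x => x.rank < α.rank) ∈ M := by
  have := Fact.mk hN.trans
  have := Fact.mk (h.sets_mem hN hC)
  have : ∀ {n : ℕ} (t s : (Fin n → ZFSet.{u}) → ZFSet.{u}) [Tm N t] [Tm N s],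
    Dp N fun v => (t v).rank ≤ (s v).rank := fun t s => hN.dp_rank_le
  induction α using ZFSet.inductionOn with
  | _ α ih =>
    have hαM := (mem_ordinals.1 hα).1
    obtain ⟨y, hy, hy'⟩ := h.image_mem hN hC hαM (G := fun δ => M.sep fun x => x.rank ≤ δ.rank)
      (fun δ hδ => h.sep_rank_le_mem hN hC (ih δ hδ ((ordinals_isOrdinal h.transitive).mem_trans hδ hα)))
      (φ := fun δ w => ∀ x ∈ M, x ∈ w ↔ x.rank ≤ δ.rank) inferInstance (fun δ hδ w hw => by
        constructor
        · intro H
          ext x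
          rw [ZFSet.mem_sep]
          exact ⟨fun hx => ⟨h.transitive.mem_trans hx hw, (H x (h.transitive.mem_trans hx hw)).1 hx⟩,
            fun hx => (H x hx.1).2 hx.2⟩
        · rintro rfl x hx
          rw [ZFSet.mem_sep]
          exact and_iff_right hx)
    convert h.sUnion_mem hy using 1
    ext x
    rw [ZFSet.mem_sep, ZFSet.mem_sUnion, ZFSet.lt_rank_iff]
    constructor
    · rintro ⟨hx, δ, hδ, hr⟩
      exact ⟨_, (hy' _).2 ⟨δ, hδ, rfl⟩, ZFSet.mem_sep.2 ⟨hx, hr⟩⟩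
    · rintro ⟨w, hw, hx⟩
      obtain ⟨δ, hδ, rfl⟩ := (hy' _).1 hw
      obtain ⟨hx, hr⟩ := ZFSet.mem_sep.1 hx
      exact ⟨hx, δ, hδ, hr⟩

/-- For the inclusion from right to left, the elements of `x` are in `M` by induction, so `x` is a
subset of the level `V_α`, which is a set of `M`; then `subset_mem` applies. -/
theorem sets_eq_VIn : M = VIn N (ordinals M) := by
  ext x
  rw [mem_VIn, ZFSet.lt_rank_iff]
  constructor
  · intro hx
    exact ⟨h.sets_subset hN hC hx, h.exists_rank_le hN hC hx⟩
  · rintro ⟨hx, α, hα, hr⟩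
    induction x using ZFSet.inductionOn with
    | _ x ih =>
      refine h.subset_mem hN hC hx (h.sep_rank_lt_mem hN hC hα) fun z hz => ?_
      have hlt := (ZFSet.rank_lt_of_mem hz).trans_le hr
      exact ZFSet.mem_sep.2 ⟨ih z hz (hN.mem_of_mem hx hz) hlt.le, hlt⟩

/-- A class well-ordering `W` may have initial segments that are proper classes, and its collapse
may exceed the ordinals of `M`. So `M` is ordered by rank first and by `W` among sets of equal rank.
Initial segments are then sets, and the collapse has its values in the ordinals of `M`. -/
theorem injIn_ordinals : InjIn N M (ordinals M) := by
  have := Fact.mk hN.trans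
  have hMN := h.sets_mem hN hC
  have := Fact.mk hMN
  have : ∀ {n : ℕ} (t s : (Fin n → ZFSet.{u}) → ZFSet.{u}) [Tm N t] [Tm N s],
    Dp N fun v => (t v).rank ≤ (s v).rank := fun t s => hN.dp_rank_le
  obtain ⟨W, hW, hirr, htrans, htot, hmin⟩ := h.global_choice
  have := Fact.mk (hC.1 hW).1
  have hE := h.sep_class hN hC (fun p => ∃ x ∈ M, ∃ y ∈ M, p = ZFSet.pair x y ∧ x.rank ≤ y.rank ∧
    (y.rank ≤ x.rank → PairRel W x y)) inferInstance
  set E := M.sep fun p => ∃ x ∈ M, ∃ y ∈ M, p = ZFSet.pair x y ∧ x.rank ≤ y.rank ∧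
    (y.rank ≤ x.rank → PairRel W x y) with hEdef
  have hEiff : ∀ x y, PairRel E x y ↔ x ∈ M ∧ y ∈ M ∧ x.rank ≤ y.rank ∧
      (y.rank ≤ x.rank → PairRel W x y) := by
    intro x y
    rw [PairRel, hEdef, ZFSet.mem_sep]
    constructor
    · rintro ⟨-, x', hx, y', hy, e, hr⟩
      obtain ⟨rfl, rfl⟩ := ZFSet.pair_inj.1 e
      exact ⟨hx, hy, hr⟩
    · rintro ⟨hx, hy, hr⟩
      exact ⟨h.pair_mem hx hy, x, hx, y, hy, rfl, hr⟩
  have hEN := (hC.1 hE).1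
  have := Fact.mk hEN
  have hwf : WellFounded (PairRel E) := by
    refine hN.wellFounded_of_internal hEN hMN (fun x y hxy => ((hEiff x y).1 hxy).1) fun X hX hXM hne => ?_
    have := Fact.mk hX
    -- The least element is the `W`-least one among the elements of minimal rank.
    obtain ⟨r, hr, hrmin⟩ := (InvImage.wf ZFSet.rank (wellFounded_lt (α := Ordinal.{u}))).has_min
      {x | x ∈ X} hne
    have hS := hN.sep_mem (fun x => ∀ y ∈ X, x.rank ≤ y.rank) inferInstance hX
    obtain ⟨m, hm, hm'⟩ := hmin _ (hC.2 ⟨hS, fun z hz => hXM (ZFSet.mem_sep.1 hz).1⟩)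
      (fun z hz => hXM (ZFSet.mem_sep.1 hz).1)
      ⟨r, ZFSet.mem_sep.2 ⟨hr, fun y hy => not_lt.1 (hrmin y hy)⟩⟩
    obtain ⟨hmX, hmr⟩ := ZFSet.mem_sep.1 hm
    refine ⟨m, hmX, fun y hy hym => ?_⟩
    obtain ⟨hyM, hmM, hle, hW'⟩ := (hEiff _ _).1 hym
    have hyS : y ∈ X.sep fun x => ∀ y ∈ X, x.rank ≤ y.rank :=
      ZFSet.mem_sep.2 ⟨hy, fun z hz => hle.trans (hmr z hz)⟩
    have hWy := hW' (hmr y hy)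
    by_cases e : y = m
    · subst e
      exact hirr _ hyM hWy
    · exact hirr _ hmM (htrans m hmM y hyM m hmM (hm' y hyS e) hWy)
  have hEtrans : ∀ x y z, PairRel E x y → PairRel E y z → PairRel E x z := by
    intro x y z hxy hyz
    obtain ⟨hx, hy, h1, h2⟩ := (hEiff _ _).1 hxy
    obtain ⟨-, hz, h3, h4⟩ := (hEiff _ _).1 hyz
    exact (hEiff _ _).2 ⟨hx, hz, h1.trans h3, fun hr => htrans x hx y hy z hz (h2 (h3.trans hr))
      (h4 (hr.trans h1))⟩
  have hEtot : ∀ x ∈ M, ∀ y ∈ M, x = y ∨ PairRel E x y ∨ PairRel E y x := by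
    intro x hx y hy
    rcases lt_trichotomy x.rank y.rank with hr | hr | hr
    · exact Or.inr (Or.inl ((hEiff _ _).2 ⟨hx, hy, hr.le, fun hr' => (hr.not_ge hr').elim⟩))
    · rcases htot x hx y hy with e | hxy | hyx
      · exact Or.inl e
      · exact Or.inr (Or.inl ((hEiff _ _).2 ⟨hx, hy, hr.le, fun _ => hxy⟩))
      · exact Or.inr (Or.inr ((hEiff _ _).2 ⟨hy, hx, hr.ge, fun _ => hyx⟩))
    · exact Or.inr (Or.inr ((hEiff _ _).2 ⟨hy, hx, hr.le, fun hr' => (hr.not_ge hr').elim⟩))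
  have htr : ∀ a, (collapse E a).IsTransitive := by
    intro a y hy z hz
    obtain ⟨b, hb, rfl⟩ := (mem_collapse hwf).1 hy
    obtain ⟨c, hc, rfl⟩ := (mem_collapse hwf).1 hz
    exact (mem_collapse hwf).2 ⟨c, hEtrans _ _ _ hc hb, rfl⟩
  have hφ : ∀ a ∈ M, ∀ y, CollapsesTo N E a y ↔ y = collapse E a := fun a ha y =>
    hN.collapsesTo_iff hwf hEN (h.sets_subset hN hC ha)
  have hM : ∀ a ∈ M, collapse E a ∈ ordinals M := by
    intro a
    induction a using hwf.induction with
    | _ a ih =>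
      intro ha
      have := Fact.mk (h.sets_subset hN hC ha)
      obtain ⟨α, hα, hr⟩ := h.exists_rank_le hN hC ha
      have hp := h.subset_mem hN hC (hN.sep_mem (fun b => PairRel E b a) inferInstance hMN)
        (h.sep_rank_le_mem hN hC (h.sep_rank_lt_mem hN hC hα)) (fun b hb => by
          obtain ⟨hb, hba⟩ := ZFSet.mem_sep.1 hb
          exact ZFSet.mem_sep.2 ⟨hb, ((hEiff _ _).1 hba).2.2.1.trans hr⟩)
      obtain ⟨y, hy, hy'⟩ := h.image_mem hN hC hp (G := collapse E) (fun b hb => by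
          obtain ⟨hb, hba⟩ := ZFSet.mem_sep.1 hb
          exact (mem_ordinals.1 (ih b hba hb)).1) (φ := fun a y => CollapsesTo N E a y) inferInstance
        (fun b hb w hw => hφ b (ZFSet.mem_sep.1 hb).1 w)
      have e : collapse E a = y := by
        ext z
        rw [mem_collapse hwf, hy']
        constructor
        · rintro ⟨b, hb, rfl⟩
          exact ⟨b, ZFSet.mem_sep.2 ⟨((hEiff _ _).1 hb).1, hb⟩, rfl⟩
        · rintro ⟨b, hb, rfl⟩
          exact ⟨b, (ZFSet.mem_sep.1 hb).2, rfl⟩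
      refine mem_ordinals.2 ⟨e ▸ hy, ?_⟩
      rw [ZFSet.isOrdinal_iff_forall_mem_isTransitive]
      refine ⟨htr a, fun z hz => ?_⟩
      obtain ⟨b, -, rfl⟩ := (mem_collapse hwf).1 hz
      exact htr b
  refine hN.injIn_of hMN (h.ordinals_mem hN hC) hM (fun a ha b hb e => ?_)
    (φ := fun a y => CollapsesTo N E a y) inferInstance fun a ha y _ => hφ a ha y
  rcases hEtot a ha b hb with e' | hab | hba
  · exact e'
  · have : collapse E a ∈ collapse E b := (mem_collapse hwf).2 ⟨a, hab, rfl⟩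
    rw [e] at this
    exact (ZFSet.mem_irrefl _ this).elim
  · have : collapse E b ∈ collapse E a := (mem_collapse hwf).2 ⟨b, hba, rfl⟩
    rw [e] at this
    exact (ZFSet.mem_irrefl _ this).elim

theorem omega_mem : ZFSet.omega ∈ ordinals M := by
  have := Fact.mk hN.trans
  obtain ⟨w, hw, ⟨e, he, hew, he0⟩, hs⟩ := h.infinity
  have hwN := h.sets_subset hN hC hw
  have := Fact.mk hwN
  have h0 : ∅ ∈ w := by
    convert hew
    symm
    rw [ZFSet.eq_empty]
    exact fun y hy => he0 y (h.transitive.mem_trans hy he) hy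
  have hs' : ∀ y ∈ w, insert y y ∈ w := by
    intro y hy
    have hyM := h.transitive.mem_trans hy hw
    obtain ⟨s, hsM, hsw, hs⟩ := hs y hyM hy
    convert hsw using 1
    ext z
    rw [ZFSet.mem_insert_iff]
    constructor
    · intro hz
      have hzM : z ∈ M := by
        rcases hz with rfl | hz
        exacts [hyM, h.transitive.mem_trans hz hyM]
      exact (hs z hzM).2 hz.symm
    · intro hz
      exact ((hs z (h.transitive.mem_trans hz hsM)).1 hz).symm
  refine mem_ordinals.2 ⟨h.subset_mem hN hC ?_ hw fun x hx => ((mem_omega_iff h0 hs').1 hx).1,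
    omega_isOrdinal⟩
  convert hN.sep_mem (fun x => ∀ m ∈ w, m = x ∨ m ∈ x → x ⊆ w ∧ m.IsTransitive ∧
      (m = ∅ ∨ ∃ k ∈ m, m = insert k k)) inferInstance hwN using 1
  ext x
  rw [ZFSet.mem_sep]
  exact mem_omega_iff h0 hs'

theorem ordinals_isCardinalIn : IsCardinalIn N (ordinals M) :=
  ⟨h.ordinals_mem hN hC, ordinals_isOrdinal h.transitive, fun α hα hinj =>
    h.ordinals_notMem hN hC (h.mem_of_injIn hN hC (h.ordinals_mem hN hC)
      (fun z hz => (mem_ordinals.1 hz).1) (mem_ordinals.1 hα).1 hinj)⟩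

/-- Regularity is Replacement in `M`. For the strong limit property, the power set of `α` is a set
of `M`, so the injection of `M` into its ordinals is bounded on it. -/
theorem ordinals_isStronglyInaccessibleIn : IsStronglyInaccessibleIn N (ordinals M) := by
  have := Fact.mk hN.trans
  refine ⟨h.ordinals_isCardinalIn hN hC, h.omega_mem hN hC, ?_, ?_⟩
  · intro α hα f hf hfun
    have := Fact.mk hf
    have hex : ∀ i ∈ α, ∃ γ, PairRel f i γ ∧ ∀ δ, PairRel f i δ → δ = γ := fun i hi => by
      obtain ⟨γ, h1, h2⟩ := hfun.2 i hi
      exact ⟨γ, h1, h2⟩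
    choose! G hG using hex
    have hGm : ∀ i ∈ α, G i ∈ ordinals M := fun i hi => (ZFSet.pair_mem_prod.1 (hfun.1 (hG i hi).1)).2
    obtain ⟨β, hβ, hβ'⟩ := h.exists_bound hN hC (mem_ordinals.1 hα).1 hGm
      (φ := fun i γ => PairRel f i γ) inferInstance
      (fun i hi γ _ => ⟨(hG i hi).2 γ, fun e => e ▸ (hG i hi).1⟩)
    refine ⟨β, hβ, fun i γ hp => ?_⟩
    have hi : i ∈ α := (ZFSet.pair_mem_prod.1 (hfun.1 hp)).1
    rw [(hG i hi).2 γ hp]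
    exact hβ' i hi
  · intro α hα
    have hαM := (mem_ordinals.1 hα).1
    obtain ⟨p, hp, hp'⟩ := h.powerset α hαM
    have hpN := h.sets_subset hN hC hp
    refine ⟨p, hpN, fun z hz => ?_, ?_⟩
    · constructor
      · intro hzp w hw
        have hzM := h.transitive.mem_trans hzp hp
        exact (hp' z hzM).1 hzp w (h.transitive.mem_trans hw hzM) hw
      · intro hzα
        exact (hp' z (h.subset_mem hN hC hz hαM hzα)).2 fun w _ hw => hzα hw
    · obtain ⟨g, hg, hgi⟩ := h.injIn_ordinals hN hC
      have := Fact.mk hg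
      obtain ⟨G, hG, hGg, hGi, -⟩ := hgi.exists_fun
      have hpM : ∀ z ∈ p, z ∈ M := fun z hz => h.transitive.mem_trans hz hp
      obtain ⟨β, hβ, hβ'⟩ := h.exists_bound hN hC hp (fun z hz => hG z (hpM z hz))
        (φ := fun z w => PairRel g z w) inferInstance (fun z hz w _ => hGg z (hpM z hz) w)
      exact ⟨β, hβ, hN.injIn_of hpN (h.sets_subset hN hC (mem_ordinals.1 hβ).1) hβ'
        (fun a ha b hb => hGi a (hpM a ha) b (hpM b hb)) (φ := fun z w => PairRel g z w) inferInstance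
        fun z hz w _ => hGg z (hpM z hz) w⟩

end IsModelMK


/-! ### Choice and Dependent Choice in the hull -/

namespace IsZF

variable {N : ZFSet.{u}} (h : IsZF N)
include h

/-- Elements of the collapse are values of nodes in `A`; each is sent to the least index of a node
with that value. -/
theorem injIn_collapse {E A κ : ZFSet.{u}} (hE : E ∈ N) (hwf : WellFounded (PairRel E)) (hA : A ∈ N)
    (hκ : κ ∈ N) (hord : κ.IsOrdinal) (hinj : InjIn N A κ) {a : ZFSet.{u}} (ha : a ∈ N)
    (hEA : ∀ b, PairRel E b a → b ∈ A) : InjIn N (collapse E a) κ := by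
  have := Fact.mk h.trans
  obtain ⟨g, hg, hgi⟩ := hinj
  have := Fact.mk hg
  have := Fact.mk hE
  have := Fact.mk ha
  have := Fact.mk hκ
  obtain ⟨G, hG, hGg, hGi, -⟩ := hgi.exists_fun
  let P : ZFSet.{u} → ZFSet.{u} → Prop := fun y ξ => ∃ b, PairRel g b ξ ∧ PairRel E b a ∧
    CollapsesTo N E b y
  have hP : ∀ y ∈ collapse E a, ∃ ξ ∈ κ, P y ξ := by
    intro y hy
    obtain ⟨b, hb, rfl⟩ := (mem_collapse hwf).1 hy
    have hbA := hEA b hb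
    exact ⟨G b, hG b hbA, b, (hGg b hbA _).2 rfl, hb,
      (h.collapsesTo_iff hwf hE (h.mem_of_mem hA hbA)).2 rfl⟩
  have hleast : ∀ y ∈ collapse E a, ∃ ξ ∈ κ, P y ξ ∧ ∀ ζ ∈ ξ, ¬ (ζ ∈ κ ∧ P y ζ) := fun y hy =>
    exists_least (hP y hy)
  choose! H hH using hleast
  refine h.injIn_of (h.exists_sim hwf hE ha).1 hκ (fun y hy => (hH y hy).1) (fun y hy z hz e => ?_)
    (φ := fun y ξ => ξ ∈ κ ∧ P y ξ ∧ ∀ ζ ∈ ξ, ¬ (ζ ∈ κ ∧ P y ζ)) (by simp only [P]; infer_instance)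
    (fun y hy ξ hξ => ⟨fun hξ => least_unique hord hξ (hH y hy), fun e => e ▸ hH y hy⟩)
  obtain ⟨b, hb, hba, hby⟩ := (hH y hy).2.1
  obtain ⟨c, hc, hca, hcz⟩ := (hH z hz).2.1
  have hbA := hEA b hba
  have hcA := hEA c hca
  rw [hGg b hbA] at hb
  rw [hGg c hcA] at hc
  obtain rfl : b = c := hGi b hbA c hcA (by rw [← hb, ← hc, e])
  rw [h.collapsesTo_iff hwf hE (h.mem_of_mem hA hbA)] at hby hcz
  rw [hby, hcz]

theorem exists_wellOrders {x κ : ZFSet.{u}} (hx : x ∈ N) (hκ : κ ∈ N) (hord : κ.IsOrdinal)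
    (hinj : InjIn N x κ) : ∃ W ∈ N, WellOrders N W x := by
  have := Fact.mk h.trans
  obtain ⟨g, hg, hgi⟩ := hinj
  have := Fact.mk hg
  have := Fact.mk hx
  obtain ⟨G, hG, hGg, hGi, -⟩ := hgi.exists_fun
  have hW := h.sep_mem (fun p => ∃ a ∈ x, ∃ b ∈ x, p = ZFSet.pair a b ∧ ∃ c, PairRel g a c ∧
    ∃ d, PairRel g b d ∧ c ∈ d) inferInstance (h.prod_mem hx hx)
  set W := (x.prod x).sep fun p => ∃ a ∈ x, ∃ b ∈ x, p = ZFSet.pair a b ∧ ∃ c, PairRel g a c ∧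
    ∃ d, PairRel g b d ∧ c ∈ d with hWdef
  have hWiff : ∀ a ∈ x, ∀ b ∈ x, PairRel W a b ↔ G a ∈ G b := by
    intro a ha b hb
    rw [PairRel, hWdef, ZFSet.mem_sep]
    constructor
    · rintro ⟨-, a', ha', b', hb', e, c, hc, d, hd, hcd⟩
      obtain ⟨rfl, rfl⟩ := ZFSet.pair_inj.1 e
      rwa [(hGg a ha c).1 hc, (hGg b hb d).1 hd] at hcd
    · intro hab
      exact ⟨ZFSet.pair_mem_prod.2 ⟨ha, hb⟩, a, ha, b, hb, rfl, _, (hGg a ha _).2 rfl, _,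
        (hGg b hb _).2 rfl, hab⟩
  have ho : ∀ a ∈ x, (G a).IsOrdinal := fun a ha => hord.mem (hG a ha)
  have htot : ∀ a ∈ x, ∀ b ∈ x, a = b ∨ PairRel W a b ∨ PairRel W b a := by
    intro a ha b hb
    rcases (ho a ha).mem_trichotomous (ho b hb) with h1 | h1 | h1
    · exact Or.inr (Or.inl ((hWiff a ha b hb).2 h1))
    · exact Or.inl (hGi a ha b hb h1)
    · exact Or.inr (Or.inr ((hWiff b hb a ha).2 h1))
  refine ⟨W, hW, ?_, ?_, htot, ?_⟩
  · intro a ha haa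
    exact ZFSet.mem_irrefl _ ((hWiff a ha a ha).1 haa)
  · intro a ha b hb c hc hab hbc
    exact (hWiff a ha c hc).2 ((ho c hc).mem_trans ((hWiff a ha b hb).1 hab) ((hWiff b hb c hc).1 hbc))
  · intro S _ hSx hne
    obtain ⟨m, hm, hmin⟩ := (InvImage.wf G ZFSet.mem_wf).has_min {a | a ∈ S} hne
    refine ⟨m, hm, fun y hy hym => ?_⟩
    rcases htot y (hSx hy) m (hSx hm) with e | h1 | h1
    · exact (hym e).elim
    · exact (hmin y hy ((hWiff _ (hSx hy) _ (hSx hm)).1 h1)).elim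
    · exact h1

end IsZF

section Beta

variable {M C : ZFSet.{u}} (h : IsModelMK M C) (hβ : IsBeta C)
include h hβ

theorem IsBeta.mem_classes {X : ZFSet.{u}} : X ∈ C ↔ X ∈ hull C ∧ X ⊆ M := by
  conv_lhs => rw [hβ.classes_eq_hull h]
  rw [ZFSet.mem_inter, ZFSet.mem_powerset, and_comm]

/-- A relation between classes that is definable over the hull is definable in the class theory. -/
theorem IsBeta.dp_of_dp_hull {P : ZFSet.{u} → ZFSet.{u} → ZFSet.{u} → Prop}
    (hP : Dp (hull C) fun v : Fin 3 → ZFSet.{u} => P (v 0) (v 1) (v 2)) :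
    Dp C fun v : Fin 3 → ZFSet.{u} => P (v 0) (v 1) (v 2) := by
  have := Fact.mk h.transitive_classes
  have := Fact.mk (h.sets_subset_classes h.empty_mem)
  have : ∀ {n : ℕ} (t : (Fin n → ZFSet.{u}) → ZFSet.{u}) [Tm C t],
    Dp C fun v => WellFounded (PairRel (t v)) := fun t => hβ.dp_wellFounded h
  obtain ⟨E, hE, hiff, hwf, hcol⟩ := h.exists_memClass
  have := Fact.mk hE
  have hP' := hβ.dp_of_hull h hP
  have : ∀ {n : ℕ} (t s r : (Fin n → ZFSet.{u}) → ZFSet.{u}) [Tm C t] [Tm C s] [Tm C r],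
      Dp C fun v => (∀ i, WellFounded (PairRel (![t v, s v, r v] i))) ∧
        P (collapse (t v) ∅) (collapse (s v) ∅) (collapse (r v) ∅) := fun t s r _ _ _ =>
    (hP'.subst ![t, s, r] fun i => by fin_cases i <;> assumption).congr fun v _ => by
      simp [Fin.forall_fin_succ]
  -- The interpretation of the hull has codes as variables, whereas here the variables are the
  -- classes themselves. `Q U X` says within class theory that `U` codes `X`, by comparison with the
  -- membership class.
  let Q : ZFSet.{u} → ZFSet.{u} → Prop := fun U X => WellFounded (PairRel U) ∧
    (∀ u, PairRel U u ∅ → ∃ z ∈ X, EqCode C U u E z) ∧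
    ∀ z ∈ X, ∃ u, PairRel U u ∅ ∧ EqCode C U u E z
  have hQ : ∀ U ∈ C, ∀ X ∈ C, Q U X ↔ WellFounded (PairRel U) ∧ collapse U ∅ = X := by
    intro U hU X hX
    refine and_congr_right fun hUwf => ?_
    have hXM := h.classes_subset X hX
    have heq : ∀ u, PairRel U u ∅ → ∀ z ∈ X, EqCode C U u E z ↔ collapse U u = z := fun u hu z hz => by
      rw [h.eqCode_iff hU hE hUwf hwf (h.pairRel_mem hU hu).1 (hXM hz), hcol z (hXM hz)]
    constructor
    · rintro ⟨h1, h2⟩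
      ext z
      rw [mem_collapse hUwf]
      constructor
      · rintro ⟨u, hu, rfl⟩
        obtain ⟨z, hz, e⟩ := h1 u hu
        rwa [(heq u hu z hz).1 e]
      · intro hz
        obtain ⟨u, hu, e⟩ := h2 z hz
        exact ⟨u, hu, (heq u hu z hz).1 e⟩
    · rintro rfl
      refine ⟨fun u hu => ?_, fun z hz => ?_⟩
      · have hm := (mem_collapse hUwf).2 ⟨u, hu, rfl⟩
        exact ⟨_, hm, (heq u hu _ hm).2 rfl⟩
      · obtain ⟨u, hu, e⟩ := (mem_collapse hUwf).1 hz
        exact ⟨u, hu, (heq u hu z hz).2 e⟩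
  have hex : ∀ X ∈ C, ∃ U ∈ C, WellFounded (PairRel U) ∧ collapse U ∅ = X := fun X hX =>
    mem_hull.1 ((hβ.mem_classes h).1 hX).1
  have hd : Dp C fun v : Fin 3 → ZFSet.{u} => ∃ U ∈ C, Q U (v 0) ∧ ∃ V ∈ C, Q V (v 1) ∧
      ∃ W ∈ C, Q W (v 2) ∧ ((∀ i, WellFounded (PairRel (![U, V, W] i))) ∧
        P (collapse U ∅) (collapse V ∅) (collapse W ∅)) := by
    simp only [Q]; infer_instance
  refine hd.congr fun v hv => ?_
  constructor
  · intro hp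
    obtain ⟨U, hU, hUwf, hU'⟩ := hex _ (hv 0)
    obtain ⟨V, hV, hVwf, hV'⟩ := hex _ (hv 1)
    obtain ⟨W, hW, hWwf, hW'⟩ := hex _ (hv 2)
    refine ⟨U, hU, (hQ U hU _ (hv 0)).2 ⟨hUwf, hU'⟩, V, hV, (hQ V hV _ (hv 1)).2 ⟨hVwf, hV'⟩,
      W, hW, (hQ W hW _ (hv 2)).2 ⟨hWwf, hW'⟩, ?_, ?_⟩
    · intro i
      fin_cases i <;> assumption
    · rwa [hU', hV', hW']
  · rintro ⟨U, hU, hUQ, V, hV, hVQ, W, hW, hWQ, -, hp⟩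
    rwa [((hQ U hU _ (hv 0)).1 hUQ).2, ((hQ V hV _ (hv 1)).1 hVQ).2, ((hQ W hW _ (hv 2)).1 hWQ).2] at hp

theorem IsBeta.injIn_ordinals_of_hull (hCB : ClassBounding M C) {x : ZFSet.{u}} (hx : x ∈ hull C) :
    InjIn (hull C) x (ordinals M) := by
  have hN := hβ.isZF_hull h hCB
  have hC : ∀ {X}, X ∈ C ↔ X ∈ hull C ∧ X ⊆ M := hβ.mem_classes h
  obtain ⟨E, hE, hwf, rfl⟩ := mem_hull.1 hx
  exact hN.injIn_collapse (hC.1 hE).1 hwf (h.sets_mem hN hC) (h.ordinals_mem hN hC)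
    (ordinals_isOrdinal h.transitive) (h.injIn_ordinals hN hC) hN.empty_mem
    fun b hb => (h.pairRel_mem hE hb).1

/-- A class all of whose slices are codes stands for a sequence of sets. `DC_∞` is applied to the
relation `ψ`, which asserts `φ` for the decoded sequence and the next decoded set. The slices of the
resulting class are codes, and Replacement in the hull decodes them to the required sequence. -/
theorem IsBeta.dcIn_hull (hCB : ClassBounding M C) (hDC : ClassDC M C) :
    DCIn (hull C) (ordinals M) := by
  have hN := hβ.isZF_hull h hCB
  have hC : ∀ {X}, X ∈ C ↔ X ∈ hull C ∧ X ⊆ M := hβ.mem_classes h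
  set N := hull C with hNdef
  have hκN := h.ordinals_mem hN hC
  have hord := ordinals_isOrdinal h.transitive
  have h0κ : ∅ ∈ ordinals M := mem_ordinals.2 ⟨h.empty_mem, ZFSet.isOrdinal_empty⟩
  have hκM : ∀ {i}, i ∈ ordinals M → i ∈ M := fun hi => (mem_ordinals.1 hi).1
  have hval : ∀ {X}, X ∈ C → WellFounded (PairRel X) → collapse X ∅ ∈ N := fun hX hwf =>
    mem_hull.2 ⟨_, hX, hwf, rfl⟩
  intro φ hφ hex x hx
  let Φ : ZFSet.{u} → ZFSet.{u} → Prop := fun f y => ∃ (hf : f ∈ N) (hy : y ∈ N), φ ⟨f, hf⟩ ⟨y, hy⟩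
  have hΦ : Dp N fun v : Fin 2 → ZFSet.{u} => Φ (v 0) (v 1) := by
    refine ⟨?_⟩
    unfold Def₂ at hφ
    convert hφ using 1
    ext v
    exact ⟨fun ⟨_, _, h⟩ => h, fun h => ⟨(v 0).2, (v 1).2, h⟩⟩
  let T : ZFSet.{u} → ZFSet.{u} → ZFSet.{u} → Prop := fun X j z =>
    ∃ S ∈ N, (∀ u ∈ N, u ∈ S ↔ PairRel X j u) ∧ CollapsesTo N S ∅ z
  let Ψ : ZFSet.{u} → ZFSet.{u} → ZFSet.{u} → Prop := fun α X Y =>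
    ∃ f ∈ N, ∃ y ∈ N, IsSeq f α ∧ (∀ j ∈ α, ∃ z, PairRel f j z ∧ T X j z) ∧ CollapsesTo N Y ∅ y ∧ Φ f y
  have hslice : ∀ {K X j S : ZFSet.{u}}, K.IsTransitive → X ∈ K → S ∈ K →
      ((∀ u ∈ K, u ∈ S ↔ PairRel X j u) ↔ S = slice X j) := by
    intro K X j S hK hX hS
    constructor
    · intro H
      ext u
      rw [mem_slice]
      exact ⟨fun hu => (H u (hK.mem_trans hu hS)).1 hu,
        fun hu => (H u (pairRel_snd_mem hK hX hu)).2 hu⟩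
    · rintro rfl u -
      exact mem_slice
  have hT : ∀ {X j z}, X ∈ C → j ∈ M → WellFounded (PairRel (slice X j)) →
      (T X j z ↔ z = collapse (slice X j) ∅) := by
    intro X j z hX hj hwf
    have hXN := (hC.1 hX).1
    have hSN := (hC.1 (h.slice_mem hX hj)).1
    constructor
    · rintro ⟨S, hS, hS', hz⟩
      rw [hslice hN.trans hXN hS] at hS'
      subst hS'
      exact (hN.collapsesTo_iff hwf hSN hN.empty_mem).1 hz
    · rintro rfl
      exact ⟨_, hSN, (hslice hN.trans hXN hSN).2 rfl, (hN.collapsesTo_iff hwf hSN hN.empty_mem).2 rfl⟩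
  have hTdp : ∀ {n : ℕ} (t s r : (Fin n → ZFSet.{u}) → ZFSet.{u}) [Tm N t] [Tm N s] [Tm N r],
      Dp N fun v => T (t v) (s v) (r v) := by
    have := Fact.mk hN.trans
    have := Fact.mk hN.empty_mem
    intro n t s r _ _ _
    simp only [T]
    infer_instance
  have hΨ : Dp N fun v : Fin 3 → ZFSet.{u} => Ψ (v 0) (v 1) (v 2) := by
    have := Fact.mk hN.trans
    have := Fact.mk hN.empty_mem
    have : ∀ {n} (t s : (Fin n → ZFSet.{u}) → ZFSet.{u}) [Tm N t] [Tm N s],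
      Dp N fun v => Φ (t v) (s v) := fun t s => hΦ.lam₂
    simp only [Ψ]
    infer_instance
  have hseq : ∀ {X α}, X ∈ C → α ∈ ordinals M → (∀ j ∈ α, WellFounded (PairRel (slice X j))) →
      ∃ f ∈ N, IsSeq f α ∧ ∀ j z, PairRel f j z ↔ j ∈ α ∧ z = collapse (slice X j) ∅ := by
    intro X α hX hα hwf
    have := Fact.mk (hC.1 hX).1
    have hαM : ∀ {j}, j ∈ α → j ∈ M := fun hj => h.transitive.mem_trans hj (hκM hα)
    obtain ⟨f, hf, hf'⟩ := hN.graph (h.sets_subset hN hC (hκM hα)) (G := fun j => collapse (slice X j) ∅)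
      (fun j hj => hval (h.slice_mem hX (hαM hj)) (hwf j hj)) (φ := T X) (hTdp _ _ _)
      (fun j hj z _ => hT hX (hαM hj) (hwf j hj))
    have hfi : ∀ j z, PairRel f j z ↔ j ∈ α ∧ z = collapse (slice X j) ∅ := by
      intro j z
      refine (hf' _).trans ⟨?_, fun ⟨hj, e⟩ => ⟨j, hj, by rw [e]⟩⟩
      rintro ⟨j', hj', e⟩
      obtain ⟨rfl, rfl⟩ := ZFSet.pair_inj.1 e
      exact ⟨hj', rfl⟩
    refine ⟨f, hf, ⟨fun p hp => ?_, fun j hj => ⟨_, (hfi j _).2 ⟨hj, rfl⟩, fun z hz => ((hfi j z).1 hz).2⟩⟩,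
      hfi⟩
    obtain ⟨j, hj, rfl⟩ := (hf' p).1 hp
    exact ⟨j, hj, _, rfl⟩
  have hseq_eq : ∀ {X α f}, X ∈ C → α ∈ ordinals M → (∀ j ∈ α, WellFounded (PairRel (slice X j))) →
      IsSeq f α → (∀ j ∈ α, ∃ z, PairRel f j z ∧ T X j z) →
      ∀ p, p ∈ f ↔ ∃ j ∈ α, p = ZFSet.pair j (collapse (slice X j) ∅) := by
    intro X α f hX hα hwf hf hfT p
    have hαM : ∀ {j}, j ∈ α → j ∈ M := fun hj => h.transitive.mem_trans hj (hκM hα)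
    have hp : ∀ j ∈ α, PairRel f j (collapse (slice X j) ∅) := fun j hj => by
      obtain ⟨z, hz, hz'⟩ := hfT j hj
      rwa [(hT hX (hαM hj) (hwf j hj)).1 hz'] at hz
    constructor
    · intro hpf
      obtain ⟨j, hj, z, rfl⟩ := hf.1 p hpf
      exact ⟨j, hj, by rw [(hf.2 j hj).unique hpf (hp j hj)]⟩
    · rintro ⟨j, hj, rfl⟩
      exact hp j hj
  obtain ⟨X₀, hX₀, hX₀wf, rfl⟩ := mem_hull.1 hx
  -- The relation is vacuous when some slice of `X` is ill-founded, since the hypothesis of `DC_∞`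
  -- concerns all classes of pairs; otherwise it also demands that `Y` be a code.
  let ψ : ZFSet.{u} → ZFSet.{u} → ZFSet.{u} → Prop := fun α X Y =>
    (∀ j ∈ α, ∀ S ∈ C, (∀ u ∈ C, u ∈ S ↔ PairRel X j u) → WellFounded (PairRel S)) →
      WellFounded (PairRel Y) ∧ Ψ α X Y
  have hψ : Dp C fun v : Fin 3 → ZFSet.{u} => ψ (v 0) (v 1) (v 2) := by
    have := Fact.mk h.transitive_classes
    have : ∀ {n : ℕ} (t : (Fin n → ZFSet.{u}) → ZFSet.{u}) [Tm C t],
      Dp C fun v => WellFounded (PairRel (t v)) := fun t => hβ.dp_wellFounded h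
    have hΨ' := hβ.dp_of_dp_hull h hΨ
    have : ∀ {n : ℕ} (t s r : (Fin n → ZFSet.{u}) → ZFSet.{u}) [Tm C t] [Tm C s] [Tm C r],
      Dp C fun v => Ψ (t v) (s v) (r v) := fun t s r => hΨ'.lam₃
    simp only [ψ]
    infer_instance
  have hwfiff : ∀ {X α}, X ∈ C → α ∈ ordinals M →
      ((∀ j ∈ α, ∀ S ∈ C, (∀ u ∈ C, u ∈ S ↔ PairRel X j u) → WellFounded (PairRel S)) ↔
        ∀ j ∈ α, WellFounded (PairRel (slice X j))) := by
    intro X α hX hα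
    refine forall₂_congr fun j hj => ?_
    have hS := h.slice_mem hX (h.transitive.mem_trans hj (hκM hα))
    constructor
    · intro H
      exact H _ hS ((hslice h.transitive_classes hX hS).2 rfl)
    · intro hwf S hS' e
      rw [hslice h.transitive_classes hX hS'] at e
      rwa [e]
  obtain ⟨Z, hZ, hZ0, hZi⟩ := hDC (fun a b c => ψ a.val b.val c.val) (h.definable_of_dp hψ) (by
      rintro ⟨α, hαM⟩ hαo ⟨X, hX⟩ -
      have hα : α ∈ ordinals M := mem_ordinals.2 ⟨hαM, hαo⟩
      by_cases hwf : ∀ j ∈ α, WellFounded (PairRel (slice X j))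
      · obtain ⟨f, hf, hfs, hf'⟩ := hseq hX hα hwf
        obtain ⟨⟨y, hy⟩, hfy⟩ := hex α hα ⟨f, hf⟩ hfs
        obtain ⟨Y, hY, hYwf, rfl⟩ := mem_hull.1 hy
        exact ⟨⟨Y, hY⟩, fun _ => ⟨hYwf, f, hf, _, hy, hfs, fun j hj => ⟨_, (hf' j _).2 ⟨hj, rfl⟩,
          (hT hX (h.transitive.mem_trans hj hαM) (hwf j hj)).2 rfl⟩,
          (hN.collapsesTo_iff hYwf (hC.1 hY).1 hN.empty_mem).2 rfl, hf, hy, hfy⟩⟩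
      · exact ⟨⟨∅, h.sets_subset_classes h.empty_mem⟩, fun H => (hwf ((hwfiff hX hα).1 H)).elim⟩) X₀ hX₀
  have hrestrict : ∀ {i j}, j ∈ i → slice (restrict Z i) j = slice Z j := by
    intro i j hj
    ext z
    rw [mem_slice, mem_slice, pair_mem_restrict]
    exact and_iff_left hj
  have hZψ : ∀ i ∈ ordinals M, i ≠ ∅ → restrict Z i ∈ C ∧ ψ i (restrict Z i) (slice Z i) := by
    intro i hi hi0
    obtain ⟨P, Y, hP, hY, hp⟩ := hZi ⟨i, hκM hi⟩ (mem_ordinals.1 hi).2 hi0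
    have hp : ψ i P.1 Y.1 := hp
    rw [hP, hY] at hp
    exact ⟨hP ▸ P.2, hp⟩
  -- The guard in `ψ` is discharged by induction: if all earlier slices are codes, so is the next
  -- one.
  have hZwf : ∀ i ∈ ordinals M, WellFounded (PairRel (slice Z i)) := by
    intro i
    induction i using ZFSet.inductionOn with
    | _ i ih =>
      intro hi
      by_cases hi0 : i = ∅
      · rwa [hi0, hZ0]
      · obtain ⟨hP, hp⟩ := hZψ i hi hi0
        refine (hp ((hwfiff hP hi).2 fun j hj => ?_)).1
        rw [hrestrict hj]
        exact ih j hj (hord.mem_trans hj hi)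
  have := Fact.mk (hC.1 hZ).1
  obtain ⟨z, hz, hz'⟩ := hN.graph hκN (G := fun j => collapse (slice Z j) ∅)
      (fun j hj => hval (h.slice_mem hZ (hκM hj)) (hZwf j hj)) (φ := T Z) (hTdp _ _ _)
      (fun j hj z _ => hT hZ (hκM hj) (hZwf j hj))
  have hzi : ∀ i ∈ ordinals M, ∀ y, ZFSet.pair i y ∈ z ↔ y = collapse (slice Z i) ∅ := by
    intro i hi y
    refine (hz' _).trans ⟨?_, fun e => ⟨i, hi, by rw [e]⟩⟩
    rintro ⟨j, hj, e⟩
    obtain ⟨rfl, rfl⟩ := ZFSet.pair_inj.1 e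
    rfl
  refine ⟨z, hz, ⟨fun p hp => ?_, fun i hi => ⟨_, (hzi i hi _).2 rfl, fun y hy => (hzi i hi y).1 hy⟩⟩,
    (hzi ∅ h0κ _).2 (by rw [hZ0]), fun i hi hi0 => ?_⟩
  · obtain ⟨j, hj, rfl⟩ := (hz' p).1 hp
    exact ⟨j, hj, _, rfl⟩
  · obtain ⟨hP, hp⟩ := hZψ i hi hi0
    have hwf : ∀ j ∈ i, WellFounded (PairRel (slice (restrict Z i) j)) := fun j hj => by
      rw [hrestrict hj]
      exact hZwf j (hord.mem_trans hj hi)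
    obtain ⟨hYwf, f, hf, y, hy, hfs, hfT, hyc, hf', hy', hfy⟩ := hp ((hwfiff hP hi).2 hwf)
    rw [hN.collapsesTo_iff hYwf (hC.1 (h.slice_mem hZ (hκM hi))).1 hN.empty_mem] at hyc
    refine ⟨⟨f, hf⟩, ⟨y, hy⟩, ?_, (hzi i hi y).2 hyc, hfy⟩
    ext p
    rw [hseq_eq hP hi hwf hfs hfT, mem_restrict, hz']
    constructor
    · rintro ⟨j, hj, rfl⟩
      rw [hrestrict hj]
      exact ⟨⟨j, hord.mem_trans hj hi, rfl⟩, j, hj, _, rfl⟩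
    · rintro ⟨⟨j, hj, rfl⟩, j', hj', z', e⟩
      obtain ⟨rfl, -⟩ := ZFSet.pair_inj.1 e
      exact ⟨j, hj', by rw [hrestrict hj']⟩

end Beta

theorem IsModelMKss.isAssociated_hull {M C : ZFSet.{u}} (h : IsModelMKss M C) (hβ : IsBeta C) :
    IsAssociated M C (hull C) := by
  have hMK := h.toIsModelMK
  have hN := hβ.isZF_hull hMK h.class_bounding
  have hC : ∀ {X}, X ∈ C ↔ X ∈ hull C ∧ X ⊆ M := hβ.mem_classes hMK
  have hκN := hMK.ordinals_mem hN hC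
  have hord := ordinals_isOrdinal hMK.transitive
  have hinj : ∀ x ∈ hull C, InjIn (hull C) x (ordinals M) := fun x hx =>
    hβ.injIn_ordinals_of_hull hMK h.class_bounding hx
  have hcard := hMK.ordinals_isCardinalIn hN hC
  have hinacc := hMK.ordinals_isStronglyInaccessibleIn hN hC
  have := Fact.mk hN.trans
  refine ⟨hN.trans, ⟨⟨?_, ?_, ?_, ?_, ?_, ?_, ?_, ?_⟩, ordinals M, hinacc, hinj,
    hβ.dcIn_hull hMK h.class_bounding h.class_dc⟩, hβ.classes_eq_hull hMK,
    ordinals M, hMK.sets_eq_VIn hN hC, ⟨hcard, fun μ hμ => ?_⟩, hinacc⟩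
  · intro x hx y hy H
    ext z
    exact ⟨fun hz => (H z (hN.mem_of_mem hx hz)).1 hz, fun hz => (H z (hN.mem_of_mem hy hz)).2 hz⟩
  · rintro x hx ⟨y, hy, hyx⟩
    obtain ⟨m, hm, hmin⟩ := ZFSet.mem_wf.has_min {y | y ∈ x} ⟨y, hyx⟩
    exact ⟨m, hN.mem_of_mem hx hm, hm, fun z _ hz => hmin z hz⟩
  · intro x hx y hy
    exact ⟨_, hN.upair_mem hx hy, fun z _ => ZFSet.mem_pair⟩
  · intro x hx
    refine ⟨_, hN.sUnion_mem hx, fun z _ => ZFSet.mem_sUnion.trans ?_⟩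
    exact ⟨fun ⟨y, hy, hz⟩ => ⟨y, hN.mem_of_mem hx hy, hy, hz⟩, fun ⟨y, _, hy, hz⟩ => ⟨y, hy, hz⟩⟩
  · refine ⟨ZFSet.omega, hN.mem_of_mem hκN (hMK.omega_mem hN hC), ⟨∅, hN.empty_mem, ZFSet.omega_zero,
      fun z _ => ZFSet.notMem_empty z⟩, fun x hx hxo => ⟨insert x x, hN.insert_mem hx hx,
      ZFSet.omega_succ hxo, fun z _ => ZFSet.mem_insert_iff.trans or_comm⟩⟩
  · intro φ hφ a ha
    have hd : Dp (hull C) fun v : Fin 1 → ZFSet.{u} => ∃ hx : v 0 ∈ hull C, φ ⟨v 0, hx⟩ := by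
      refine ⟨?_⟩
      unfold Def₁ at hφ
      convert hφ using 1
      ext v
      exact ⟨fun ⟨_, h⟩ => h, fun h => ⟨(v 0).2, h⟩⟩
    refine ⟨_, hN.sep_mem (fun x => ∃ hx : x ∈ hull C, φ ⟨x, hx⟩) hd ha, fun x => ?_⟩
    rw [ZFSet.mem_sep]
    exact and_congr_right fun _ => ⟨fun ⟨_, h⟩ => h, fun h => ⟨x.2, h⟩⟩
  · intro φ hφ a ha hex
    have hd : Dp (hull C) fun v : Fin 2 → ZFSet.{u} =>
        ∃ (hx : v 0 ∈ hull C) (hy : v 1 ∈ hull C), φ ⟨v 0, hx⟩ ⟨v 1, hy⟩ := by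
      refine ⟨?_⟩
      unfold Def₂ at hφ
      convert hφ using 1
      ext v
      exact ⟨fun ⟨_, _, h⟩ => h, fun h => ⟨(v 0).2, (v 1).2, h⟩⟩
    obtain ⟨b, hb, hb'⟩ := hN.coll (fun x y => ∃ (hx : x ∈ hull C) (hy : y ∈ hull C), φ ⟨x, hx⟩ ⟨y, hy⟩)
      hd ha (fun x hx => by
        obtain ⟨y, hy⟩ := hex ⟨x, hN.mem_of_mem ha hx⟩ hx
        exact ⟨y.1, y.2, _, y.2, hy⟩)
    refine ⟨b, hb, fun x hx => ?_⟩
    obtain ⟨y, hy, _, hyN, hp⟩ := hb' x.1 hx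
    exact ⟨⟨y, hyN⟩, hy, hp⟩
  · intro x hx
    exact hN.exists_wellOrders hx hκN hord (hinj x hx)
  · rcases hord.mem_or_subset hμ.2.1 with hm | hm
    · exact (hμ.2.2 _ hm (hinj μ hμ.1)).elim
    · exact hm


/-! ### Uniqueness of the associated set model -/

/-- An injection of a transitive set `t` into `κ` copies the membership relation of `t` to `κ`. -/
theorem IsZF.exists_copy {N : ZFSet.{u}} (h : IsZF N) {t κ M : ZFSet.{u}} (ht : t ∈ N)
    (htt : t.IsTransitive) (hM : M ∈ N) (hκM : κ ⊆ M)
    (hpair : ∀ {x y}, x ∈ M → y ∈ M → ZFSet.pair x y ∈ M) (hinj : InjIn N t κ) :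
    ∃ E ∈ N, E ⊆ M ∧ WellFounded (PairRel E) ∧ ∃ G : ZFSet.{u} → ZFSet.{u}, (∀ y ∈ t, G y ∈ κ) ∧
      (∀ y ∈ t, ∀ z ∈ t, G y = G z → y = z) ∧
      (∀ a b, PairRel E a b ↔ ∃ z ∈ t, ∃ y ∈ z, a = G y ∧ b = G z) ∧
      ∀ y ∈ t, collapse E (G y) = y := by
  have := Fact.mk h.trans
  obtain ⟨f, hf, hfi⟩ := hinj
  obtain ⟨G, hG, hGf, hGi, -⟩ := hfi.exists_fun
  have := Fact.mk hf
  have := Fact.mk ht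
  have hE := h.sep_mem (fun p => ∃ z ∈ t, ∃ y ∈ z, ∃ a, PairRel f y a ∧ ∃ b, PairRel f z b ∧
    p = ZFSet.pair a b) inferInstance hM
  set E := M.sep fun p => ∃ z ∈ t, ∃ y ∈ z, ∃ a, PairRel f y a ∧ ∃ b, PairRel f z b ∧
    p = ZFSet.pair a b with hEdef
  have hiff : ∀ a b, PairRel E a b ↔ ∃ z ∈ t, ∃ y ∈ z, a = G y ∧ b = G z := by
    intro a b
    rw [PairRel, hEdef, ZFSet.mem_sep]
    constructor
    · rintro ⟨-, z, hz, y, hy, a', ha, b', hb, e⟩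
      obtain ⟨rfl, rfl⟩ := ZFSet.pair_inj.1 e
      exact ⟨z, hz, y, hy, (hGf y (htt.mem_trans hy hz) _).1 ha, (hGf z hz _).1 hb⟩
    · rintro ⟨z, hz, y, hy, rfl, rfl⟩
      have hyt := htt.mem_trans hy hz
      exact ⟨hpair (hκM (hG y hyt)) (hκM (hG z hz)), z, hz, y, hy, _, (hGf y hyt _).2 rfl, _,
        (hGf z hz _).2 rfl, rfl⟩
  have hpred : ∀ z ∈ t, ∀ a, PairRel E a (G z) ↔ ∃ y ∈ z, a = G y := by
    intro z hz a
    rw [hiff]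
    constructor
    · rintro ⟨z', hz', y, hy, rfl, e⟩
      obtain rfl := hGi z hz z' hz' e
      exact ⟨y, hy, rfl⟩
    · rintro ⟨y, hy, rfl⟩
      exact ⟨z, hz, y, hy, rfl, rfl⟩
  have hacc : ∀ z ∈ t, Acc (PairRel E) (G z) := by
    intro z
    induction z using ZFSet.inductionOn with
    | _ z ih =>
      intro hz
      constructor
      intro a ha
      obtain ⟨y, hy, rfl⟩ := (hpred z hz a).1 ha
      exact ih y hy (htt.mem_trans hy hz)
  have hwf : WellFounded (PairRel E) := ⟨fun b => ⟨b, fun a ha => by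
    obtain ⟨z, hz, y, hy, rfl, -⟩ := (hiff a b).1 ha
    exact hacc y (htt.mem_trans hy hz)⟩⟩
  refine ⟨E, hE, ZFSet.sep_subset, hwf, G, hG, hGi, hiff, fun z => ?_⟩
  induction z using ZFSet.inductionOn with
  | _ z ih =>
    intro hz
    ext y
    rw [mem_collapse hwf]
    constructor
    · rintro ⟨a, ha, rfl⟩
      obtain ⟨y, hy, rfl⟩ := (hpred z hz a).1 ha
      rwa [ih y hy (htt.mem_trans hy hz)]
    · intro hy
      exact ⟨G y, (hpred z hz _).2 ⟨y, hy, rfl⟩, ih y hy (htt.mem_trans hy hz)⟩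

/-- The hull is the only transitive set that satisfies the characterization. -/
theorem IsAssociated.eq_hull {M C N : ZFSet.{u}} (h : IsModelMK M C) (hA : IsAssociated M C N) :
    N = hull C := by
  have hN := hA.model.toIsModelZFCminus.isZF hA.transitive
  obtain ⟨κ, hM, hlarge, hκ⟩ := hA.sets_eq
  have hch := hA.model.choice
  have hMN : M ∈ N := hM ▸ hκ.VIn_mem hN hch
  have hC : ∀ {X}, X ∈ C ↔ X ∈ N ∧ X ⊆ M := hN.mem_classes_iff hMN hA.classes_eq
  have hκM : κ ⊆ M := hM ▸ hκ.subset_VIn hN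
  obtain ⟨μ, hμ, hinj, -⟩ := hA.model.inaccessible
  -- The sets of `N` inject into the cardinal `μ` of the axioms, which is at most the largest
  -- cardinal `κ`; so the copies live on elements of `M`.
  have hμκ : μ ⊆ κ := hlarge.2 μ hμ.cardinal
  ext x
  constructor
  · intro hx
    obtain ⟨t, ht, htt, hxt⟩ := hN.exists_transitive hx
    obtain ⟨E, hE, hEM, hwf, G, hG, -, -, hcol⟩ := hN.exists_copy ht htt hMN (hμκ.trans hκM) h.pair_mem
      (hinj t ht)
    rw [← hcol x hxt]
    exact h.collapse_mem_hull (hC.2 ⟨hE, hEM⟩) hwf (hκM (hμκ (hG x hxt)))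
  · intro hx
    obtain ⟨X, hX, hwf, rfl⟩ := mem_hull.1 hx
    exact (hN.exists_sim hwf (hC.1 hX).1 hN.empty_mem).1


/-! ### Isomorphisms of subtrees -/

theorem SubtreeIso.symm {M₀ R y z : ZFSet.{u}} (h : SubtreeIso M₀ R y z) : SubtreeIso M₀ R z y :=
  h.map RelIso.symm

section Subtree

variable {M₀ R : ZFSet.{u}} (hR : ∀ a b, PairRel R a b → a ∈ M₀ ∧ b ∈ M₀)
include hR

theorem reflTransGen_subrel {y : ZFSet.{u}} {u v : {w // InSubtree M₀ R y w}}
    (huv : Relation.ReflTransGen (PairRel R) u.1 v.1) :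
    Relation.ReflTransGen (Subrel (PairRel R) (InSubtree M₀ R y)) u v := by
  obtain ⟨u, hu⟩ := u
  replace huv : Relation.ReflTransGen (PairRel R) u v.1 := huv
  induction huv using Relation.ReflTransGen.head_induction_on with
  | refl => exact Relation.ReflTransGen.refl
  | @head c d hcd hdv ih =>
    have hd : InSubtree M₀ R y d := ⟨(hR c d hcd).2, hdv.trans v.2.2⟩
    have hcd' : Subrel (PairRel R) (InSubtree M₀ R y) ⟨c, hu⟩ ⟨d, hd⟩ := hcd
    exact .head hcd' (ih hd)

theorem reflTransGen_map {y z : ZFSet.{u}}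
    (e : Subrel (PairRel R) (InSubtree M₀ R y) ≃r Subrel (PairRel R) (InSubtree M₀ R z))
    {u v : {w // InSubtree M₀ R y w}} (huv : Relation.ReflTransGen (PairRel R) u.1 v.1) :
    Relation.ReflTransGen (PairRel R) (e u).1 (e v).1 :=
  (reflTransGen_subrel hR huv).lift (fun w => (e w).1) fun _ _ hab => e.map_rel_iff.2 hab

theorem subtreeIso_restrict {y z : ZFSet.{u}}
    (e : Subrel (PairRel R) (InSubtree M₀ R y) ≃r Subrel (PairRel R) (InSubtree M₀ R z))
    (w : {w // InSubtree M₀ R y w}) : SubtreeIso M₀ R w.1 (e w).1 := by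
  have h1 : ∀ v, InSubtree M₀ R w.1 v → InSubtree M₀ R y v := fun v hv => ⟨hv.1, hv.2.trans w.2.2⟩
  have h2 : ∀ v, InSubtree M₀ R (e w).1 v → InSubtree M₀ R z v := fun v hv =>
    ⟨hv.1, hv.2.trans (e w).2.2⟩
  refine ⟨⟨⟨fun v => ⟨(e ⟨v.1, h1 _ v.2⟩).1, (e ⟨v.1, h1 _ v.2⟩).2.1, reflTransGen_map hR e v.2.2⟩,
    fun v => ⟨(e.symm ⟨v.1, h2 _ v.2⟩).1, (e.symm ⟨v.1, h2 _ v.2⟩).2.1, ?_⟩, ?_, ?_⟩, ?_⟩⟩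
  · have := reflTransGen_map hR e.symm (u := ⟨v.1, h2 _ v.2⟩) (v := e w) v.2.2
    rwa [e.symm_apply_apply] at this
  · intro v
    apply Subtype.ext
    simp
  · intro v
    apply Subtype.ext
    simp
  · intro u v
    exact e.map_rel_iff

/-- The top is reached from every node of its subtree, so its image and `z` reach each other; if
they were different, `R` would have a cycle. -/
theorem subtreeIso_top (hwf : WellFounded (PairRel R)) {y z : ZFSet.{u}} (hy : y ∈ M₀) (hz : z ∈ M₀)
    (e : Subrel (PairRel R) (InSubtree M₀ R y) ≃r Subrel (PairRel R) (InSubtree M₀ R z)) :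
    (e ⟨y, hy, .refl⟩).1 = z := by
  set t : {w // InSubtree M₀ R z w} := ⟨z, hz, .refl⟩ with ht
  have h1 : Relation.ReflTransGen (PairRel R) z (e ⟨y, hy, .refl⟩).1 := by
    have := reflTransGen_map hR e (u := e.symm t) (v := ⟨y, hy, .refl⟩) (e.symm t).2.2
    rwa [e.apply_symm_apply] at this
  have h2 : Relation.ReflTransGen (PairRel R) (e ⟨y, hy, .refl⟩).1 z := (e ⟨y, hy, .refl⟩).2.2
  rcases Relation.reflTransGen_iff_eq_or_transGen.1 h1 with h3 | h3
  · exact h3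
  · exact (hwf.transGen.irrefl.irrefl _ (h3.trans_left h2)).elim

theorem SubtreeIso.exists_child (hwf : WellFounded (PairRel R)) {y z w : ZFSet.{u}} (hy : y ∈ M₀)
    (hz : z ∈ M₀) (h : SubtreeIso M₀ R y z) (hw : PairRel R w y) :
    ∃ v, PairRel R v z ∧ SubtreeIso M₀ R w v := by
  obtain ⟨e⟩ := h
  let w' : {v // InSubtree M₀ R y v} := ⟨w, (hR _ _ hw).1, .single hw⟩
  refine ⟨(e w').1, ?_, subtreeIso_restrict hR e w'⟩
  have : PairRel R (e w').1 (e ⟨y, hy, .refl⟩).1 := e.map_rel_iff.2 hw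
  rwa [subtreeIso_top hR hwf hy hz e] at this

/-- By restriction, an isomorphism of subtrees matches children with isomorphic subtrees, so it acts
as a bisimulation. -/
theorem SubtreeIso.collapse_eq (hwf : WellFounded (PairRel R)) {y z : ZFSet.{u}} (hy : y ∈ M₀)
    (hz : z ∈ M₀) (h : SubtreeIso M₀ R y z) : collapse R y = collapse R z := by
  induction y using hwf.induction generalizing z with
  | _ y ih =>
    ext u
    rw [mem_collapse hwf, mem_collapse hwf]
    constructor
    · rintro ⟨b, hb, rfl⟩
      obtain ⟨v, hv, hbv⟩ := h.exists_child hR hwf hy hz hb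
      exact ⟨v, hv, (ih b hb (hR _ _ hb).1 (hR _ _ hv).1 hbv).symm⟩
    · rintro ⟨v, hv, rfl⟩
      obtain ⟨b, hb, hvb⟩ := (h.symm).exists_child hR hwf hz hy hv
      exact ⟨b, hb, ih b hb (hR _ _ hb).1 (hR _ _ hv).1 (hvb.symm)⟩

end Subtree

theorem IsCodingPair.mem_of_pairRel {C M₀ R a x y : ZFSet.{u}} (h : IsCodingPair C M₀ R a)
    (hxy : PairRel R x y) : x ∈ M₀ ∧ y ∈ M₀ := by
  obtain ⟨x', hx, y', hy, e⟩ := h.relation _ hxy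
  obtain ⟨rfl, rfl⟩ := ZFSet.pair_inj.1 e
  exact ⟨hx, hy⟩

theorem RChain.reflTransGen {R : ZFSet.{u}} {n : ℕ} {z a : ZFSet.{u}} (h : RChain R n z a) :
    Relation.ReflTransGen (PairRel R) z a := by
  induction n generalizing z with
  | zero => rw [show z = a from h]
  | succ n ih =>
    obtain ⟨w, hw, hwa⟩ := h
    exact .head hw (ih hwa)

/-- The set that is coded by a coding pair is the collapse of its distinguished element. -/
theorem IsCodingPair.collapse_eq {C M₀ R a x : ZFSet.{u}} (h : IsCodingPair C M₀ R a)
    (hx : Codes M₀ R x) : collapse R a = x := by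
  have hR : ∀ a b, PairRel R a b → a ∈ M₀ ∧ b ∈ M₀ := fun _ _ => h.mem_of_pairRel
  obtain ⟨c⟩ := hx
  have hcol : ∀ z (hz : z ∈ M₀), collapse R z = (c (Quotient.mk _ ⟨z, hz⟩)).1 := by
    intro z
    induction z using h.wf.induction with
    | _ z ih =>
      intro hz
      ext y
      rw [mem_collapse h.wf]
      constructor
      · rintro ⟨b, hb, rfl⟩
        have hbM := (hR _ _ hb).1
        rw [ih b hb hbM]
        exact c.map_rel_iff.2 ⟨⟨b, hbM⟩, ⟨z, hz⟩, rfl, rfl, hb⟩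
      · intro hy
        let y' : TCSingleton x := ⟨y, .head hy (c (Quotient.mk _ ⟨z, hz⟩)).2⟩
        obtain ⟨p, hp⟩ := c.surjective y'
        have hq : quotRel M₀ R p (Quotient.mk _ ⟨z, hz⟩) := c.map_rel_iff.1 (by rw [hp]; exact hy)
        obtain ⟨w, z', rfl, hz', hwz⟩ := hq
        -- The quotient relation provides a child of some node equivalent to `z`; the isomorphism
        -- moves it to a child of `z` itself.
        have hiso : SubtreeIso M₀ R z'.1 z := Quotient.exact hz'
        obtain ⟨v, hv, hwv⟩ := hiso.exists_child hR h.wf z'.2 hz hwz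
        have hvM := (hR _ _ hv).1
        refine ⟨v, hv, ?_⟩
        rw [ih v hv hvM]
        have : (Quotient.mk (nodeSetoid M₀ R) ⟨v, hvM⟩) = Quotient.mk _ w :=
          Quotient.sound (hwv.symm)
        rw [this, hp]
  have hmem : ∀ y z, PairRel R y z → collapse R y ∈ collapse R z := fun y z hyz =>
    (mem_collapse h.wf).2 ⟨y, hyz, rfl⟩
  -- It is not given that the isomorphism sends the class of `a` to `x`. Let it send the class of
  -- `w` to `x`. As `w` is joined to `a` by a chain, `x` is below or equal to `collapse R a`, which
  -- in turn lies in `TC({x})`; well-foundedness of membership makes them equal.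
  obtain ⟨p, hp⟩ := c.surjective ⟨x, .refl⟩
  obtain ⟨⟨w, hw⟩, rfl⟩ := Quotient.exists_rep p
  have hwx : collapse R w = x := by rw [hcol w hw, hp]
  obtain ⟨n, hn, -⟩ := h.level w hw
  have h1 : Relation.ReflTransGen (fun s t : ZFSet.{u} => s ∈ t) (collapse R w) (collapse R a) :=
    hn.reflTransGen.lift _ hmem
  have h2 : Relation.ReflTransGen (fun s t : ZFSet.{u} => s ∈ t) (collapse R a) x := by
    rw [hcol a h.top_mem]
    exact (c (Quotient.mk _ ⟨a, h.top_mem⟩)).2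
  rw [hwx] at h1
  rcases Relation.reflTransGen_iff_eq_or_transGen.1 h1 with h3 | h3
  · exact h3
  · exact (ZFSet.mem_wf.transGen.irrefl.irrefl _ (h3.trans_left h2)).elim

/-- A coding pair in which nodes with the same collapse have isomorphic subtrees codes the collapse of
its distinguished element. -/
theorem IsCodingPair.codes {C M₀ R a : ZFSet.{u}} (h : IsCodingPair C M₀ R a)
    (hiso : ∀ y ∈ M₀, ∀ z ∈ M₀, collapse R y = collapse R z → SubtreeIso M₀ R y z) :
    Codes M₀ R (collapse R a) := by
  have hR : ∀ a b, PairRel R a b → a ∈ M₀ ∧ b ∈ M₀ := fun _ _ => h.mem_of_pairRel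
  have hmem : ∀ y z, PairRel R y z → collapse R y ∈ collapse R z := fun y z hyz =>
    (mem_collapse h.wf).2 ⟨y, hyz, rfl⟩
  let F : Quotient (nodeSetoid M₀ R) → TCSingleton (collapse R a) := Quotient.lift
    (fun y => ⟨collapse R y.1, by
      obtain ⟨n, hn, -⟩ := h.level y.1 y.2
      exact hn.reflTransGen.lift _ hmem⟩)
    fun y z hyz => Subtype.ext (SubtreeIso.collapse_eq hR h.wf y.2 z.2 hyz)
  have hF : Function.Bijective F := by
    constructor
    · intro p q
      refine Quotient.inductionOn₂ p q fun y z e => Quotient.sound ?_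
      exact hiso y.1 y.2 z.1 z.2 (congrArg Subtype.val e)
    · rintro ⟨y, hy⟩
      suffices ∃ s ∈ M₀, collapse R s = y by
        obtain ⟨s, hs, e⟩ := this
        exact ⟨Quotient.mk _ ⟨s, hs⟩, Subtype.ext e⟩
      induction hy using Relation.ReflTransGen.head_induction_on with
      | refl => exact ⟨a, h.top_mem, rfl⟩
      | head hcd _ ih =>
        obtain ⟨s, hs, rfl⟩ := ih
        obtain ⟨b, hb, e⟩ := (mem_collapse h.wf).1 hcd
        exact ⟨b, (hR _ _ hb).1, e⟩
  refine ⟨⟨Equiv.ofBijective F hF, ?_⟩⟩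
  intro p q
  refine Quotient.inductionOn₂ p q fun y z => ?_
  change collapse R y.1 ∈ collapse R z.1 ↔ _
  constructor
  · intro hyz
    obtain ⟨b, hb, e⟩ := (mem_collapse h.wf).1 hyz
    have hbM := (hR _ _ hb).1
    exact ⟨⟨b, hbM⟩, z, Quotient.sound (hiso b hbM y.1 y.2 e), rfl, hb⟩
  · rintro ⟨y', z', hy, hz, hyz⟩
    have h1 : SubtreeIso M₀ R y'.1 y.1 := Quotient.exact hy
    have h2 : SubtreeIso M₀ R z'.1 z.1 := Quotient.exact hz
    rw [← h1.collapse_eq hR h.wf y'.2 y.2, ← h2.collapse_eq hR h.wf z'.2 z.2]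
    exact hmem _ _ hyz

/-! ### The tree of a well-founded relation -/

/-- `s` is a node with label `l` in the tree of descending paths of `E` from `r`. -/
inductive IsNode (E r : ZFSet.{u}) : ZFSet.{u} → ZFSet.{u} → Prop
  | root : IsNode E r (ZFSet.pair ∅ r) r
  | child {s l m : ZFSet.{u}} : IsNode E r s l → PairRel E m l → IsNode E r (ZFSet.pair s m) m

namespace IsNode

variable {E r : ZFSet.{u}}

theorem exists_eq_pair {s l : ZFSet.{u}} (h : IsNode E r s l) : ∃ q, s = ZFSet.pair q l := by
  cases h with
  | root => exact ⟨_, rfl⟩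
  | child _ _ => exact ⟨_, rfl⟩

theorem ne_empty {s l : ZFSet.{u}} (h : IsNode E r s l) : s ≠ ∅ := by
  obtain ⟨q, rfl⟩ := h.exists_eq_pair
  exact pair_ne_empty _ _

theorem label_unique {s l m : ZFSet.{u}} (h : IsNode E r s l) (h' : IsNode E r s m) : l = m := by
  obtain ⟨q, rfl⟩ := h.exists_eq_pair
  obtain ⟨q', e⟩ := h'.exists_eq_pair
  exact (ZFSet.pair_inj.1 e).2

/-- A node is the nested pair of the labels on its path, so its parent and label can be read off.
Since `∅` is not a node, the root is not mistaken for a child. -/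
theorem of_child {s l m k : ZFSet.{u}} (h : IsNode E r s l) (h' : IsNode E r (ZFSet.pair s m) k) :
    PairRel E m l := by
  generalize hq : ZFSet.pair s m = q at h'
  cases h' with
  | root => exact (h.ne_empty (ZFSet.pair_inj.1 hq).1).elim
  | child h'' hp =>
    obtain ⟨rfl, rfl⟩ := ZFSet.pair_inj.1 hq
    rwa [h.label_unique h'']

end IsNode

/-- Extension of the node `y` by a path, whose last entry comes first. -/
noncomputable def extend (y : ZFSet.{u}) : List ZFSet.{u} → ZFSet.{u}
  | [] => y
  | m :: ms => ZFSet.pair (extend y ms) m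

/-- `ms` is a descending path of `E` from `l`, whose last entry comes first. -/
def IsPath (E l : ZFSet.{u}) : List ZFSet.{u} → Prop
  | [] => True
  | m :: ms => IsPath E l ms ∧ PairRel E m (ms.headD l)

theorem rank_lt_rank_pair_left (x y : ZFSet.{u}) : x.rank < (ZFSet.pair x y).rank :=
  (ZFSet.rank_lt_of_mem (ZFSet.mem_singleton.2 rfl : x ∈ ({x} : ZFSet))).trans
    (ZFSet.rank_lt_of_mem (by simp [ZFSet.pair] : ({x} : ZFSet) ∈ ZFSet.pair x y))

theorem rank_le_extend (y : ZFSet.{u}) (ms : List ZFSet.{u}) : y.rank ≤ (extend y ms).rank := by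
  induction ms with
  | nil => exact le_rfl
  | cons m ms ih => exact ih.trans (rank_lt_rank_pair_left _ _).le

/-- Paths of different length cannot give the same node, because a proper extension of `y` has
larger rank than `y`. -/
theorem extend_injective (y : ZFSet.{u}) : Function.Injective (extend y) := by
  intro ms
  induction ms with
  | nil =>
    rintro (_ | ⟨m, ms⟩) e
    · rfl
    · have := (rank_le_extend y ms).trans_lt (rank_lt_rank_pair_left (extend y ms) m)
      rw [show ZFSet.pair (extend y ms) m = y from e.symm] at this
      exact (lt_irrefl _ this).elim
  | cons m ms ih =>
    rintro (_ | ⟨m', ms'⟩) e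
    · have := (rank_le_extend y ms).trans_lt (rank_lt_rank_pair_left (extend y ms) m)
      rw [show ZFSet.pair (extend y ms) m = y from e] at this
      exact (lt_irrefl _ this).elim
    · obtain ⟨e1, rfl⟩ := ZFSet.pair_inj.1 (show ZFSet.pair _ _ = ZFSet.pair _ _ from e)
      rw [ih e1]

theorem IsNode.extend {E r s l : ZFSet.{u}} (h : IsNode E r s l) {ms : List ZFSet.{u}}
    (hms : IsPath E l ms) : IsNode E r (extend s ms) (ms.headD l) := by
  induction ms with
  | nil => exact h
  | cons m ms ih => exact (ih hms.1).child hms.2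

/-- `(M₀, R)` is the tree of descending paths of `E` from `r`. -/
structure IsTreeOf (E r M₀ R : ZFSet.{u}) : Prop where
  mem_iff : ∀ s, s ∈ M₀ ↔ ∃ l, IsNode E r s l
  rel_iff : ∀ p, p ∈ R ↔ ∃ s ∈ M₀, ∃ m, ZFSet.pair s m ∈ M₀ ∧ p = ZFSet.pair (ZFSet.pair s m) s

namespace IsTreeOf

variable {E r M₀ R : ZFSet.{u}} (h : IsTreeOf E r M₀ R)
include h

theorem pairRel_iff {s' s l : ZFSet.{u}} (hs : IsNode E r s l) :
    PairRel R s' s ↔ ∃ m, PairRel E m l ∧ s' = ZFSet.pair s m := by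
  rw [PairRel, h.rel_iff]
  constructor
  · rintro ⟨s₁, hs₁, m, hm, e⟩
    obtain ⟨rfl, rfl⟩ := ZFSet.pair_inj.1 e
    obtain ⟨k, hk⟩ := (h.mem_iff _).1 hm
    exact ⟨m, hs.of_child hk, rfl⟩
  · rintro ⟨m, hm, rfl⟩
    exact ⟨s, (h.mem_iff s).2 ⟨l, hs⟩, m, (h.mem_iff _).2 ⟨m, hs.child hm⟩, rfl⟩

theorem exists_parent {s' s : ZFSet.{u}} (hp : PairRel R s' s) :
    s' ∈ M₀ ∧ s ∈ M₀ ∧ ∃ m, s' = ZFSet.pair s m := by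
  obtain ⟨s₁, hs₁, m, hm, e⟩ := (h.rel_iff _).1 hp
  obtain ⟨rfl, rfl⟩ := ZFSet.pair_inj.1 e
  exact ⟨hm, hs₁, m, rfl⟩

theorem parent_unique {v y z : ZFSet.{u}} (hy : PairRel R v y) (hz : PairRel R v z) : y = z := by
  obtain ⟨-, -, m, rfl⟩ := h.exists_parent hy
  obtain ⟨-, -, k, e⟩ := h.exists_parent hz
  exact (ZFSet.pair_inj.1 e).1

theorem wf (hE : WellFounded (PairRel E)) : WellFounded (PairRel R) := by
  have hacc : ∀ l s, IsNode E r s l → Acc (PairRel R) s := by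
    intro l
    induction l using hE.induction with
    | _ l ih =>
      intro s hs
      constructor
      intro s' hs'
      obtain ⟨m, hm, rfl⟩ := (h.pairRel_iff hs).1 hs'
      exact ih m hm _ (hs.child hm)
  refine ⟨fun s => ⟨s, fun s' hs' => ?_⟩⟩
  obtain ⟨l, hl⟩ := (h.mem_iff s').1 (h.exists_parent hs').1
  exact hacc l s' hl

theorem collapse_eq (hE : WellFounded (PairRel E)) {s l : ZFSet.{u}} (hs : IsNode E r s l) :
    collapse R s = collapse E l := by
  induction l using hE.induction generalizing s with
  | _ l ih =>
    ext y
    rw [mem_collapse (h.wf hE), mem_collapse hE]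
    constructor
    · rintro ⟨s', hs', rfl⟩
      obtain ⟨m, hm, rfl⟩ := (h.pairRel_iff hs).1 hs'
      exact ⟨m, hm, (ih m hm (hs.child hm)).symm⟩
    · rintro ⟨m, hm, rfl⟩
      exact ⟨_, (h.pairRel_iff hs).2 ⟨m, hm, rfl⟩, ih m hm (hs.child hm)⟩

theorem not_rel_root {s : ZFSet.{u}} : ¬ PairRel R (ZFSet.pair ∅ r) s := by
  intro hp
  obtain ⟨-, hs, m, e⟩ := h.exists_parent hp
  obtain ⟨l, hl⟩ := (h.mem_iff s).1 hs
  exact hl.ne_empty (ZFSet.pair_inj.1 e).1.symm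

theorem level {s l : ZFSet.{u}} (hs : IsNode E r s l) : ∃! n, RChain R n s (ZFSet.pair ∅ r) := by
  induction hs with
  | root =>
    refine ⟨0, rfl, fun n hn => ?_⟩
    cases n with
    | zero => rfl
    | succ n =>
      obtain ⟨w, hw, -⟩ := hn
      exact (h.not_rel_root hw).elim
  | @child s l m hs hm ih =>
    obtain ⟨n, hn, huniq⟩ := ih
    have hp : PairRel R (ZFSet.pair s m) s := (h.pairRel_iff hs).2 ⟨m, hm, rfl⟩
    refine ⟨n + 1, ⟨s, hp, hn⟩, fun k hk => ?_⟩
    cases k with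
    | zero =>
      rw [show ZFSet.pair s m = ZFSet.pair ∅ r from hk] at hp
      exact (h.not_rel_root hp).elim
    | succ k =>
      obtain ⟨w, hw, hk⟩ := hk
      obtain rfl := h.parent_unique hp hw
      rw [huniq k hk]

/-- The subtree of a node consists of the descending paths from its label. -/
theorem nonempty_path_iso {s l : ZFSet.{u}} (hs : IsNode E r s l) :
    Nonempty ((fun p q : {ms // IsPath E l ms} => ∃ m, p.1 = m :: q.1) ≃r
      Subrel (PairRel R) (InSubtree M₀ R s)) := by
  have hmem : ∀ ms, IsPath E l ms → InSubtree M₀ R s (extend s ms) := by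
    intro ms
    induction ms with
    | nil => exact fun _ => ⟨(h.mem_iff s).2 ⟨l, hs⟩, .refl⟩
    | cons m ms ih =>
      intro hms
      exact ⟨(h.mem_iff _).2 ⟨_, hs.extend hms⟩,
        .head ((h.pairRel_iff (hs.extend hms.1)).2 ⟨m, hms.2, rfl⟩) (ih hms.1).2⟩
  let F : {ms // IsPath E l ms} → {w // InSubtree M₀ R s w} := fun p => ⟨extend s p.1, hmem p.1 p.2⟩
  have hF : Function.Bijective F := by
    constructor
    · intro p q e
      exact Subtype.ext (extend_injective s (congrArg Subtype.val e))
    · rintro ⟨w, hw⟩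
      suffices ∃ ms, IsPath E l ms ∧ extend s ms = w by
        obtain ⟨ms, hms, e⟩ := this
        exact ⟨⟨ms, hms⟩, Subtype.ext e⟩
      obtain ⟨-, hw⟩ := hw
      induction hw using Relation.ReflTransGen.head_induction_on with
      | refl => exact ⟨[], trivial, rfl⟩
      | head hcd _ ih =>
        obtain ⟨ms, hms, rfl⟩ := ih
        obtain ⟨m, hm, rfl⟩ := (h.pairRel_iff (hs.extend hms)).1 hcd
        exact ⟨m :: ms, ⟨hms, hm⟩, rfl⟩
  refine ⟨⟨Equiv.ofBijective F hF, ?_⟩⟩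
  intro p q
  change PairRel R (extend s p.1) (extend s q.1) ↔ _
  rw [h.pairRel_iff (hs.extend q.2)]
  constructor
  · rintro ⟨m, hm, e⟩
    exact ⟨m, extend_injective s e⟩
  · rintro ⟨m, e⟩
    have hp := p.2
    rw [e] at hp
    exact ⟨m, hp.2, by rw [e]; rfl⟩

/-- Both subtrees are isomorphic to the lists of descending paths from the common label. -/
theorem subtreeIso {y z l : ZFSet.{u}} (hy : IsNode E r y l) (hz : IsNode E r z l) :
    SubtreeIso M₀ R y z := by
  obtain ⟨e⟩ := h.nonempty_path_iso hy
  obtain ⟨f⟩ := h.nonempty_path_iso hz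
  exact ⟨e.symm.trans f⟩

/-- The tree of an extensional well-founded relation is a coding pair. -/
theorem isCodingPair_and_codes {C : ZFSet.{u}} (hM : M₀ ∈ C) (hR : R ∈ C)
    (hE : WellFounded (PairRel E)) (hext : ∀ s l, IsNode E r s l → ∀ t m, IsNode E r t m →
      collapse E l = collapse E m → l = m) :
    IsCodingPair C M₀ R (ZFSet.pair ∅ r) ∧ Codes M₀ R (collapse E r) := by
  have hwf := h.wf hE
  have hrel : ∀ a b, PairRel R a b → a ∈ M₀ ∧ b ∈ M₀ := fun a b hab =>
    ⟨(h.exists_parent hab).1, (h.exists_parent hab).2.1⟩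
  have hcp : IsCodingPair C M₀ R (ZFSet.pair ∅ r) := by
    refine ⟨hM, hR, (h.mem_iff _).2 ⟨_, .root⟩, ?_, ?_, ?_, ?_, hwf⟩
    · intro p hp
      obtain ⟨s, hs, m, hm, rfl⟩ := (h.rel_iff p).1 hp
      exact ⟨_, hm, s, hs, rfl⟩
    · intro z hz
      obtain ⟨l, hl⟩ := (h.mem_iff z).1 hz
      exact h.level hl
    · intro x hx y hy z hz hne hyx hzx hiso
      obtain ⟨l, hl⟩ := (h.mem_iff x).1 hx
      obtain ⟨m, hm, rfl⟩ := (h.pairRel_iff hl).1 hyx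
      obtain ⟨k, hk, rfl⟩ := (h.pairRel_iff hl).1 hzx
      -- Siblings with isomorphic subtrees have labels with equal collapses; by extensionality the
      -- labels, and hence the siblings, are equal.
      have e := hiso.collapse_eq hrel hwf hy hz
      rw [h.collapse_eq hE (hl.child hm), h.collapse_eq hE (hl.child hk)] at e
      exact hne (by rw [hext _ _ (hl.child hm) _ _ (hl.child hk) e])
    · intro n y hy z hz _ _ hne v hvy hvz
      exact hne (h.parent_unique hvy hvz)
  refine ⟨hcp, ?_⟩
  rw [← h.collapse_eq hE .root]
  refine hcp.codes fun y hy z hz e => ?_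
  obtain ⟨l, hl⟩ := (h.mem_iff y).1 hy
  obtain ⟨m, hm⟩ := (h.mem_iff z).1 hz
  rw [h.collapse_eq hE hl, h.collapse_eq hE hm] at e
  obtain rfl := hext _ _ hl _ _ hm e
  exact h.subtreeIso hl hm

end IsTreeOf

/-- The inductive `IsNode` has to be replaced by a formula: `s` is a node iff it belongs to a set `F
∈ M` each of whose elements is the root or a child of another element of `F`. Such an `F` is built
along the path to `s`; conversely, parents have smaller rank, so induction on the rank shows that
all elements of `F` are nodes. -/
theorem IsModelMK.exists_isTreeOf {M C : ZFSet.{u}} (h : IsModelMK M C) {E r : ZFSet.{u}} (hE : E ∈ C)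
    (hr : r ∈ M) : ∃ M₀ ∈ C, ∃ R ∈ C, IsTreeOf E r M₀ R := by
  have := Fact.mk h.transitive_classes
  have := Fact.mk hE
  have := Fact.mk h.sets_mem_classes
  have hMC : ∀ {x}, x ∈ M → x ∈ C := fun hx => h.sets_subset_classes hx
  have hroot : ZFSet.pair ∅ r ∈ M := h.pair_mem h.empty_mem hr
  obtain ⟨a, ha⟩ : ∃ a, a = ZFSet.pair ∅ r := ⟨_, rfl⟩
  rw [← ha] at hroot
  have := Fact.mk (hMC hroot)
  let A : ZFSet.{u} → Prop := fun F => ∀ u ∈ F, u = a ∨ ∃ v ∈ F, ∃ q ∈ M, ∃ l ∈ M, ∃ m ∈ M,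
    v = ZFSet.pair q l ∧ u = ZFSet.pair v m ∧ PairRel E m l
  have hAnode : ∀ F, A F → ∀ u ∈ F, ∃ l, IsNode E r u l := by
    intro F hF u
    induction hn : u.rank using WellFoundedLT.induction generalizing u with
    | _ n ih =>
      intro hu
      rcases hF u hu with rfl | ⟨v, hv, q, -, l, -, m, -, rfl, rfl, hm⟩
      · exact ⟨r, ha ▸ .root⟩
      · obtain ⟨k, hk⟩ := ih _ (hn ▸ rank_lt_rank_pair_left _ _) _ rfl hv
        obtain ⟨q', e⟩ := hk.exists_eq_pair
        obtain ⟨rfl, rfl⟩ := ZFSet.pair_inj.1 e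
        exact ⟨m, hk.child hm⟩
  have hnodeA : ∀ s l, IsNode E r s l → ∃ F ∈ M, A F ∧ s ∈ F := by
    intro s l hs
    induction hs with
    | root =>
      rw [← ha]
      exact ⟨{a}, h.singleton_mem hroot, fun u hu => Or.inl (ZFSet.mem_singleton.1 hu),
        ZFSet.mem_singleton.2 rfl⟩
    | @child s l m hs hm ih =>
      obtain ⟨F, hF, hA, hsF⟩ := ih
      have hsM := h.transitive.mem_trans hsF hF
      obtain ⟨hmM, hlM⟩ := h.pairRel_mem hE hm
      refine ⟨insert (ZFSet.pair s m) F, h.insert_mem (h.pair_mem hsM hmM) hF, fun u hu => ?_,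
        ZFSet.mem_insert _ _⟩
      rcases ZFSet.mem_insert_iff.1 hu with rfl | hu
      · obtain ⟨q, rfl⟩ := hs.exists_eq_pair
        exact Or.inr ⟨_, ZFSet.mem_insert_of_mem _ hsF, q, fst_mem_of_transitive h.transitive hsM, l, hlM,
          m, hmM, rfl, rfl, hm⟩
      · refine (hA u hu).imp_right ?_
        rintro ⟨v, hv, hv'⟩
        exact ⟨v, ZFSet.mem_insert_of_mem _ hv, hv'⟩
  have hM₀ := h.sep_mem (fun s => ∃ F ∈ M, A F ∧ s ∈ F) (by simp only [A]; infer_instance)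
  set M₀ := M.sep fun s => ∃ F ∈ M, A F ∧ s ∈ F with hM₀def
  have hmem : ∀ s, s ∈ M₀ ↔ ∃ l, IsNode E r s l := by
    intro s
    rw [hM₀def, ZFSet.mem_sep]
    constructor
    · rintro ⟨-, F, -, hA, hs⟩
      exact hAnode F hA s hs
    · rintro ⟨l, hl⟩
      obtain ⟨F, hF, hA, hs⟩ := hnodeA s l hl
      exact ⟨h.transitive.mem_trans hs hF, F, hF, hA, hs⟩
  have := Fact.mk hM₀
  have hR := h.sep_mem (fun p => ∃ s ∈ M₀, ∃ m ∈ M, ∃ q ∈ M₀, q = ZFSet.pair s m ∧ p = ZFSet.pair q s)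
    inferInstance
  refine ⟨M₀, hM₀, _, hR, hmem, fun p => ?_⟩
  have hM₀M := h.classes_subset M₀ hM₀
  rw [ZFSet.mem_sep]
  constructor
  · rintro ⟨-, s, hs, m, -, q, hq, rfl, rfl⟩
    exact ⟨s, hs, m, hq, rfl⟩
  · rintro ⟨s, hs, m, hm, rfl⟩
    exact ⟨h.pair_mem (hM₀M hm) (hM₀M hs), s, hs, m, snd_mem_of_transitive h.transitive (hM₀M hm), _, hm,
      rfl, rfl⟩

/-! ### The hull consists of the sets coded by coding pairs -/

theorem IsModelMKss.mem_codedSets_iff {M C : ZFSet.{u}} (h : IsModelMKss M C) (hβ : IsBeta C)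
    {x : ZFSet.{u}} : x ∈ hull C ↔ x ∈ codedSets C := by
  have hMK := h.toIsModelMK
  constructor
  · intro hx
    have hN := hβ.isZF_hull hMK h.class_bounding
    have hC : ∀ {X}, X ∈ C ↔ X ∈ hull C ∧ X ⊆ M := hβ.mem_classes hMK
    -- An arbitrary code of `x` need not be extensional, and its tree could have isomorphic
    -- siblings. A copy of membership on a transitive set that contains `x` has distinct collapses
    -- for distinct labels, so its tree is a coding pair.
    obtain ⟨t, ht, htt, hxt⟩ := hN.exists_transitive hx
    obtain ⟨E, hE, hEM, hwf, G, hG, hGi, hiff, hcol⟩ := hN.exists_copy ht htt (hMK.sets_mem hN hC)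
      (fun α hα => (mem_ordinals.1 hα).1) hMK.pair_mem
      (hβ.injIn_ordinals_of_hull hMK h.class_bounding ht)
    obtain ⟨M₀, hM₀, R, hR, htree⟩ := hMK.exists_isTreeOf (hC.2 ⟨hE, hEM⟩)
      (mem_ordinals.1 (hG x hxt)).1
    have hlab : ∀ s l, IsNode E (G x) s l → ∃ y ∈ t, l = G y := by
      intro s l hs
      cases hs with
      | root => exact ⟨x, hxt, rfl⟩
      | child _ hm =>
        obtain ⟨z, hz, y, hy, e, -⟩ := (hiff _ _).1 hm
        exact ⟨y, htt.mem_trans hy hz, e⟩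
    obtain ⟨h1, h2⟩ := htree.isCodingPair_and_codes hM₀ hR hwf (by
      intro s l hs s' m hs' e
      obtain ⟨y, hy, rfl⟩ := hlab s l hs
      obtain ⟨z, hz, rfl⟩ := hlab s' m hs'
      rw [hcol y hy, hcol z hz] at e
      rw [e])
    rw [hcol x hxt] at h2
    exact ⟨M₀, R, _, h1, h2⟩
  · rintro ⟨M₀, R, a, hcp, hcodes⟩
    rw [← hcp.collapse_eq hcodes]
    exact hMK.collapse_mem_hull hcp.mem_right hcp.wf (hMK.classes_subset M₀ hcp.mem_left hcp.top_mem)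

end ClassTheory

theorem proposition20 :
    (∀ M C : ZFSet.{u}, ClassTheory.IsModelMKss M C → ClassTheory.IsBeta C →
      ∃ N : ZFSet.{u}, (∀ x, x ∈ N ↔ x ∈ ClassTheory.codedSets C) ∧
        ClassTheory.IsAssociated M C N ∧
        ∀ N' : ZFSet.{u}, ClassTheory.IsAssociated M C N' → N' = N) ∧
    (∀ N κ M C : ZFSet.{u}, N.IsTransitive → ClassTheory.IsModelSetMKss N →
      ClassTheory.IsStronglyInaccessibleIn N κ →
      M = ClassTheory.VIn N κ → C = M.powerset ∩ N →
      ClassTheory.IsModelMKss M C ∧ ClassTheory.IsBeta C) := by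
  refine ⟨fun M C h hβ => ⟨ClassTheory.hull C, fun x => h.mem_codedSets_iff hβ,
    h.isAssociated_hull hβ, fun N' hN' => hN'.eq_hull h.toIsModelMK⟩, ?_⟩
  intro N κ M C hN hmod hκ hM hC
  exact hmod.isModelMKss_and_isBeta hN hκ hM hC
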